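/- Let $1\le p<\infty$, and write $L_p=L_p(\mathbb{R}_+)$ for the complex Lebesgue space on $\mathbb{R}_+=(0,\infty)$. Let $D=i\,\frac{d}{dt}$, with domain the set of all $u\in L_p$ that are absolutely continuous on every bounded interval of $\mathbb{R}_+$ and satisfy $u'\in L_p$. Let $q\in L_\infty(\mathbb{R}_+)$ be a real-valued potential of period $1$, $q(t+1)=q(t)$. Let $b_1,b_2\in L_\infty(\mathbb{R}_+)$ and $k_1,k_2\in L_\infty(\mathbb{R}_+\times\mathbb{R}_+)$ be complex-valued. Consider in $L_p$ the perturbed Hill operator $$ (Hu)(t)=(D^2u)(t)+q(t)u(t)+b_1(t)(Du)(t)+b_2(t)u(t)+\int_0^\infty k_1(t,s)(Du)(s)\,ds+\int_0^\infty k_2(t,s)u(s)\,ds $$ on its maximal domain, that is, on the functions $u\in W_p^2(\mathbb{R}_+)$ (meaning $u$ and $Du$ both lie in the domain of $D$; no boundary condition at $0$ is imposed) for which the integrals converge absolutely for almost every $t$ and $Hu\in L_p$. The continuous spectrum of an operator $T$ in a Banach space is understood in the sense in which it may contain eigenvalues: it is the set of all $z\in\mathbb{C}$ for which there is a bounded sequence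 $(u_n)$ in the domain of $T$ that has no convergent subsequence and satisfies $Tu_n-zu_n\to0$. Suppose that for some $\delta>1$: 1. $(1+t)^\delta b_j(t)\in L_\infty(\mathbb{R}_+)$ for $j=1,2$; 2. $k_j(t,s)=0$ for almost all $(t,s)$ with $t>s$, for $j=1,2$; 3. for $j=1,2$ the integral operator $u\mapsto\int_0^\infty(1+t)^\delta k_j(t,s)u(s)\,ds$ is well defined on all of $L_p$ (with integrals absolutely convergent for almost every $t$) and bounded in $L_p$. Let $\lambda$ be a real number that is an interior point, relative to $\mathbb{R}$, of the continuous spectrum of $H$. Then $\lambda$ is not an eigenvalue of $H$; that is, there is no $u\neq0$ in the domain of $H$ with $Hu=\lambda u$. -/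

import Mathlib

open MeasureTheory Set Filter Topology
open scoped ENNReal

/-! ## Spectral notions for unbounded operators -/

section Spectral

variable {E : Type*} [NormedAddCommGroup E] [NormedSpace ℂ E]

/-- `z` is an eigenvalue of the (possibly unbounded) operator `T`. -/
def IsEigenvalue (T : E →ₗ.[ℂ] E) (z : ℂ) : Prop :=
  ∃ u : T.domain, (u : E) ≠ 0 ∧ T u = z • (u : E)

/-- The continuous spectrum of a (possibly unbounded) operator `T`, in the sense in which it may
contain eigenvalues: `z` belongs to it if there is a bounded sequence `uₙ` in the domain of `T`
without convergent subsequences such that `T uₙ - z uₙ → 0`. -/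
def continuousSpectrum (T : E →ₗ.[ℂ] E) : Set ℂ :=
  {z | ∃ u : ℕ → T.domain,
    (∃ C : ℝ, ∀ n, ‖(u n : E)‖ ≤ C) ∧
    (∀ φ : ℕ → ℕ, StrictMono φ → ¬ ∃ x : E, Tendsto (fun n => (u (φ n) : E)) atTop (𝓝 x)) ∧
    Tendsto (fun n => T (u n) - z • (u n : E)) atTop (𝓝 0)}

end Spectral

/-! ## The perturbed Hill operator on the half-line -/

/-- Lebesgue measure on the half-line `(0, ∞)`. -/
noncomputable abbrev halfLine : Measure ℝ := volume.restrict (Ioi (0 : ℝ))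

/-- The complex space `L_p(0, ∞)`. -/
noncomputable abbrev LpHalf (p : ℝ≥0∞) := Lp ℂ p halfLine

/-- The graph of the operator `D = i d/dt` in `L_p(0, ∞)`: the pairs `(u, w)` such that `u` has a
representative `g` that is absolutely continuous on every bounded interval `[0, R]` and satisfies
`i g' = w`, that is `g' = -i w`, almost everywhere. -/
noncomputable def derivGraph (p : ℝ≥0∞) : Submodule ℂ (LpHalf p × LpHalf p) where
  carrier := {x | ∃ g : ℝ → ℂ, x.1 =ᵐ[halfLine] g ∧
    (∀ R : ℝ, 0 < R → AbsolutelyContinuousOnInterval g 0 R) ∧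
    ∀ᵐ t ∂halfLine, HasDerivAt g (-Complex.I * x.2 t) t}
  add_mem' := by
    rintro x y ⟨g, hg, hgc, hgd⟩ ⟨h, hh, hhc, hhd⟩
    refine ⟨g + h, ?_, fun R hR => (hgc R hR).add (hhc R hR), ?_⟩
    · exact (Lp.coeFn_add x.1 y.1).trans (hg.add hh)
    · filter_upwards [hgd, hhd, Lp.coeFn_add x.2 y.2] with t h1 h2 h3
      have := h1.add h2
      rw [Prod.snd_add, h3, Pi.add_apply, mul_add]
      exact this
  zero_mem' := by
    refine ⟨fun _ => 0, Lp.coeFn_zero ℂ p halfLine, fun R _ => ?_, ?_⟩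
    · exact (LipschitzWith.const (0 : ℂ)).lipschitzOnWith.absolutelyContinuousOnInterval
    · filter_upwards [Lp.coeFn_zero ℂ p halfLine] with t h1
      rw [Prod.snd_zero, h1]
      simpa using hasDerivAt_const t (0 : ℂ)
  smul_mem' := by
    rintro c x ⟨g, hg, hgc, hgd⟩
    refine ⟨fun t => c • g t, ?_, fun R hR => (hgc R hR).const_smul c, ?_⟩
    · exact (Lp.coeFn_smul c x.1).trans (hg.const_smul c)
    · filter_upwards [hgd, Lp.coeFn_smul c x.2] with t h1 h2
      have e : -Complex.I * (c • x.2 t) = c • (-Complex.I * x.2 t) := by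
        simp only [smul_eq_mul]
        ring
      rw [Prod.smul_snd, h2, Pi.smul_apply, e]
      exact h1.const_smul c

/-- The function `D u` is determined by `u`. -/
theorem derivGraph_unique {p : ℝ≥0∞} {x : LpHalf p × LpHalf p} (hx : x ∈ derivGraph p)
    (h0 : x.1 = 0) : x.2 = 0 := by
  obtain ⟨g, hg, hgc, hgd⟩ := hx
  rw [h0] at hg
  have hg0 : g =ᵐ[halfLine] fun _ => 0 := hg.symm.trans (Lp.coeFn_zero ℂ p halfLine)
  have hcont : ContinuousOn g (Ioi 0) := by
    intro t ht
    have h1 : ContinuousOn g (uIcc 0 (t + 1)) :=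
      (hgc (t + 1) (by have := mem_Ioi.1 ht; linarith)).continuousOn
    refine (h1.continuousAt ?_).continuousWithinAt
    rw [uIcc_of_le (by have := mem_Ioi.1 ht; linarith)]
    exact Icc_mem_nhds ht (by linarith)
  have hzero : EqOn g (fun _ => 0) (Ioi 0) :=
    Measure.eqOn_open_of_ae_eq hg0 isOpen_Ioi hcont continuousOn_const
  rw [Lp.eq_zero_iff_ae_eq_zero]
  filter_upwards [hgd, ae_restrict_mem measurableSet_Ioi] with t h1 ht
  have h2 : HasDerivAt g 0 t :=
    (hasDerivAt_const t (0 : ℂ)).congr_of_eventuallyEq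
      (hzero.eventuallyEq_of_mem (Ioi_mem_nhds ht))
  have := h1.unique h2
  simpa using this

/-- The graph of the perturbed Hill operator
`(H u)(t) = (D² u)(t) + q(t) u(t) + b₁(t) (D u)(t) + b₂(t) u(t)
  + ∫₀^∞ k₁(t,s) (D u)(s) ds + ∫₀^∞ k₂(t,s) u(s) ds`
on its maximal domain in `L_p(0, ∞)`: `u`, `v = D u` and `w = D² u` lie in `L_p(0, ∞)`, the two
integrals converge absolutely for almost every `t`, and `f = H u` lies in `L_p(0, ∞)`. -/
noncomputable def hillGraph (p : ℝ≥0∞) (q : ℝ → ℝ) (b₁ b₂ : ℝ → ℂ) (k₁ k₂ : ℝ → ℝ → ℂ) :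
    Submodule ℂ (LpHalf p × LpHalf p) where
  carrier := {x | ∃ v w : LpHalf p, (x.1, v) ∈ derivGraph p ∧ (v, w) ∈ derivGraph p ∧
    ∀ᵐ t ∂halfLine,
      Integrable (fun s => k₁ t s * v s) halfLine ∧
      Integrable (fun s => k₂ t s * x.1 s) halfLine ∧
      x.2 t = w t + q t * x.1 t + b₁ t * v t + b₂ t * x.1 t
        + (∫ s, k₁ t s * v s ∂halfLine) + ∫ s, k₂ t s * x.1 s ∂halfLine}
  add_mem' := by
    rintro x y ⟨v, w, h1, h2, h3⟩ ⟨v', w', h1', h2', h3'⟩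
    refine ⟨v + v', w + w', (derivGraph p).add_mem h1 h1', (derivGraph p).add_mem h2 h2', ?_⟩
    have hv := Lp.coeFn_add v v'
    have hx := Lp.coeFn_add x.1 y.1
    filter_upwards [h3, h3', hv, hx, Lp.coeFn_add w w', Lp.coeFn_add x.2 y.2]
      with t ⟨a, b, c⟩ ⟨a', b', c'⟩ e1 e2 e3 e4
    have i1 : (fun s => k₁ t s * (v + v' : LpHalf p) s) =ᵐ[halfLine]
        fun s => k₁ t s * v s + k₁ t s * v' s := by
      filter_upwards [hv] with s hs
      rw [hs, Pi.add_apply, mul_add]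
    have i2 : (fun s => k₂ t s * (x.1 + y.1 : LpHalf p) s) =ᵐ[halfLine]
        fun s => k₂ t s * x.1 s + k₂ t s * y.1 s := by
      filter_upwards [hx] with s hs
      rw [hs, Pi.add_apply, mul_add]
    refine ⟨(a.add a').congr i1.symm, (b.add b').congr i2.symm, ?_⟩
    rw [Prod.fst_add, Prod.snd_add, integral_congr_ae i1, integral_congr_ae i2,
      integral_add a a', integral_add b b', e1, e2, e3, e4]
    simp only [Pi.add_apply]
    rw [c, c']
    ring
  zero_mem' := by
    refine ⟨0, 0, (derivGraph p).zero_mem, (derivGraph p).zero_mem, ?_⟩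
    have h0 := Lp.coeFn_zero ℂ p halfLine
    filter_upwards [h0] with t ht
    have i (k : ℝ → ℝ → ℂ) : (fun s => k t s * (0 : LpHalf p) s) =ᵐ[halfLine] fun _ => 0 := by
      filter_upwards [h0] with s hs
      rw [hs, Pi.zero_apply, mul_zero]
    refine ⟨(integrable_zero _ _ _).congr (i k₁).symm,
      (integrable_zero _ _ _).congr (i k₂).symm, ?_⟩
    rw [Prod.fst_zero, Prod.snd_zero, integral_congr_ae (i k₁), integral_congr_ae (i k₂), ht]
    simp
  smul_mem' := by
    rintro c x ⟨v, w, h1, h2, h3⟩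
    refine ⟨c • v, c • w, (derivGraph p).smul_mem c h1, (derivGraph p).smul_mem c h2, ?_⟩
    have hv := Lp.coeFn_smul c v
    have hx := Lp.coeFn_smul c x.1
    filter_upwards [h3, hv, hx, Lp.coeFn_smul c w, Lp.coeFn_smul c x.2]
      with t ⟨a, b, d⟩ e1 e2 e3 e4
    have i1 : (fun s => k₁ t s * (c • v : LpHalf p) s) =ᵐ[halfLine]
        fun s => c * (k₁ t s * v s) := by
      filter_upwards [hv] with s hs
      rw [hs, Pi.smul_apply, smul_eq_mul]
      ring
    have i2 : (fun s => k₂ t s * (c • x.1 : LpHalf p) s) =ᵐ[halfLine]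
        fun s => c * (k₂ t s * x.1 s) := by
      filter_upwards [hx] with s hs
      rw [hs, Pi.smul_apply, smul_eq_mul]
      ring
    refine ⟨(a.const_mul c).congr i1.symm, (b.const_mul c).congr i2.symm, ?_⟩
    rw [Prod.smul_fst, Prod.smul_snd, integral_congr_ae i1, integral_congr_ae i2,
      integral_const_mul, integral_const_mul, e1, e2, e3, e4]
    simp only [Pi.smul_apply, smul_eq_mul]
    rw [d]
    ring

/-- The function `H u` is determined by `u`. -/
theorem hillGraph_unique {p : ℝ≥0∞} {q : ℝ → ℝ} {b₁ b₂ : ℝ → ℂ} {k₁ k₂ : ℝ → ℝ → ℂ}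
    (x : LpHalf p × LpHalf p) (hx : x ∈ hillGraph p q b₁ b₂ k₁ k₂) (h0 : x.1 = 0) :
    x.2 = 0 := by
  obtain ⟨v, w, h1, h2, h3⟩ := hx
  have hv : v = 0 := derivGraph_unique h1 h0
  have hw : w = 0 := derivGraph_unique h2 hv
  have hz := Lp.coeFn_zero ℂ p halfLine
  rw [Lp.eq_zero_iff_ae_eq_zero]
  rw [h0, hv, hw] at h3
  filter_upwards [h3, hz] with t ⟨_, _, c⟩ ht
  have i (k : ℝ → ℝ → ℂ) : (fun s => k t s * (0 : LpHalf p) s) =ᵐ[halfLine] fun _ => 0 := by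
    filter_upwards [hz] with s hs
    rw [hs, Pi.zero_apply, mul_zero]
  rw [c, integral_congr_ae (i k₁), integral_congr_ae (i k₂), ht]
  simp

/-- The perturbed Hill operator in `L_p(0, ∞)`, with the domain described in `hillGraph`. -/
noncomputable def hillOperator (p : ℝ≥0∞) (q : ℝ → ℝ) (b₁ b₂ : ℝ → ℂ) (k₁ k₂ : ℝ → ℝ → ℂ) :
    LpHalf p →ₗ.[ℂ] LpHalf p :=
  (hillGraph p q b₁ b₂ k₁ k₂).toLinearPMap

theorem hillOperator_graph (p : ℝ≥0∞) (q : ℝ → ℝ) (b₁ b₂ : ℝ → ℂ) (k₁ k₂ : ℝ → ℝ → ℂ) :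
    (hillOperator p q b₁ b₂ k₁ k₂).graph = hillGraph p q b₁ b₂ k₁ k₂ :=
  Submodule.toLinearPMap_graph_eq _ hillGraph_unique

/-- The integral operator `u ↦ ∫₀^∞ κ(·, s) u(s) ds` is (everywhere defined, with absolutely
convergent integrals, and) bounded in `L_p(0, ∞)`. -/
def IsBoundedIntegralKernel (p : ℝ≥0∞) [Fact (1 ≤ p)] (κ : ℝ → ℝ → ℂ) : Prop :=
  ∃ K : LpHalf p →L[ℂ] LpHalf p, ∀ u : LpHalf p, ∀ᵐ t ∂halfLine,
    Integrable (fun s => κ t s * u s) halfLine ∧ K u t = ∫ s, κ t s * u s ∂halfLine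

/-! Put `Q = q - λ`. Since `D² = -d²/dt²`, the relation `H u = λ u + f` reads `y'' = Q y + (1 +
t)^(-δ) g - f`. As the kernels vanish for `t > s`, the `L_p` norm of `g` on each `(a, ∞)` is
controlled by that of `(y, y')` on the same half-line (`IsHillSol.exists_isPertSol`). The rest is
perturbation of the periodic equation `y'' = Q y`, governed by the discriminant `Δ(λ)`, the trace of
its monodromy matrix, which has determinant `1`.

Gaps, `|Δ| > 2`. There are a solution `φ` decaying and a solution `ψ` growing exponentially.
Variation of constants expresses `y`, up to a multiple of `φ`, through an exponentially decaying
Green kernel, and far out the perturbation is small. Hence `y` is controlled by `f` and by one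
number, the Wronskian of `ψ` and `y` at some `n`, which is itself controlled by `y` and `f`
(`IsDichotomy.exists_estimate`). By compactness of bounded sets in `ℂ`, a bounded sequence with `H u
- λ u → 0` has a convergent subsequence, so gaps contain no continuous spectrum
(`notMem_continuousSpectrum`).

Consequently `|Δ| ≤ 2` near an interior point `λ` of the continuous spectrum. If `|Δ(λ)| < 2`, an
invariant definite quadratic form bounds all solutions (`IsFund.stable_of_abs_lt`). If `|Δ(λ)| = 2`,
then `Δ` touches the value `±2` without crossing it, which forces the monodromy matrix to be `±1`
(`IsFund.scalar_of_discriminant`), and again all solutions are bounded.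

In the bounded case let `H u = λ u`. The Wronskian of `y` with a bounded solution tends to `0` along
a sequence, because `y` and `y'` are in `L_p`; so `y` is represented by integrals over `(t, ∞)`
only. As `δ > 1`, the resulting tail operator has small norm on `L_p(a, ∞)` for large `a`, hence `y
= 0` there. A backward Grönwall argument in `L_p` (`IsPertSol.exists_phaseLp_zero_le`) carries this
down to `0` (`IsPertSol.phaseLp_eq_zero_of_stable`). -/

/-! ## Integral inequalities -/

/-- Jensen's inequality for a kernel of mass at most `A`. -/
theorem lintegral_mul_rpow_le {α : Type*} [MeasurableSpace α] {μ : Measure α} {r : ℝ}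
    (hr : 1 ≤ r) {k h : α → ℝ≥0∞} (hk : AEMeasurable k μ) (hh : AEMeasurable h μ) :
    (∫⁻ s, k s * h s ∂μ) ^ r ≤ (∫⁻ s, k s ∂μ) ^ (r - 1) * ∫⁻ s, k s * h s ^ r ∂μ := by
  have hr0 : 0 < r := by linarith
  -- The splitting to which Hölder's inequality with exponents `1 - 1/r` and `1/r` applies; it also
  -- makes sense for `r = 1`.
  have e : ∀ s, k s * h s = (k s) ^ (1 - 1 / r) * (k s * h s ^ r) ^ (1 / r) := by
    intro s
    rw [ENNReal.mul_rpow_of_nonneg _ _ (by positivity), ← mul_assoc,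
      ← ENNReal.rpow_add_of_nonneg _ _ (by rw [sub_nonneg]; exact (div_le_one hr0).2 hr)
        (by positivity), ← ENNReal.rpow_mul, mul_one_div_cancel hr0.ne']
    simp
  have key := ENNReal.lintegral_mul_norm_pow_le (μ := μ) hk
    (hk.mul (hh.pow_const r)) (p := 1 - 1 / r) (q := 1 / r)
    (by rw [sub_nonneg]; exact (div_le_one hr0).2 hr) (by positivity) (by ring)
  simp_rw [e]
  refine (ENNReal.rpow_le_rpow key hr0.le).trans ?_
  rw [ENNReal.mul_rpow_of_nonneg _ _ hr0.le, ← ENNReal.rpow_mul, ← ENNReal.rpow_mul,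
    one_div_mul_cancel hr0.ne', ENNReal.rpow_one]
  have : (1 - 1 / r) * r = r - 1 := by field_simp
  rw [this]
  simp

/-- Schur's test. -/
theorem eLpNorm_lintegral_kernel_le {α : Type*} [MeasurableSpace α] {μ : Measure α} [SFinite μ]
    {p : ℝ≥0∞} (hp1 : 1 ≤ p) (hp : p ≠ ⊤) {k : α → α → ℝ≥0∞}
    (hk : Measurable (Function.uncurry k)) {A : ℝ≥0∞}
    (hA : ∀ᵐ t ∂μ, ∫⁻ s, k t s ∂μ ≤ A) (hB : ∀ᵐ s ∂μ, ∫⁻ t, k t s ∂μ ≤ A)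
    {h : α → ℝ≥0∞} (hh : AEMeasurable h μ) :
    eLpNorm (fun t => ∫⁻ s, k t s * h s ∂μ) p μ ≤ A * eLpNorm h p μ := by
  have hp0 : p ≠ 0 := (zero_lt_one.trans_le hp1).ne'
  have hr : 1 ≤ p.toReal := by
    rwa [← ENNReal.toReal_one, ENNReal.toReal_le_toReal ENNReal.one_ne_top hp]
  set r := p.toReal with hrdef
  have hr0 : 0 < r := by linarith
  rw [eLpNorm_eq_lintegral_rpow_enorm_toReal hp0 hp, eLpNorm_eq_lintegral_rpow_enorm_toReal hp0 hp]
  simp only [enorm_eq_self]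
  rw [← hrdef]
  have e : A = (A ^ r) ^ (1 / r) := by
    rw [← ENNReal.rpow_mul, mul_one_div_cancel hr0.ne', ENNReal.rpow_one]
  rw [e, ← ENNReal.mul_rpow_of_nonneg _ _ (by positivity)]
  refine ENNReal.rpow_le_rpow ?_ (by positivity)
  calc ∫⁻ t, (∫⁻ s, k t s * h s ∂μ) ^ r ∂μ
      ≤ ∫⁻ t, A ^ (r - 1) * ∫⁻ s, k t s * h s ^ r ∂μ ∂μ := by
        refine lintegral_mono_ae ?_
        filter_upwards [hA] with t ht
        have hkt : Measurable (k t) := hk.of_uncurry_left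
        refine (lintegral_mul_rpow_le hr hkt.aemeasurable hh).trans ?_
        gcongr
    _ = A ^ (r - 1) * ∫⁻ t, ∫⁻ s, k t s * h s ^ r ∂μ ∂μ := by
        have hm : AEMeasurable (fun z : α × α => k z.1 z.2 * h z.2 ^ r) (μ.prod μ) :=
          hk.aemeasurable.mul ((hh.comp_snd).pow_const r)
        exact lintegral_const_mul'' _ hm.lintegral_prod_right'
    _ = A ^ (r - 1) * ∫⁻ s, ∫⁻ t, k t s * h s ^ r ∂μ ∂μ := by
        have hm : AEMeasurable (fun z : α × α => k z.1 z.2 * h z.2 ^ r) (μ.prod μ) :=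
          hk.aemeasurable.mul ((hh.comp_snd).pow_const r)
        rw [lintegral_lintegral_swap hm]
    _ ≤ A ^ (r - 1) * ∫⁻ s, A * h s ^ r ∂μ := by
        refine mul_le_mul_right (lintegral_mono_ae ?_) _
        filter_upwards [hB] with s hs
        have hks : Measurable (fun t => k t s) := hk.of_uncurry_right
        rw [lintegral_mul_const _ hks]
        gcongr
    _ = A ^ r * ∫⁻ s, h s ^ r ∂μ := by
        rw [lintegral_const_mul'' _ (hh.pow_const r), ← mul_assoc]
        congr 1
        rcases eq_or_ne r 1 with h1 | h1
        · simp [h1]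
        · nth_rw 2 [← ENNReal.rpow_one A]
          rw [← ENNReal.rpow_add_of_nonneg _ _ (by linarith) zero_le_one]
          ring_nf

theorem aemeasurable_lintegral_kernel {α : Type*} [MeasurableSpace α] {μ : Measure α} [SFinite μ]
    {k : α → α → ℝ≥0∞} (hk : Measurable (Function.uncurry k)) {h : α → ℝ≥0∞}
    (hh : AEMeasurable h μ) : AEMeasurable (fun t => ∫⁻ s, k t s * h s ∂μ) μ :=
  AEMeasurable.lintegral_prod_right' (f := fun z : α × α => k z.1 z.2 * h z.2)
    (hk.aemeasurable.mul hh.comp_snd)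

/-! ## Absolutely continuous functions -/

namespace AbsolutelyContinuousOnInterval

theorem comp_lipschitzWith {X Y : Type*} [PseudoMetricSpace X] [PseudoMetricSpace Y]
    {f : ℝ → X} {a b : ℝ} (hf : AbsolutelyContinuousOnInterval f a b) {g : X → Y}
    (hg : LipschitzWith 1 g) : AbsolutelyContinuousOnInterval (fun t => g (f t)) a b := by
  rw [absolutelyContinuousOnInterval_iff] at hf ⊢
  intro ε hε
  obtain ⟨η, hη, H⟩ := hf ε hε
  refine ⟨η, hη, fun E hE hs => lt_of_le_of_lt (Finset.sum_le_sum fun i _ => ?_) (H E hE hs)⟩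
  simpa using hg.dist_le_mul (f (E.2 i).1) (f (E.2 i).2)

/-- The fundamental theorem of calculus, with a given almost everywhere derivative. -/
theorem integral_eq_sub_of_ae {f f' : ℝ → ℝ} {a b : ℝ} (hab : a ≤ b)
    (hf : AbsolutelyContinuousOnInterval f a b)
    (hf' : ∀ᵐ t ∂volume.restrict (Ioc a b), HasDerivAt f (f' t) t) :
    f b - f a = ∫ t in a..b, f' t := by
  rw [← hf.integral_deriv_eq_sub]
  refine intervalIntegral.integral_congr_ae ?_
  rw [uIoc_of_le hab]
  filter_upwards [(ae_restrict_iff' measurableSet_Ioc).1 hf'] with t ht h using (ht h).deriv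

/-- A unimodular factor `θ` turns `f b - f a` into its modulus; the real fundamental theorem of
calculus then applies to `Re (θ f)`. -/
theorem enorm_sub_le {f f' : ℝ → ℂ} {a b : ℝ} (hab : a ≤ b)
    (hf : AbsolutelyContinuousOnInterval f a b)
    (hf' : ∀ᵐ t ∂volume.restrict (Ioc a b), HasDerivAt f (f' t) t) :
    ‖f b - f a‖ₑ ≤ ∫⁻ t in Ioc a b, ‖f' t‖ₑ := by
  obtain ⟨θ, hθ, hθ'⟩ : ∃ θ : ℂ, ‖θ‖ = 1 ∧ (θ * (f b - f a)).re = ‖f b - f a‖ := by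
    rcases eq_or_ne (f b - f a) 0 with h | h
    · exact ⟨1, by simp, by simp [h]⟩
    · have hn : (‖f b - f a‖ : ℂ) ≠ 0 := by simpa using h
      refine ⟨(starRingEnd ℂ) (f b - f a) / ‖f b - f a‖, ?_, ?_⟩
      · rw [norm_div, RCLike.norm_conj]
        simp [norm_ne_zero_iff.2 h]
      · rw [div_mul_eq_mul_div, mul_comm, Complex.mul_conj, Complex.normSq_eq_norm_sq]
        push_cast
        rw [sq, mul_div_assoc, div_self hn]
        simp
  have hg : AbsolutelyContinuousOnInterval (fun t => (θ * f t).re) a b := by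
    refine (hf.const_smul θ).comp_lipschitzWith (g := Complex.re) ?_
    refine LipschitzWith.of_dist_le_mul fun x y => ?_
    simpa [dist_eq_norm] using Complex.abs_re_le_norm (x - y)
  have hg' : ∀ᵐ t ∂volume.restrict (Ioc a b),
      HasDerivAt (fun t => (θ * f t).re) (θ * f' t).re t := by
    filter_upwards [hf'] with t ht
    exact Complex.reCLM.hasFDerivAt.comp_hasDerivAt t (ht.const_mul θ)
  have h1 := integral_eq_sub_of_ae hab hg hg'
  have h2 : ‖f b - f a‖ = ∫ t in a..b, (θ * f' t).re := by
    rw [← h1, ← hθ', mul_sub, Complex.sub_re]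
  rw [← enorm_norm, h2, intervalIntegral.integral_of_le hab]
  refine (enorm_integral_le_lintegral_enorm _).trans (lintegral_mono fun t => ?_)
  rw [← ofReal_norm, ← ofReal_norm]
  refine ENNReal.ofReal_le_ofReal ?_
  calc ‖(θ * f' t).re‖ ≤ ‖θ * f' t‖ := Complex.abs_re_le_norm _
    _ = ‖f' t‖ := by rw [norm_mul, hθ, one_mul]

end AbsolutelyContinuousOnInterval

/-! ## The equation `y'' = Q y` on the half-line with an essentially bounded coefficient -/

/-- An essentially bounded coefficient on the half-line. -/
structure IsBddCoeff (Q : ℝ → ℝ) (M : ℝ) : Prop where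
  meas : AEStronglyMeasurable Q halfLine
  one_le : 1 ≤ M
  bound : ∀ᵐ t ∂halfLine, |Q t| ≤ M

/-- `y` solves `y'' = Q y` on `[0, ∞)` and `z` is its derivative. -/
structure IsSol (Q : ℝ → ℝ) (y z : ℝ → ℝ) : Prop where
  cont : Continuous y
  cont' : Continuous z
  eq : ∀ t, 0 ≤ t → y t = y 0 + ∫ s in 0..t, z s
  eq' : ∀ t, 0 ≤ t → z t = z 0 + ∫ s in 0..t, Q s * y s

theorem restrict_Ioc_le_halfLine {a b : ℝ} (ha : 0 ≤ a) : volume.restrict (Ioc a b) ≤ halfLine :=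
  Measure.restrict_mono (fun _ ht => lt_of_le_of_lt ha ht.1) le_rfl

/-! ### Existence of solutions by a weighted contraction -/

/-- The exponentially weighted primitive of a bounded function, frozen on the negative axis. -/
noncomputable def weightedPrimitive (L : ℝ) (g : ℝ → ℝ) (t : ℝ) : ℝ :=
  Real.exp (-(L * max t 0)) * ∫ s in 0..max t 0, Real.exp (L * s) * g s

section weightedPrimitive

variable {L K : ℝ} {g : ℝ → ℝ}

theorem intervalIntegrable_exp_mul (hg : AEStronglyMeasurable g volume)
    (hb : ∀ᵐ t, |g t| ≤ K) (a b : ℝ) :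
    IntervalIntegrable (fun s => Real.exp (L * s) * g s) volume a b := by
  have h1 : IntervalIntegrable g volume a b := by
    rw [intervalIntegrable_iff]
    have : IsFiniteMeasure (volume.restrict (uIoc a b)) := by
      unfold uIoc
      infer_instance
    exact Integrable.of_bound hg.restrict K (ae_restrict_of_ae hb)
  exact h1.continuousOn_mul (by fun_prop)

theorem continuous_weightedPrimitive (hg : AEStronglyMeasurable g volume)
    (hb : ∀ᵐ t, |g t| ≤ K) : Continuous (weightedPrimitive L g) := by
  unfold weightedPrimitive
  have h := intervalIntegral.continuous_primitive
    (intervalIntegrable_exp_mul (L := L) hg hb) 0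
  exact (by fun_prop : Continuous fun t : ℝ => Real.exp (-(L * max t 0))).mul
    (h.comp (by fun_prop : Continuous fun t : ℝ => max t 0))

/-- The weight gains a factor `1 / L`, uniformly on the whole half-line: this is what makes the
Picard map a global contraction. -/
theorem abs_weightedPrimitive_le (hL : 0 < L) (hb : ∀ᵐ t, |g t| ≤ K) (hK : 0 ≤ K) (t : ℝ) :
    |weightedPrimitive L g t| ≤ K / L := by
  set τ := max t 0 with hτ
  have hτ0 : 0 ≤ τ := le_max_right _ _
  have h1 : ‖∫ s in 0..τ, Real.exp (L * s) * g s‖ ≤ ∫ s in 0..τ, K * Real.exp (L * s) := by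
    refine intervalIntegral.norm_integral_le_of_norm_le hτ0 ?_
      (Continuous.intervalIntegrable (by fun_prop) _ _)
    filter_upwards [hb] with s hs _
    rw [norm_mul, Real.norm_eq_abs, Real.norm_eq_abs, abs_of_pos (Real.exp_pos _), mul_comm]
    gcongr
  have h2 : ∫ s in 0..τ, K * Real.exp (L * s) = K / L * (Real.exp (L * τ) - 1) := by
    rw [intervalIntegral.integral_const_mul,
      intervalIntegral.integral_comp_mul_left (fun x => Real.exp x) hL.ne', integral_exp]
    simp only [mul_zero, Real.exp_zero, smul_eq_mul]
    ring
  rw [h2] at h1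
  rw [weightedPrimitive, abs_mul, abs_of_pos (Real.exp_pos _), ← hτ]
  calc Real.exp (-(L * τ)) * |∫ s in 0..τ, Real.exp (L * s) * g s|
      ≤ Real.exp (-(L * τ)) * (K / L * (Real.exp (L * τ) - 1)) := by gcongr; exact h1
    _ = K / L * (1 - Real.exp (-(L * τ))) := by
        have : Real.exp (-(L * τ)) * Real.exp (L * τ) = 1 := by rw [← Real.exp_add]; simp
        linear_combination K / L * this
    _ ≤ K / L := by
        have := Real.exp_pos (-(L * τ))
        have h3 : 0 ≤ K / L := by positivity
        nlinarith

theorem weightedPrimitive_sub {g' : ℝ → ℝ} {K' : ℝ} (hg : AEStronglyMeasurable g volume)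
    (hb : ∀ᵐ t, |g t| ≤ K) (hg' : AEStronglyMeasurable g' volume)
    (hb' : ∀ᵐ t, |g' t| ≤ K') (t : ℝ) :
    weightedPrimitive L g t - weightedPrimitive L g' t =
      weightedPrimitive L (fun s => g s - g' s) t := by
  simp only [weightedPrimitive]
  rw [← mul_sub, ← intervalIntegral.integral_sub (intervalIntegrable_exp_mul hg hb _ _)
    (intervalIntegrable_exp_mul hg' hb' _ _)]
  simp only [mul_sub]

end weightedPrimitive

namespace IsBddCoeff

variable {Q : ℝ → ℝ} {M : ℝ}

theorem intervalIntegrable_mul (hQ : IsBddCoeff Q M) {y : ℝ → ℝ} (hy : Continuous y) {a b : ℝ}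
    (ha : 0 ≤ a) (hab : a ≤ b) : IntervalIntegrable (fun s => Q s * y s) volume a b := by
  have h1 : IntervalIntegrable Q volume a b := by
    rw [intervalIntegrable_iff_integrableOn_Ioc_of_le hab]
    exact Integrable.of_bound (hQ.meas.mono_measure (restrict_Ioc_le_halfLine ha)) M
      ((ae_mono (restrict_Ioc_le_halfLine ha)) hQ.bound)
  exact h1.mul_continuousOn hy.continuousOn

/-- The extension of the coefficient by zero is bounded on the line. -/
theorem bound_indicator (hQ : IsBddCoeff Q M) : ∀ᵐ t, |(Ioi 0).indicator Q t| ≤ M := by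
  filter_upwards [(ae_restrict_iff' measurableSet_Ioi).1 hQ.bound] with t ht
  by_cases h : t ∈ Ioi (0 : ℝ)
  · rw [indicator_of_mem h]
    exact ht h
  · rw [indicator_of_notMem h, abs_zero]
    linarith [hQ.one_le]

theorem meas_indicator (hQ : IsBddCoeff Q M) :
    AEStronglyMeasurable ((Ioi 0).indicator Q) volume :=
  (aestronglyMeasurable_indicator_iff measurableSet_Ioi).2 hQ.meas

/-- Picard iteration for the unknown `e^(-L t) (y, z)`, which is bounded on the half-line. Both
components of the map have Lipschitz constant at most `M / L`, the first because `1 ≤ M`, so `L = 2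
M` gives a contraction by `1/2` without any restriction to short intervals. Freezing at `t = 0` for
negative times keeps the unknown in a space of bounded continuous functions on `ℝ`. -/
theorem exists_isSol (hQ : IsBddCoeff Q M) (α β : ℝ) :
    ∃ y z, IsSol Q y z ∧ y 0 = α ∧ z 0 = β := by
  have hM : 0 < M := by linarith [hQ.one_le]
  set L := 2 * M with hL
  have hLpos : 0 < L := by positivity
  set R := (Ioi 0).indicator Q with hR
  let E := BoundedContinuousFunction ℝ (ℝ × ℝ)
  have n1 (x : E) (s : ℝ) : |(x s).1| ≤ ‖x‖ := (norm_fst_le _).trans (x.norm_coe_le_norm s)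
  have n2 (x : E) (s : ℝ) : |(x s).2| ≤ ‖x‖ := (norm_snd_le _).trans (x.norm_coe_le_norm s)
  have c1 (x : E) : Continuous fun s => (x s).1 := continuous_fst.comp x.continuous
  have c2 (x : E) : Continuous fun s => (x s).2 := continuous_snd.comp x.continuous
  have m1 (x : E) : AEStronglyMeasurable (fun s => (x s).2) volume := (c2 x).aestronglyMeasurable
  have m2 (x : E) : AEStronglyMeasurable (fun s => R s * (x s).1) volume :=
    hQ.meas_indicator.mul (c1 x).aestronglyMeasurable
  have b1 (x : E) : ∀ᵐ s, |(x s).2| ≤ M * ‖x‖ := Eventually.of_forall fun s =>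
    (n2 x s).trans (le_mul_of_one_le_left (norm_nonneg x) hQ.one_le)
  have b2 (x : E) : ∀ᵐ s, |R s * (x s).1| ≤ M * ‖x‖ := by
    filter_upwards [hQ.bound_indicator] with s hs
    rw [abs_mul]
    gcongr
    exact n1 x s
  have be : ∀ t : ℝ, |Real.exp (-(L * max t 0))| ≤ 1 := fun t => by
    rw [abs_of_pos (Real.exp_pos _), Real.exp_le_one_iff]
    have : 0 ≤ max t 0 := le_max_right _ _
    nlinarith
  have cf (x : E) : Continuous fun t : ℝ =>
      (Real.exp (-(L * max t 0)) * α + weightedPrimitive L (fun s => (x s).2) t,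
        Real.exp (-(L * max t 0)) * β + weightedPrimitive L (fun s => R s * (x s).1) t) := by
    have := continuous_weightedPrimitive (L := L) (m1 x) (b1 x)
    have := continuous_weightedPrimitive (L := L) (m2 x) (b2 x)
    fun_prop
  let T (x : E) : E := BoundedContinuousFunction.ofNormedAddCommGroup _ (cf x)
    (max (|α| + M * ‖x‖ / L) (|β| + M * ‖x‖ / L)) (by
      intro t
      refine (Prod.norm_def _).trans_le (max_le_max ?_ ?_)
      · refine (abs_add_le _ _).trans (add_le_add ?_
          (abs_weightedPrimitive_le hLpos (b1 x) (by positivity) t))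
        rw [abs_mul]
        exact mul_le_of_le_one_left (abs_nonneg _) (be t)
      · refine (abs_add_le _ _).trans (add_le_add ?_
          (abs_weightedPrimitive_le hLpos (b2 x) (by positivity) t))
        rw [abs_mul]
        exact mul_le_of_le_one_left (abs_nonneg _) (be t))
  have hT (x : E) (t : ℝ) : T x t =
      (Real.exp (-(L * max t 0)) * α + weightedPrimitive L (fun s => (x s).2) t,
        Real.exp (-(L * max t 0)) * β + weightedPrimitive L (fun s => R s * (x s).1) t) := rfl
  have hcontr : ContractingWith (1 / 2) T := by
    refine ⟨by norm_num, LipschitzWith.of_dist_le_mul fun x x' => ?_⟩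
    rw [BoundedContinuousFunction.dist_le (by positivity)]
    intro t
    have e : ((1 / 2 : NNReal) : ℝ) * dist x x' = M * ‖x - x'‖ / L := by
      rw [hL, dist_eq_norm]
      push_cast
      field_simp
    rw [e, hT, hT, Prod.dist_eq]
    refine max_le ?_ ?_
    · rw [Real.dist_eq, add_sub_add_left_eq_sub, weightedPrimitive_sub (m1 x) (b1 x) (m1 x') (b1 x')]
      exact abs_weightedPrimitive_le hLpos (b1 (x - x')) (by positivity) t
    · rw [Real.dist_eq, add_sub_add_left_eq_sub, weightedPrimitive_sub (m2 x) (b2 x) (m2 x') (b2 x')]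
      simp only [← mul_sub]
      exact abs_weightedPrimitive_le hLpos (b2 (x - x')) (by positivity) t
  set x := ContractingWith.fixedPoint T hcontr with hx
  have hfix : T x = x := ContractingWith.fixedPoint_isFixedPt hcontr
  have e1 (t : ℝ) (ht : 0 ≤ t) : Real.exp (L * t) * (x t).1 =
      α + ∫ s in 0..t, Real.exp (L * s) * (x s).2 := by
    have : (x t).1 = (T x t).1 := by rw [hfix]
    rw [this, hT]
    simp only [weightedPrimitive, max_eq_left ht]
    rw [← mul_add, ← mul_assoc, ← Real.exp_add]
    simp
  have e2 (t : ℝ) (ht : 0 ≤ t) : Real.exp (L * t) * (x t).2 =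
      β + ∫ s in 0..t, Real.exp (L * s) * (R s * (x s).1) := by
    have : (x t).2 = (T x t).2 := by rw [hfix]
    rw [this, hT]
    simp only [weightedPrimitive, max_eq_left ht]
    rw [← mul_add, ← mul_assoc, ← Real.exp_add]
    simp
  have i1 : Real.exp (L * 0) * (x 0).1 = α := by simpa using e1 0 le_rfl
  have i2 : Real.exp (L * 0) * (x 0).2 = β := by simpa using e2 0 le_rfl
  refine ⟨fun t => Real.exp (L * t) * (x t).1, fun t => Real.exp (L * t) * (x t).2,
    ⟨?_, ?_, ?_, ?_⟩, i1, i2⟩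
  · have := c1 x
    fun_prop
  · have := c2 x
    fun_prop
  · intro t ht
    simp only [i1]
    exact e1 t ht
  · intro t ht
    simp only [i2]
    rw [e2 t ht]
    congr 1
    refine intervalIntegral.integral_congr_ae (Eventually.of_forall fun s hs => ?_)
    rw [uIoc_of_le ht] at hs
    rw [hR, indicator_of_mem (mem_Ioi.2 hs.1)]
    ring

end IsBddCoeff

/-! ### Grönwall's inequality, uniqueness and Wronskians -/

/-- Grönwall's inequality in integral form. -/
theorem le_mul_exp_of_le_add_integral {w : ℝ → ℝ} (hw : Continuous w) {ε M T : ℝ} (hM : 0 ≤ M)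
    (h : ∀ t ∈ Icc 0 T, w t ≤ ε + M * ∫ s in 0..t, w s) {t : ℝ} (ht : t ∈ Icc 0 T) :
    w t ≤ ε * Real.exp (M * t) := by
  have hd : ∀ t, HasDerivAt (fun t => ∫ s in 0..t, w s) (w t) t := fun t =>
    intervalIntegral.integral_hasDerivAt_right (hw.intervalIntegrable _ _)
      hw.stronglyMeasurable.stronglyMeasurableAtFilter hw.continuousAt
  have hd2 : ∀ t, HasDerivAt (fun t => Real.exp (-(M * t)) * (ε + M * ∫ s in 0..t, w s))
      (Real.exp (-(M * t)) * (-M) * (ε + M * ∫ s in 0..t, w s)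
        + Real.exp (-(M * t)) * (M * w t)) t := by
    intro t
    have h1 : HasDerivAt (fun t => Real.exp (-(M * t))) (Real.exp (-(M * t)) * (-M)) t := by
      have := ((hasDerivAt_id t).const_mul M).neg.exp
      simpa using this
    exact h1.mul (((hd t).const_mul M).const_add ε)
  have hanti : AntitoneOn (fun t => Real.exp (-(M * t)) * (ε + M * ∫ s in 0..t, w s))
      (Icc 0 T) := by
    refine antitoneOn_of_deriv_nonpos (convex_Icc _ _)
      (fun t _ => (hd2 t).continuousAt.continuousWithinAt)
      (fun t _ => (hd2 t).differentiableAt.differentiableWithinAt) fun t ht => ?_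
    rw [(hd2 t).deriv]
    have h1 := h t (interior_subset ht)
    have h2 := Real.exp_pos (-(M * t))
    have : Real.exp (-(M * t)) * (-M) * (ε + M * ∫ s in 0..t, w s)
        + Real.exp (-(M * t)) * (M * w t)
        = (Real.exp (-(M * t)) * M) * (w t - (ε + M * ∫ s in 0..t, w s)) := by ring
    rw [this]
    exact mul_nonpos_of_nonneg_of_nonpos (by positivity) (by linarith)
  have h3 := hanti (left_mem_Icc.2 (ht.1.trans ht.2)) ht ht.1
  simp only [mul_zero, neg_zero, Real.exp_zero, one_mul, intervalIntegral.integral_same,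
    add_zero] at h3
  have h4 : ε + M * ∫ s in 0..t, w s ≤ ε * Real.exp (M * t) := by
    have h5 : Real.exp (-(M * t)) * Real.exp (M * t) = 1 := by rw [← Real.exp_add]; simp
    have := mul_le_mul_of_nonneg_right h3 (Real.exp_pos (M * t)).le
    calc ε + M * ∫ s in 0..t, w s
        = Real.exp (-(M * t)) * (ε + M * ∫ s in 0..t, w s) * Real.exp (M * t) := by
          linear_combination -(ε + M * ∫ s in 0..t, w s) * h5
      _ ≤ _ := this
  exact (h t ht).trans h4

namespace IsSol

variable {Q : ℝ → ℝ} {M : ℝ} {y z y₁ z₁ : ℝ → ℝ}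

theorem hasDerivAt (h : IsSol Q y z) {t : ℝ} (ht : 0 < t) : HasDerivAt y (z t) t := by
  have hd : HasDerivAt (fun t => y 0 + ∫ s in 0..t, z s) (z t) t :=
    (intervalIntegral.integral_hasDerivAt_right (h.cont'.intervalIntegrable _ _)
      h.cont'.stronglyMeasurable.stronglyMeasurableAtFilter h.cont'.continuousAt).const_add _
  refine hd.congr_of_eventuallyEq ?_
  filter_upwards [Ioi_mem_nhds ht] with s hs using h.eq s (le_of_lt hs)

theorem absolutelyContinuous (h : IsSol Q y z) {R : ℝ} (hR : 0 ≤ R) :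
    AbsolutelyContinuousOnInterval y 0 R := by
  have h1 := ((h.cont'.intervalIntegrable 0 R).absolutelyContinuousOnInterval_intervalIntegral
    (c := 0) (by simp)).add
    (LipschitzWith.const (y 0)).lipschitzOnWith.absolutelyContinuousOnInterval
  rw [absolutelyContinuousOnInterval_iff] at h1 ⊢
  intro ε hε
  obtain ⟨η, hη, H⟩ := h1 ε hε
  refine ⟨η, hη, fun E hE hs => ?_⟩
  have := H E hE hs
  refine lt_of_le_of_lt (Finset.sum_le_sum fun i hi => ?_) this
  have hm := hE.1 i (by simpa using hi)
  rw [uIcc_of_le hR] at hm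
  rw [h.eq _ hm.1.1, h.eq _ hm.2.1]
  simp [add_comm]

theorem absolutelyContinuous' (hQ : IsBddCoeff Q M) (h : IsSol Q y z) {R : ℝ} (hR : 0 ≤ R) :
    AbsolutelyContinuousOnInterval z 0 R := by
  have h1 := ((hQ.intervalIntegrable_mul h.cont le_rfl hR
    ).absolutelyContinuousOnInterval_intervalIntegral (c := 0) (by simp)).add
    (LipschitzWith.const (z 0)).lipschitzOnWith.absolutelyContinuousOnInterval
  rw [absolutelyContinuousOnInterval_iff] at h1 ⊢
  intro ε hε
  obtain ⟨η, hη, H⟩ := h1 ε hε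
  refine ⟨η, hη, fun E hE hs => ?_⟩
  have := H E hE hs
  refine lt_of_le_of_lt (Finset.sum_le_sum fun i hi => ?_) this
  have hm := hE.1 i (by simpa using hi)
  rw [uIcc_of_le hR] at hm
  rw [h.eq' _ hm.1.1, h.eq' _ hm.2.1]
  simp [add_comm]

theorem ae_hasDerivAt' (hQ : IsBddCoeff Q M) (h : IsSol Q y z) :
    ∀ᵐ t ∂halfLine, HasDerivAt z (Q t * y t) t := by
  rw [ae_restrict_iff' measurableSet_Ioi]
  have h1 : ∀ n : ℕ, ∀ᵐ t, t ∈ uIcc (0 : ℝ) n → ∀ c ∈ uIcc (0 : ℝ) n,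
      HasDerivAt (fun x => ∫ s in c..x, Q s * y s) (Q t * y t) t := fun n =>
    (hQ.intervalIntegrable_mul h.cont le_rfl n.cast_nonneg).ae_hasDerivAt_integral
  filter_upwards [ae_all_iff.2 h1] with t ht h0
  obtain ⟨n, hn⟩ := exists_nat_ge t
  have hn0 : (0 : ℝ) ≤ n := n.cast_nonneg
  have h2 := (ht n (by rw [uIcc_of_le hn0]; exact ⟨le_of_lt h0, hn⟩) 0 (by simp)).const_add (z 0)
  refine h2.congr_of_eventuallyEq ?_
  filter_upwards [Ioi_mem_nhds (mem_Ioi.1 h0)] with s hs using h.eq' s (le_of_lt hs)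

theorem lin (hQ : IsBddCoeff Q M) (h : IsSol Q y z) (h₁ : IsSol Q y₁ z₁) (a b : ℝ) :
    IsSol Q (fun t => a * y t + b * y₁ t) (fun t => a * z t + b * z₁ t) := by
  have := h.cont
  have := h.cont'
  have := h₁.cont
  have := h₁.cont'
  refine ⟨by fun_prop, by fun_prop, fun t ht => ?_, fun t ht => ?_⟩
  · rw [intervalIntegral.integral_add (Continuous.intervalIntegrable (by fun_prop) _ _)
      (Continuous.intervalIntegrable (by fun_prop) _ _), intervalIntegral.integral_const_mul,
      intervalIntegral.integral_const_mul, h.eq t ht, h₁.eq t ht]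
    ring
  · have e : ∀ s, Q s * (a * y s + b * y₁ s) = a * (Q s * y s) + b * (Q s * y₁ s) := by
      intro s; ring
    simp only [e]
    rw [intervalIntegral.integral_add
      ((hQ.intervalIntegrable_mul h.cont le_rfl ht).const_mul a)
      ((hQ.intervalIntegrable_mul h₁.cont le_rfl ht).const_mul b),
      intervalIntegral.integral_const_mul,
      intervalIntegral.integral_const_mul, h.eq' t ht, h₁.eq' t ht]
    ring

theorem shift (hQ : IsBddCoeff Q M) (hper : Function.Periodic Q 1) (h : IsSol Q y z) :
    IsSol Q (fun t => y (t + 1)) (fun t => z (t + 1)) := by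
  have := h.cont
  have := h.cont'
  refine ⟨by fun_prop, by fun_prop, fun t ht => ?_, fun t ht => ?_⟩
  · rw [intervalIntegral.integral_comp_add_right, h.eq _ (by linarith : (0 : ℝ) ≤ t + 1),
      h.eq _ (by norm_num : (0 : ℝ) ≤ 0 + 1), add_assoc,
      intervalIntegral.integral_add_adjacent_intervals] <;>
    exact h.cont'.intervalIntegrable _ _
  · have e : ∀ s, Q s * y (s + 1) = (fun x => Q x * y x) (s + 1) := by
      intro s; simp only [hper s]
    simp only [e]
    rw [intervalIntegral.integral_comp_add_right (fun x => Q x * y x),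
      h.eq' _ (by linarith : (0 : ℝ) ≤ t + 1),
      h.eq' _ (by norm_num : (0 : ℝ) ≤ 0 + 1), add_assoc,
      intervalIntegral.integral_add_adjacent_intervals] <;>
    exact hQ.intervalIntegrable_mul h.cont (by norm_num) (by linarith)

/-- Continuous dependence on the spectral parameter. -/
theorem dist_le {d B T : ℝ} (hQ : IsBddCoeff Q M) (hQ₁ : IsBddCoeff (fun t => Q t - d) M)
    (h : IsSol Q y z)
    (h₁ : IsSol (fun t => Q t - d) y₁ z₁) (e : y₁ 0 = y 0) (e' : z₁ 0 = z 0)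
    (hB : ∀ t ∈ Icc 0 T, |y t| ≤ B) {t : ℝ} (ht : t ∈ Icc 0 T) :
    |y₁ t - y t| + |z₁ t - z t| ≤ |d| * B * T * Real.exp (M * t) := by
  have := h.cont
  have := h.cont'
  have := h₁.cont
  have := h₁.cont'
  have hM : 0 ≤ M := by linarith [hQ.one_le]
  refine le_mul_exp_of_le_add_integral (w := fun t => |y₁ t - y t| + |z₁ t - z t|)
    (by fun_prop) hM (fun t ht => ?_) ht
  have e1 : y₁ t - y t = ∫ s in 0..t, (z₁ s - z s) := by
    rw [h.eq t ht.1, h₁.eq t ht.1, e, intervalIntegral.integral_sub]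
    · ring
    · exact Continuous.intervalIntegrable (by fun_prop) _ _
    · exact Continuous.intervalIntegrable (by fun_prop) _ _
  have e2 : z₁ t - z t = ∫ s in 0..t, ((Q s - d) * (y₁ s - y s) - d * y s) := by
    rw [h.eq' t ht.1, h₁.eq' t ht.1, e', add_sub_add_left_eq_sub,
      ← intervalIntegral.integral_sub (hQ₁.intervalIntegrable_mul h₁.cont le_rfl ht.1)
      (hQ.intervalIntegrable_mul h.cont le_rfl ht.1)]
    congr 1
    ext s
    ring
  have e3 : |y₁ t - y t| ≤ ∫ s in 0..t, |z₁ s - z s| := by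
    rw [e1]
    exact intervalIntegral.abs_integral_le_integral_abs ht.1
  have e4 : |z₁ t - z t| ≤ ∫ s in 0..t, (M * |y₁ s - y s| + |d| * B) := by
    rw [e2, ← Real.norm_eq_abs]
    refine intervalIntegral.norm_integral_le_of_norm_le ht.1 ?_
      (Continuous.intervalIntegrable (by fun_prop) _ _)
    filter_upwards [(ae_restrict_iff' measurableSet_Ioi).1 hQ₁.bound] with s hs hst
    refine (norm_sub_le _ _).trans ?_
    rw [norm_mul, norm_mul]
    simp only [Real.norm_eq_abs]
    gcongr
    · exact hs hst.1
    · exact hB s ⟨hst.1.le, hst.2.trans ht.2⟩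
  rw [intervalIntegral.integral_add (Continuous.intervalIntegrable (by fun_prop) _ _)
      (Continuous.intervalIntegrable (by fun_prop) _ _), intervalIntegral.integral_const_mul,
      intervalIntegral.integral_const, smul_eq_mul, sub_zero] at e4
  rw [intervalIntegral.integral_add (Continuous.intervalIntegrable (by fun_prop) _ _)
      (Continuous.intervalIntegrable (by fun_prop) _ _)]
  have e5 : 0 ≤ ∫ s in 0..t, |z₁ s - z s| :=
    intervalIntegral.integral_nonneg ht.1 fun _ _ => abs_nonneg _
  have hB0 : 0 ≤ B := (abs_nonneg _).trans (hB 0 ⟨le_rfl, ht.1.trans ht.2⟩)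
  have e6 : t * (|d| * B) ≤ |d| * B * T := by
    rw [mul_comm]
    exact mul_le_mul_of_nonneg_left ht.2 (by positivity)
  -- The normalisation `1 ≤ M` lets the same constant dominate both components of the first-order
  -- system.
  have e7 : ∫ s in 0..t, |z₁ s - z s| ≤ M * ∫ s in 0..t, |z₁ s - z s| :=
    le_mul_of_one_le_left e5 hQ.one_le
  show |y₁ t - y t| + |z₁ t - z t| ≤ _
  linarith

theorem exists_bound (h : IsSol Q y z) (T : ℝ) :
    ∃ B, 0 ≤ B ∧ ∀ t ∈ Icc 0 T, |y t| ≤ B ∧ |z t| ≤ B := by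
  have hc : ContinuousOn (fun t => |y t| + |z t|) (Icc 0 T) :=
    (h.cont.abs.add h.cont'.abs).continuousOn
  obtain ⟨B, hB⟩ := isCompact_Icc.exists_bound_of_continuousOn hc
  refine ⟨|B|, abs_nonneg B, fun t ht => ?_⟩
  have := (Real.norm_of_nonneg (by positivity : 0 ≤ |y t| + |z t|)).symm.trans_le (hB t ht)
  have := le_abs_self B
  constructor <;> linarith [abs_nonneg (y t), abs_nonneg (z t)]

theorem unique (hQ : IsBddCoeff Q M) (h : IsSol Q y z) (h₁ : IsSol Q y₁ z₁) (e : y₁ 0 = y 0)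
    (e' : z₁ 0 = z 0) {t : ℝ} (ht : 0 ≤ t) : y₁ t = y t ∧ z₁ t = z t := by
  obtain ⟨B, -, hB⟩ := h.exists_bound t
  have := dist_le (d := 0) hQ (by simpa using hQ) h (by simpa using h₁) e e'
    (fun s hs => (hB s hs).1) (right_mem_Icc.2 ht)
  simp only [abs_zero, zero_mul] at this
  have h1 := abs_nonneg (y₁ t - y t)
  have h2 := abs_nonneg (z₁ t - z t)
  exact ⟨sub_eq_zero.1 (abs_eq_zero.1 (by linarith)), sub_eq_zero.1 (abs_eq_zero.1 (by linarith))⟩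

/-- The Wronskian of two solutions to different values of the spectral parameter. -/
theorem wronskian_sub {d : ℝ} (hQ : IsBddCoeff Q M) (hQ₁ : IsBddCoeff (fun t => Q t - d) M)
    (h : IsSol Q y z) (h₁ : IsSol (fun t => Q t - d) y₁ z₁) {t : ℝ} (ht : 0 ≤ t) :
    (y t * z₁ t - z t * y₁ t) - (y 0 * z₁ 0 - z 0 * y₁ 0) = -d * ∫ s in 0..t, y s * y₁ s := by
  rw [← intervalIntegral.integral_const_mul]
  refine AbsolutelyContinuousOnInterval.integral_eq_sub_of_ae (f := fun t => y t * z₁ t - z t * y₁ t)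
    ht (((h.absolutelyContinuous ht).mul (absolutelyContinuous' hQ₁ h₁ ht)).sub
      ((absolutelyContinuous' hQ h ht).mul (h₁.absolutelyContinuous ht))) ?_
  have hle := restrict_Ioc_le_halfLine (b := t) le_rfl
  filter_upwards [ae_mono hle (ae_hasDerivAt' hQ h), ae_mono hle (ae_hasDerivAt' hQ₁ h₁),
    ae_restrict_mem measurableSet_Ioc] with s h2 h3 hs
  have := ((h.hasDerivAt hs.1).mul h3).sub (h2.mul (h₁.hasDerivAt hs.1))
  refine this.congr_deriv ?_
  ring

theorem wronskian_eq (hQ : IsBddCoeff Q M) (h : IsSol Q y z) (h₁ : IsSol Q y₁ z₁) {t : ℝ}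
    (ht : 0 ≤ t) : y t * z₁ t - z t * y₁ t = y 0 * z₁ 0 - z 0 * y₁ 0 := by
  have := wronskian_sub (d := 0) hQ (by simpa using hQ) h (by simpa using h₁) ht
  simp only [neg_zero, zero_mul] at this
  linarith

end IsSol

/-! ## Floquet theory -/

/-- The fundamental system of `y'' = Q y` normalised at `0`. -/
structure IsFund (Q : ℝ → ℝ) (c c' s s' : ℝ → ℝ) : Prop where
  solc : IsSol Q c c'
  sols : IsSol Q s s'
  c0 : c 0 = 1
  c0' : c' 0 = 0
  s0 : s 0 = 0
  s0' : s' 0 = 1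

theorem IsBddCoeff.exists_isFund {Q : ℝ → ℝ} {M : ℝ} (hQ : IsBddCoeff Q M) :
    ∃ c c' s s', IsFund Q c c' s s' := by
  obtain ⟨c, c', h1, h2, h3⟩ := hQ.exists_isSol 1 0
  obtain ⟨s, s', h4, h5, h6⟩ := hQ.exists_isSol 0 1
  exact ⟨c, c', s, s', h1, h4, h2, h3, h5, h6⟩

namespace IsFund

variable {Q : ℝ → ℝ} {M : ℝ} {c c' s s' : ℝ → ℝ}

theorem det_eq_one (hQ : IsBddCoeff Q M) (h : IsFund Q c c' s s') {t : ℝ} (ht : 0 ≤ t) :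
    c t * s' t - c' t * s t = 1 := by
  have := h.solc.wronskian_eq hQ h.sols ht
  rw [h.c0, h.c0', h.s0, h.s0'] at this
  linarith

theorem eq_lin (hQ : IsBddCoeff Q M) (h : IsFund Q c c' s s') {y z : ℝ → ℝ} (hy : IsSol Q y z)
    {t : ℝ} (ht : 0 ≤ t) :
    y t = y 0 * c t + z 0 * s t ∧ z t = y 0 * c' t + z 0 * s' t :=
  IsSol.unique hQ (h.solc.lin hQ h.sols (y 0) (z 0)) hy
    (by simp [h.c0, h.s0]) (by simp [h.c0', h.s0']) ht

theorem shift_c (hQ : IsBddCoeff Q M) (hper : Function.Periodic Q 1) (h : IsFund Q c c' s s')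
    {t : ℝ} (ht : 0 ≤ t) :
    c (t + 1) = c 1 * c t + c' 1 * s t ∧ c' (t + 1) = c 1 * c' t + c' 1 * s' t := by
  simpa using h.eq_lin hQ (h.solc.shift hQ hper) ht

theorem shift_s (hQ : IsBddCoeff Q M) (hper : Function.Periodic Q 1) (h : IsFund Q c c' s s')
    {t : ℝ} (ht : 0 ≤ t) :
    s (t + 1) = s 1 * c t + s' 1 * s t ∧ s' (t + 1) = s 1 * c' t + s' 1 * s' t := by
  simpa using h.eq_lin hQ (h.sols.shift hQ hper) ht

/-- All solutions of the equation are bounded, together with their derivatives. -/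
def Stable (c c' s s' : ℝ → ℝ) : Prop :=
  ∃ B, ∀ t, 0 ≤ t → |c t| ≤ B ∧ |c' t| ≤ B ∧ |s t| ≤ B ∧ |s' t| ≤ B

/-- A quantity that is periodic on the half-line and bounded on a period is bounded. -/
theorem _root_.exists_bound_of_periodic {F : ℝ → ℝ} (hF : Continuous F)
    (hp : ∀ t, 0 ≤ t → F (t + 1) = F t) : ∃ B, ∀ t, 0 ≤ t → |F t| ≤ B := by
  obtain ⟨B, hB⟩ := isCompact_Icc.exists_bound_of_continuousOn (s := Icc (0 : ℝ) 1)
    hF.continuousOn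
  refine ⟨B, fun t ht => ?_⟩
  have h1 : ∀ n : ℕ, ∀ t, 0 ≤ t → F (t + n) = F t := by
    intro n
    induction n with
    | zero => intro t _; simp
    | succ k ih =>
      intro t ht
      rw [Nat.cast_succ, ← add_assoc, hp _ (by positivity), ih t ht]
  have h2 := Nat.floor_le ht
  have h3 := Nat.lt_floor_add_one t
  have h4 := h1 ⌊t⌋₊ (t - ⌊t⌋₊) (by linarith)
  rw [sub_add_cancel] at h4
  rw [h4]
  exact hB _ ⟨by linarith, by linarith⟩

/-- The monodromy matrix has determinant `1` and therefore preserves the quadratic form `s 1 x² +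
(s' 1 - c 1) x y - c' 1 y²`. Its discriminant is `(c 1 + s' 1)² - 4 < 0`, so the form is definite;
being periodic along `(c, s)` and `(c', s')`, it is bounded, and with it the solutions. -/
theorem stable_of_abs_lt (hQ : IsBddCoeff Q M) (hper : Function.Periodic Q 1)
    (h : IsFund Q c c' s s') (hD : |c 1 + s' 1| < 2) : Stable c c' s s' := by
  have hdet := h.det_eq_one hQ zero_le_one
  have hcc := h.solc.cont
  have hcc' := h.solc.cont'
  have hsc := h.sols.cont
  have hsc' := h.sols.cont'
  have hD2 : 0 < 4 - (c 1 + s' 1) ^ 2 := by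
    have := (sq_lt_sq' (by linarith [(abs_lt.1 hD).1]) (abs_lt.1 hD).2)
    linarith
  set D := 4 - (c 1 + s' 1) ^ 2 with hDdef
  have key : ∀ x y : ℝ → ℝ, Continuous x → Continuous y →
      (∀ t, 0 ≤ t → x (t + 1) = c 1 * x t + c' 1 * y t) →
      (∀ t, 0 ≤ t → y (t + 1) = s 1 * x t + s' 1 * y t) →
      ∃ B, ∀ t, 0 ≤ t → |x t| ≤ B ∧ |y t| ≤ B := by
    intro x y hx hy h1 h2
    obtain ⟨B, hB⟩ := exists_bound_of_periodic
      (F := fun t => s 1 * x t ^ 2 + (s' 1 - c 1) * x t * y t - c' 1 * y t ^ 2)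
      (by fun_prop) (fun t ht => by
        simp only [h1 t ht, h2 t ht]
        linear_combination
          (s 1 * x t ^ 2 + (s' 1 - c 1) * x t * y t - c' 1 * y t ^ 2) * hdet)
    refine ⟨max (4 * |s 1| * B / D + 1) (4 * |c' 1| * B / D + 1), fun t ht => ?_⟩
    set F := s 1 * x t ^ 2 + (s' 1 - c 1) * x t * y t - c' 1 * y t ^ 2 with hF
    have hFB : |F| ≤ B := hB t ht
    -- Definiteness enters through completed squares: `D u²` is at most `4 e F`, where `e` is the
    -- coefficient of the square of the other variable. The crude inequality `|u| ≤ u² + 1` avoids a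
    -- square root.
    have hlt : ∀ u e : ℝ, D * u ^ 2 ≤ 4 * e * F → |u| ≤ 4 * |e| * B / D + 1 := by
      intro u e hu
      have h3 : 4 * e * F ≤ 4 * |e| * B := by
        calc 4 * e * F ≤ |4 * e * F| := le_abs_self _
          _ = 4 * |e| * |F| := by rw [abs_mul, abs_mul]; norm_num
          _ ≤ 4 * |e| * B := by gcongr
      have h4 : u ^ 2 ≤ 4 * |e| * B / D := by
        rw [le_div_iff₀ hD2]
        linarith
      have h5 : |u| ≤ u ^ 2 + 1 := by
        rw [← sq_abs]
        nlinarith [sq_nonneg (|u| - 1), abs_nonneg u]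
      linarith
    constructor
    · refine (hlt (x t) (-c' 1) ?_).trans ?_
      · have : 4 * (-c' 1) * F - D * x t ^ 2 = (2 * c' 1 * y t - (s' 1 - c 1) * x t) ^ 2 := by
          rw [hF, hDdef]
          linear_combination (4 * x t ^ 2) * hdet
        nlinarith [sq_nonneg (2 * c' 1 * y t - (s' 1 - c 1) * x t)]
      · rw [abs_neg]; exact le_max_right _ _
    · refine (hlt (y t) (s 1) ?_).trans (le_max_left _ _)
      have : 4 * (s 1) * F - D * y t ^ 2 = (2 * s 1 * x t + (s' 1 - c 1) * y t) ^ 2 := by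
        rw [hF, hDdef]
        linear_combination (4 * y t ^ 2) * hdet
      nlinarith [sq_nonneg (2 * s 1 * x t + (s' 1 - c 1) * y t)]
  obtain ⟨B₁, hB₁⟩ := key c s hcc hsc (fun t ht => (h.shift_c hQ hper ht).1)
    (fun t ht => (h.shift_s hQ hper ht).1)
  obtain ⟨B₂, hB₂⟩ := key c' s' hcc' hsc' (fun t ht => (h.shift_c hQ hper ht).2)
    (fun t ht => (h.shift_s hQ hper ht).2)
  exact ⟨max B₁ B₂, fun t ht => ⟨(hB₁ t ht).1.trans (le_max_left _ _),
    (hB₂ t ht).1.trans (le_max_right _ _), (hB₁ t ht).2.trans (le_max_left _ _),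
    (hB₂ t ht).2.trans (le_max_right _ _)⟩⟩

/-- The determinant relation leaves only the multipliers `±1`, so the absolute values of all
solutions are periodic. -/
theorem stable_of_scalar (hQ : IsBddCoeff Q M) (hper : Function.Periodic Q 1)
    (h : IsFund Q c c' s s') (h1 : s 1 = 0) (h2 : c' 1 = 0) (h3 : c 1 = s' 1) :
    Stable c c' s s' := by
  have hdet := h.det_eq_one hQ zero_le_one
  have hsq : c 1 ^ 2 = 1 := by rw [h1, ← h3] at hdet; linarith
  have key : ∀ x : ℝ → ℝ, Continuous x → (∀ t, 0 ≤ t → x (t + 1) = c 1 * x t) →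
      ∃ B, ∀ t, 0 ≤ t → |x t| ≤ B := by
    intro x hx hs
    obtain ⟨B, hB⟩ := exists_bound_of_periodic (F := fun t => |x t|) hx.abs (fun t ht => by
      have : |c 1| = 1 := (abs_eq zero_le_one).2 (sq_eq_one_iff.1 hsq)
      simp only [hs t ht, abs_mul, this, one_mul])
    exact ⟨B, fun t ht => by simpa using hB t ht⟩
  obtain ⟨B₁, hB₁⟩ := key c h.solc.cont fun t ht => by rw [(h.shift_c hQ hper ht).1, h2]; ring
  obtain ⟨B₂, hB₂⟩ := key c' h.solc.cont' fun t ht => by rw [(h.shift_c hQ hper ht).2, h2]; ring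
  obtain ⟨B₃, hB₃⟩ := key s h.sols.cont fun t ht => by
    rw [(h.shift_s hQ hper ht).1, h1, ← h3]; ring
  obtain ⟨B₄, hB₄⟩ := key s' h.sols.cont' fun t ht => by
    rw [(h.shift_s hQ hper ht).2, h1, ← h3]; ring
  refine ⟨max (max B₁ B₂) (max B₃ B₄), fun t ht => ⟨?_, ?_, ?_, ?_⟩⟩
  · exact (hB₁ t ht).trans ((le_max_left _ _).trans (le_max_left _ _))
  · exact (hB₂ t ht).trans ((le_max_right _ _).trans (le_max_left _ _))
  · exact (hB₃ t ht).trans ((le_max_left _ _).trans (le_max_right _ _))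
  · exact (hB₄ t ht).trans ((le_max_right _ _).trans (le_max_right _ _))

/-! ### Variation of the discriminant -/

/-- An exact difference formula, obtained by combining the four Wronskian identities on `[0, 1]`
between old and new fundamental solutions. As `d → 0` the bracket tends to the integral over a
period of the invariant quadratic form evaluated at `(c, s)`, so no differentiability of the
discriminant has to be discussed. -/
theorem discriminant_sub {d : ℝ} (hQ : IsBddCoeff Q M) (hQ₁ : IsBddCoeff (fun t => Q t - d) M)
    (h : IsFund Q c c' s s') {γ γ' σ σ' : ℝ → ℝ} (h₁ : IsFund (fun t => Q t - d) γ γ' σ σ') :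
    (γ 1 + σ' 1) - (c 1 + s' 1) = -d * (s 1 * (∫ t in 0..1, c t * γ t)
      + s' 1 * (∫ t in 0..1, c t * σ t) - c 1 * (∫ t in 0..1, s t * γ t)
      - c' 1 * ∫ t in 0..1, s t * σ t) := by
  have hdet := h.det_eq_one hQ zero_le_one
  have e1 := h.solc.wronskian_sub hQ hQ₁ h₁.solc zero_le_one
  have e2 := h.solc.wronskian_sub hQ hQ₁ h₁.sols zero_le_one
  have e3 := h.sols.wronskian_sub hQ hQ₁ h₁.solc zero_le_one
  have e4 := h.sols.wronskian_sub hQ hQ₁ h₁.sols zero_le_one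
  simp only [h.c0, h.c0', h.s0, h.s0', h₁.c0, h₁.c0', h₁.s0, h₁.s0'] at e1 e2 e3 e4
  linear_combination s 1 * e1 + s' 1 * e2 - c 1 * e3 - c' 1 * e4 - (γ 1 + σ' 1) * hdet

theorem _root_.IsSol.tendsto_integral_mul {y z : ℝ → ℝ} (hQ : IsBddCoeff Q M) (h : IsSol Q y z)
    {η : ℝ} (hη : 0 < η) (hM : ∀ d, |d| < η → IsBddCoeff (fun t => Q t - d) M)
    {Y Z : ℝ → ℝ → ℝ} (hY : ∀ d, |d| < η → IsSol (fun t => Q t - d) (Y d) (Z d))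
    (e : ∀ d, |d| < η → Y d 0 = y 0) (e' : ∀ d, |d| < η → Z d 0 = z 0) {F : ℝ → ℝ}
    (hF : Continuous F) :
    Tendsto (fun d => ∫ t in 0..1, F t * Y d t) (𝓝 0) (𝓝 (∫ t in 0..1, F t * y t)) := by
  obtain ⟨B, hB0, hB⟩ := h.exists_bound 1
  obtain ⟨K, hK⟩ := isCompact_Icc.exists_bound_of_continuousOn (s := Icc (0 : ℝ) 1) hF.continuousOn
  have hK0 : 0 ≤ K := (norm_nonneg _).trans (hK 0 (by simp))
  have hM0 : 0 ≤ M := by linarith [hQ.one_le]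
  rw [tendsto_iff_norm_sub_tendsto_zero]
  have hlim : Tendsto (fun d : ℝ => K * (|d| * B * 1 * Real.exp (M * 1)) * |(1 : ℝ) - 0|)
      (𝓝 0) (𝓝 0) := by
    have : Continuous fun d : ℝ => K * (|d| * B * 1 * Real.exp (M * 1)) * |(1 : ℝ) - 0| := by
      fun_prop
    simpa using this.tendsto 0
  refine squeeze_zero' (Eventually.of_forall fun _ => norm_nonneg _) ?_ hlim
  have hnear : ∀ᶠ d : ℝ in 𝓝 0, |d| < η := by
    filter_upwards [Metric.ball_mem_nhds (0 : ℝ) hη] with d hd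
    simpa using hd
  filter_upwards [hnear] with d hd
  rw [← intervalIntegral.integral_sub
    ((hF.fun_mul (hY d hd).cont).intervalIntegrable _ _)
    ((hF.fun_mul h.cont).intervalIntegrable _ _)]
  refine intervalIntegral.norm_integral_le_of_norm_le_const fun t ht => ?_
  rw [uIoc_of_le zero_le_one] at ht
  have ht' : t ∈ Icc (0 : ℝ) 1 := ⟨ht.1.le, ht.2⟩
  rw [← mul_sub, norm_mul]
  have h1 := h.dist_le hQ (hM d hd) (hY d hd) (e d hd) (e' d hd) (fun s hs => (hB s hs).1) ht'
  have h2 : Real.exp (M * t) ≤ Real.exp (M * 1) := by gcongr; exact ht.2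
  refine mul_le_mul (hK t ht') ?_ (norm_nonneg _) hK0
  calc ‖Y d t - y t‖ ≤ |Y d t - y t| + |Z d t - z t| := by
        rw [Real.norm_eq_abs]; linarith [abs_nonneg (Z d t - z t)]
    _ ≤ |d| * B * 1 * Real.exp (M * t) := h1
    _ ≤ _ := by gcongr

/-- A nontrivial solution does not vanish identically on a period. -/
theorem _root_.IsSol.exists_ne_zero {y z y₁ z₁ : ℝ → ℝ} (hQ : IsBddCoeff Q M) (h : IsSol Q y z)
    (h₁ : IsSol Q y₁ z₁) (hW : y 0 * z₁ 0 - z 0 * y₁ 0 ≠ 0) : ∃ t ∈ Icc (0 : ℝ) 1, y t ≠ 0 := by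
  by_contra! hc
  have hd := h.hasDerivAt (t := 1 / 2) (by norm_num)
  have h0 : HasDerivAt y 0 (1 / 2) := by
    refine (hasDerivAt_const (1 / 2 : ℝ) (0 : ℝ)).congr_of_eventuallyEq ?_
    filter_upwards [Icc_mem_nhds (by norm_num : (0 : ℝ) < 1 / 2) (by norm_num : (1 / 2 : ℝ) < 1)]
      with t ht using hc t ht
  have hw := h.wronskian_eq hQ h₁ (t := 1 / 2) (by norm_num)
  rw [hd.unique h0, hc (1 / 2) ⟨by norm_num, by norm_num⟩] at hw
  exact hW (by linarith)

/-- If the discriminant has modulus `2` and does not cross this value, then the monodromy matrix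
is scalar. -/
theorem scalar_of_discriminant (hQ : IsBddCoeff Q M)
    (h : IsFund Q c c' s s') (hD : |c 1 + s' 1| = 2) {η : ℝ} (hη : 0 < η)
    (hM : ∀ d, |d| < η → IsBddCoeff (fun t => Q t - d) M)
    (hlt : ∀ d, |d| < η → ∀ γ γ' σ σ', IsFund (fun t => Q t - d) γ γ' σ σ' →
      |γ 1 + σ' 1| ≤ 2) : s 1 = 0 ∧ c' 1 = 0 ∧ c 1 = s' 1 := by
  have hcc := h.solc.cont
  have hsc := h.sols.cont
  have hdet := h.det_eq_one hQ zero_le_one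
  have hex : ∀ d : ℝ, ∃ γ γ' σ σ', |d| < η → IsFund (fun t => Q t - d) γ γ' σ σ' := by
    intro d
    by_cases hd : |d| < η
    · obtain ⟨γ, γ', σ, σ', hf⟩ := (hM d hd).exists_isFund
      exact ⟨γ, γ', σ, σ', fun _ => hf⟩
    · exact ⟨0, 0, 0, 0, fun h => absurd h hd⟩
  choose γ γ' σ σ' hf using hex
  have lc {F : ℝ → ℝ} (hF : Continuous F) := h.solc.tendsto_integral_mul hQ hη hM
    (fun d hd => (hf d hd).solc) (fun d hd => by rw [(hf d hd).c0, h.c0])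
    (fun d hd => by rw [(hf d hd).c0', h.c0']) hF
  have ls {F : ℝ → ℝ} (hF : Continuous F) := h.sols.tendsto_integral_mul hQ hη hM
    (fun d hd => (hf d hd).sols) (fun d hd => by rw [(hf d hd).s0, h.s0])
    (fun d hd => by rw [(hf d hd).s0', h.s0']) hF
  have hlim := ((((lc hcc).const_mul (s 1)).add ((ls hcc).const_mul (s' 1))).sub
    ((lc hsc).const_mul (c 1))).sub ((ls hsc).const_mul (c' 1))
  have hlim2 := hlim.const_mul (c 1 + s' 1)
  -- With `Δ = ±2` and `|Δ(d)| ≤ 2`, the product `Δ (Δ - Δ(d))` is nonnegative; by the difference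
  -- formula it equals `d` times `Δ` times the bracket.
  have hsign : ∀ d, |d| < η → 0 ≤ d * ((c 1 + s' 1) * (s 1 * (∫ t in 0..1, c t * γ d t)
      + s' 1 * (∫ t in 0..1, c t * σ d t) - c 1 * (∫ t in 0..1, s t * γ d t)
      - c' 1 * ∫ t in 0..1, s t * σ d t)) := by
    intro d hd
    have e := discriminant_sub hQ (hM d hd) h (hf d hd)
    have h2 := abs_le.1 (hlt d hd _ _ _ _ (hf d hd))
    have h3 : 0 ≤ (c 1 + s' 1) * ((c 1 + s' 1) - (γ d 1 + σ' d 1)) := by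
      rcases (abs_eq (by norm_num)).1 hD with h4 | h4 <;> rw [h4] <;> linarith
    refine h3.trans_eq ?_
    linear_combination -(c 1 + s' 1) * e
  have hnear : ∀ᶠ d : ℝ in 𝓝 0, |d| < η := by
    filter_upwards [Metric.ball_mem_nhds (0 : ℝ) hη] with d hd
    simpa using hd
  -- The bracket times `Δ` is nonpositive for `d < 0` and nonnegative for `d > 0`, so its limit at
  -- `0` vanishes.
  have hJ := le_antisymm
    (le_of_tendsto (hlim2.mono_left (nhdsWithin_le_nhds (s := Iio 0))) (by
      filter_upwards [nhdsWithin_le_nhds hnear, self_mem_nhdsWithin] with d hd hd0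
      have h5 := hsign d hd
      have h6 : d < 0 := hd0
      by_contra! h7
      exact absurd h5 (not_le.2 (mul_neg_of_neg_of_pos h6 h7))))
    (ge_of_tendsto (hlim2.mono_left (nhdsWithin_le_nhds (s := Ioi 0))) (by
      filter_upwards [nhdsWithin_le_nhds hnear, self_mem_nhdsWithin] with d hd hd0
      exact nonneg_of_mul_nonneg_right (hsign d hd) hd0))
  have hD0 : c 1 + s' 1 ≠ 0 := by
    intro h0
    rw [h0, abs_zero] at hD
    norm_num at hD
  have hJ0 := (mul_eq_zero.1 hJ).resolve_left hD0
  -- Since `Δ² = 4`, the form is degenerate, hence plus or minus a perfect square. Its integral is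
  -- zero, so its coefficients must vanish one after the other.
  have hdisc : (s' 1 - c 1) ^ 2 + 4 * s 1 * c' 1 = 0 := by
    have : (c 1 + s' 1) ^ 2 = 4 := by rw [← sq_abs, hD]; norm_num
    linear_combination this - 4 * hdet
  have hG : ∫ t in 0..1, (s 1 * (c t * c t) + s' 1 * (c t * s t) - c 1 * (s t * c t)
      - c' 1 * (s t * s t)) = 0 := by
    rw [intervalIntegral.integral_sub, intervalIntegral.integral_sub,
      intervalIntegral.integral_add]
    · simpa only [intervalIntegral.integral_const_mul] using hJ0
    all_goals exact Continuous.intervalIntegrable (by fun_prop) _ _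
  -- Multiplied by `s 1`, the integrand is nonnegative, and at `t = 0` it equals `(s 1)²`.
  have hs1 : s 1 = 0 := by
    by_contra hne
    have hpos : 0 < ∫ t in 0..1, s 1 * (s 1 * (c t * c t) + s' 1 * (c t * s t)
        - c 1 * (s t * c t) - c' 1 * (s t * s t)) := by
      refine intervalIntegral.integral_pos zero_lt_one (Continuous.continuousOn (by fun_prop))
        (fun t _ => ?_) ⟨0, by simp, ?_⟩
      · have : 4 * (s 1 * (s 1 * (c t * c t) + s' 1 * (c t * s t)
            - c 1 * (s t * c t) - c' 1 * (s t * s t)))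
            = (2 * s 1 * c t + (s' 1 - c 1) * s t) ^ 2 := by
          linear_combination -(s t ^ 2) * hdisc
        nlinarith [sq_nonneg (2 * s 1 * c t + (s' 1 - c 1) * s t)]
      · rw [h.c0, h.s0]
        have : 0 < s 1 * s 1 := mul_self_pos.2 hne
        linarith
    rw [intervalIntegral.integral_const_mul, hG, mul_zero] at hpos
    exact lt_irrefl _ hpos
  have hcs : c 1 = s' 1 := by
    rw [hs1] at hdisc
    have : (s' 1 - c 1) ^ 2 = 0 := by linarith
    have := pow_eq_zero_iff (two_ne_zero) |>.1 this
    linarith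
  refine ⟨hs1, ?_, hcs⟩
  by_contra hne
  obtain ⟨t₀, ht₀, hst₀⟩ := h.sols.exists_ne_zero hQ h.solc
    (by rw [h.s0, h.s0', h.c0, h.c0']; norm_num)
  have hpos : 0 < ∫ t in 0..1, c' 1 * -(s 1 * (c t * c t) + s' 1 * (c t * s t)
      - c 1 * (s t * c t) - c' 1 * (s t * s t)) := by
    have e : ∀ t, c' 1 * -(s 1 * (c t * c t) + s' 1 * (c t * s t)
        - c 1 * (s t * c t) - c' 1 * (s t * s t)) = (c' 1 * s t) ^ 2 := by
      intro t
      rw [hs1, hcs]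
      ring
    refine intervalIntegral.integral_pos zero_lt_one (Continuous.continuousOn (by fun_prop))
      (fun t _ => ?_) ⟨t₀, ht₀, ?_⟩
    · rw [e]; positivity
    · rw [e]
      have := mul_ne_zero hne hst₀
      positivity
  rw [intervalIntegral.integral_const_mul, intervalIntegral.integral_neg, hG] at hpos
  simp at hpos

end IsFund

/-! ### Exponential dichotomy in a gap -/

/-- An exponentially decaying solution `φ` and an exponentially growing solution `ψ` of
`y'' = Q y` with Wronskian `1`. -/
structure IsDichotomy (Q : ℝ → ℝ) (φ φ' ψ ψ' : ℝ → ℝ) (ρ κ K : ℝ) : Prop where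
  solφ : IsSol Q φ φ'
  solψ : IsSol Q ψ ψ'
  wronskian : φ 0 * ψ' 0 - φ' 0 * ψ 0 = 1
  ne_zero : ρ ≠ 0
  mult : ∀ t, 0 ≤ t → φ (t + 1) = ρ * φ t
  mult' : ∀ t, 0 ≤ t → φ' (t + 1) = ρ * φ' t
  pos : 0 < κ
  boundφ : ∀ t, 0 ≤ t → |φ t| ≤ K * Real.exp (-(κ * t))
  boundφ' : ∀ t, 0 ≤ t → |φ' t| ≤ K * Real.exp (-(κ * t))
  boundψ : ∀ t, 0 ≤ t → |ψ t| ≤ K * Real.exp (κ * t)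
  boundψ' : ∀ t, 0 ≤ t → |ψ' t| ≤ K * Real.exp (κ * t)

theorem exists_kernel_vector {a b c d : ℝ} (h : a * d = b * c) :
    ∃ x y : ℝ, (x ≠ 0 ∨ y ≠ 0) ∧ a * x + b * y = 0 ∧ c * x + d * y = 0 := by
  by_cases hb : b = 0
  · by_cases ha : a = 0
    · by_cases hd : d = 0
      · by_cases hc : c = 0
        · exact ⟨1, 0, by simp, by simp [ha], by simp [hc]⟩
        · exact ⟨0, 1, by simp, by simp [hb], by simp [hd]⟩
      · exact ⟨d, -c, Or.inl hd, by simp [ha, hb], by ring⟩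
    · exact ⟨b, -a, Or.inr (by simpa using ha), by ring, by linarith⟩
  · exact ⟨b, -a, Or.inl hb, by ring, by linarith⟩

/-- The function `|F t| e^(κ t)` is periodic. The sign of `κ` is free, so this serves for decay and
for growth. -/
theorem exists_bound_of_multiplier {F : ℝ → ℝ} (hF : Continuous F) {ρ κ : ℝ}
    (hκ : |ρ| * Real.exp κ = 1) (hp : ∀ t, 0 ≤ t → F (t + 1) = ρ * F t) :
    ∃ K, ∀ t, 0 ≤ t → |F t| ≤ K * Real.exp (-(κ * t)) := by
  obtain ⟨K, hK⟩ := exists_bound_of_periodic (F := fun t => |F t| * Real.exp (κ * t))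
    (by fun_prop) (fun t ht => by
      simp only [hp t ht, abs_mul]
      rw [mul_add, Real.exp_add, mul_one]
      linear_combination (|F t| * Real.exp (κ * t)) * hκ)
  refine ⟨K, fun t ht => ?_⟩
  have h1 := hK t ht
  rw [abs_of_nonneg (by positivity)] at h1
  rw [Real.exp_neg, ← div_eq_mul_inv, le_div_iff₀ (Real.exp_pos _)]
  exact h1

/-- The characteristic polynomial `X² - Δ X + 1` has real roots `ρ`, `ρ'` with `|ρ| < 1 < |ρ'|`.
Eigenvectors of the monodromy matrix give solutions that are multiplied by these roots over each
period, and `κ = -log |ρ|`. -/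
theorem IsFund.exists_dichotomy {Q : ℝ → ℝ} {M : ℝ} {c c' s s' : ℝ → ℝ} (hQ : IsBddCoeff Q M)
    (hper : Function.Periodic Q 1) (h : IsFund Q c c' s s') (hD : 2 < |c 1 + s' 1|) :
    ∃ φ φ' ψ ψ' ρ κ K, IsDichotomy Q φ φ' ψ ψ' ρ κ K := by
  have hdet := h.det_eq_one hQ zero_le_one
  obtain ⟨ρ, ρ', hmul, hadd, hlt⟩ : ∃ ρ ρ' : ℝ, ρ * ρ' = 1 ∧ ρ + ρ' = c 1 + s' 1 ∧ |ρ| < 1 := by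
    set D := c 1 + s' 1
    have hD2 : 0 ≤ D ^ 2 - 4 := by
      rw [← sq_abs]
      nlinarith
    have hr := Real.sq_sqrt hD2
    set r := √(D ^ 2 - 4)
    have h1 : (D - r) / 2 * ((D + r) / 2) = 1 := by linear_combination -(1 / 4) * hr
    have h2 : (D - r) / 2 + (D + r) / 2 = D := by ring
    have h3 : |(D - r) / 2| * |(D + r) / 2| = 1 := by rw [← abs_mul, h1, abs_one]
    have h4 : 2 < |(D - r) / 2| + |(D + r) / 2| := by
      have := abs_add_le ((D - r) / 2) ((D + r) / 2)
      rw [h2] at this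
      linarith
    rcases lt_or_ge |(D - r) / 2| 1 with h5 | h5
    · exact ⟨_, _, h1, h2, h5⟩
    · refine ⟨(D + r) / 2, (D - r) / 2, by linarith, by linarith, ?_⟩
      by_contra! h6
      nlinarith
  have hρ : 0 < |ρ| := abs_pos.2 (left_ne_zero_of_mul_eq_one hmul)
  have hne : ρ ≠ ρ' := by
    rintro rfl
    have : |ρ| * |ρ| = 1 := by rw [← abs_mul, hmul, abs_one]
    nlinarith
  set κ := -Real.log |ρ| with hκ
  have hκ0 : 0 < κ := neg_pos.2 (Real.log_neg hρ hlt)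
  have e1 : |ρ| * Real.exp κ = 1 := by
    rw [hκ, Real.exp_neg, Real.exp_log hρ, mul_inv_cancel₀ hρ.ne']
  have e2 : |ρ'| * Real.exp (-κ) = 1 := by
    rw [hκ, neg_neg, Real.exp_log hρ, ← abs_mul, mul_comm, hmul, abs_one]
  obtain ⟨α, β, hv, h1, h2⟩ := exists_kernel_vector (a := c 1 - ρ) (b := s 1) (c := c' 1)
    (d := s' 1 - ρ) (by linear_combination hdet - hmul + ρ * hadd)
  obtain ⟨α', β', hv', h1', h2'⟩ := exists_kernel_vector (a := c 1 - ρ') (b := s 1) (c := c' 1)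
    (d := s' 1 - ρ') (by linear_combination hdet - hmul + ρ' * hadd)
  set W := α * β' - β * α' with hW
  -- Eigenvectors to distinct eigenvalues are independent: if `W = 0`, then all products of their
  -- coordinates vanish.
  have hW0 : W ≠ 0 := by
    intro h0
    have hd : ρ - ρ' ≠ 0 := sub_ne_zero.2 hne
    have a1 : α' * α = 0 := by
      refine (mul_eq_zero.1 (?_ : (ρ - ρ') * (α' * α) = 0)).resolve_left hd
      linear_combination -α' * h1 + α * h1' - s 1 * (h0.symm.trans hW).symm
    have a2 : β' * β = 0 := by
      refine (mul_eq_zero.1 (?_ : (ρ - ρ') * (β' * β) = 0)).resolve_left hd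
      linear_combination -β' * h2 + β * h2' + c' 1 * (h0.symm.trans hW).symm
    have a3 : α' * β = 0 := by
      refine (mul_eq_zero.1 (?_ : (ρ - ρ') * (α' * β) = 0)).resolve_left hd
      linear_combination -α' * h2 + α * h2' - (s' 1 - ρ') * (h0.symm.trans hW).symm
    have a4 : α * β' = 0 := by linarith
    rcases hv with hv | hv <;> rcases hv' with hv' | hv' <;> simp_all
  have hcc := h.solc.cont
  have hcc' := h.solc.cont'
  have hsc := h.sols.cont
  have hsc' := h.sols.cont'
  have hφ := h.solc.lin hQ h.sols α β
  have hψ := h.solc.lin hQ h.sols (α' / W) (β' / W)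
  obtain ⟨K₁, hK₁⟩ := exists_bound_of_multiplier (F := fun t => α * c t + β * s t)
    (by fun_prop) e1 (fun t ht => by
      rw [(h.shift_c hQ hper ht).1, (h.shift_s hQ hper ht).1]
      linear_combination c t * h1 + s t * h2)
  obtain ⟨K₂, hK₂⟩ := exists_bound_of_multiplier (F := fun t => α * c' t + β * s' t)
    (by fun_prop) e1 (fun t ht => by
      rw [(h.shift_c hQ hper ht).2, (h.shift_s hQ hper ht).2]
      linear_combination c' t * h1 + s' t * h2)
  obtain ⟨K₃, hK₃⟩ := exists_bound_of_multiplier (F := fun t => α' / W * c t + β' / W * s t)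
    (by fun_prop) e2 (fun t ht => by
      rw [(h.shift_c hQ hper ht).1, (h.shift_s hQ hper ht).1]
      linear_combination (c t * h1' + s t * h2') / W)
  obtain ⟨K₄, hK₄⟩ := exists_bound_of_multiplier (F := fun t => α' / W * c' t + β' / W * s' t)
    (by fun_prop) e2 (fun t ht => by
      rw [(h.shift_c hQ hper ht).2, (h.shift_s hQ hper ht).2]
      linear_combination (c' t * h1' + s' t * h2') / W)
  set K := max (max K₁ K₂) (max K₃ K₄) with hK
  refine ⟨_, _, _, _, ρ, κ, K, hφ, hψ, ?_, abs_pos.1 hρ, ?_, ?_, hκ0, ?_, ?_, ?_, ?_⟩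
  · simp only [h.c0, h.c0', h.s0, h.s0']
    have : (α * β' - β * α') / W = 1 := div_self hW0
    linear_combination this
  · intro t ht
    rw [(h.shift_c hQ hper ht).1, (h.shift_s hQ hper ht).1]
    linear_combination c t * h1 + s t * h2
  · intro t ht
    rw [(h.shift_c hQ hper ht).2, (h.shift_s hQ hper ht).2]
    linear_combination c' t * h1 + s' t * h2
  · exact fun t ht => (hK₁ t ht).trans (by gcongr; exact (le_max_left _ _).trans (le_max_left _ _))
  · exact fun t ht => (hK₂ t ht).trans (by gcongr; exact (le_max_right _ _).trans (le_max_left _ _))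
  · intro t ht
    have := hK₃ t ht
    rw [neg_mul, neg_neg] at this
    exact this.trans (by gcongr; exact (le_max_left _ _).trans (le_max_right _ _))
  · intro t ht
    have := hK₄ t ht
    rw [neg_mul, neg_neg] at this
    exact this.trans (by gcongr; exact (le_max_right _ _).trans (le_max_right _ _))

/-! ## Integral operators on the half-line -/

section Kernels

variable {p : ℝ≥0∞} {D : ℝ → ℝ≥0∞} {a : ℝ}

theorem measurableSet_snd_mem_Ioi : MeasurableSet {x : ℝ × ℝ | x.1 < x.2} :=
  measurableSet_lt measurable_fst measurable_snd

/-- Schur's test for the indicator of `t < s ≤ t + η`, whose sections in both variables have length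
at most `η`. -/
theorem eLpNorm_window_le (hp1 : 1 ≤ p) (hp : p ≠ ⊤) (η : ℝ)
    (hD : AEMeasurable D (volume.restrict (Ioi a))) :
    AEMeasurable (fun t => ∫⁻ s in Ioc t (t + η), D s) (volume.restrict (Ioi a)) ∧
    eLpNorm (fun t => ∫⁻ s in Ioc t (t + η), D s) p (volume.restrict (Ioi a)) ≤
      ENNReal.ofReal η * eLpNorm D p (volume.restrict (Ioi a)) := by
  let S : Set (ℝ × ℝ) := {x | x.1 < x.2 ∧ x.2 ≤ x.1 + η}
  have hS : MeasurableSet S := (measurableSet_lt measurable_fst measurable_snd).inter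
    (measurableSet_le measurable_snd (measurable_fst.add_const η))
  have h1 : ∀ t s : ℝ, S.indicator (fun _ => (1 : ℝ≥0∞)) (t, s) =
      (Ioc t (t + η)).indicator (fun _ => 1) s := by
    intro t s
    simp only [indicator, S, mem_ofPred_eq, mem_Ioc]
  have h2 : ∀ t s : ℝ, S.indicator (fun _ => (1 : ℝ≥0∞)) (t, s) =
      (Ico (s - η) s).indicator (fun _ => 1) t := by
    intro t s
    simp only [indicator, S, mem_ofPred_eq, mem_Ico, sub_le_iff_le_add, and_comm]
  have hk : Measurable (Function.uncurry fun t s : ℝ =>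
      S.indicator (fun _ => (1 : ℝ≥0∞)) (t, s)) := measurable_const.indicator hS
  have key := eLpNorm_lintegral_kernel_le (μ := volume.restrict (Ioi a)) hp1 hp
    (k := fun t s => S.indicator (fun _ => 1) (t, s)) (A := ENNReal.ofReal η) hk ?_ ?_ hD
  · suffices hcongr : (fun t => ∫⁻ s in Ioc t (t + η), D s) =ᵐ[volume.restrict (Ioi a)]
        fun t => ∫⁻ s in Ioi a, S.indicator (fun _ => 1) (t, s) * D s from
      ⟨(aemeasurable_lintegral_kernel hk hD).congr hcongr.symm,
        le_of_eq_of_le (eLpNorm_congr_ae hcongr) key⟩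
    filter_upwards [ae_restrict_mem measurableSet_Ioi] with t ht
    simp only [h1]
    rw [← lintegral_indicator measurableSet_Ioc, ← lintegral_indicator measurableSet_Ioi]
    refine lintegral_congr fun s => ?_
    by_cases hs : s ∈ Ioc t (t + η)
    · rw [indicator_of_mem hs, indicator_of_mem (mem_Ioi.2 ((mem_Ioi.1 ht).trans hs.1)),
        indicator_of_mem hs, one_mul]
    · simp [indicator, hs]
  · refine Eventually.of_forall fun t => ?_
    simp only [h1]
    refine (lintegral_mono' Measure.restrict_le_self le_rfl).trans ?_
    rw [lintegral_indicator measurableSet_Ioc]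
    simp
  · refine Eventually.of_forall fun s => ?_
    simp only [h2]
    refine (lintegral_mono' Measure.restrict_le_self le_rfl).trans ?_
    rw [lintegral_indicator measurableSet_Ico]
    simp

/-- The tail integral with an integrable power weight has small norm far out on the half-line. -/
theorem exists_eLpNorm_tail_le (hp1 : 1 ≤ p) (hp : p ≠ ⊤) {δ : ℝ} (hδ : 1 < δ) :
    ∃ A : ℝ → ℝ≥0∞, Tendsto A atTop (𝓝 0) ∧ ∀ a, 0 ≤ a → ∀ D : ℝ → ℝ≥0∞,
      AEMeasurable D (volume.restrict (Ioi a)) →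
      AEMeasurable (fun t => ∫⁻ s in Ioi t, ENNReal.ofReal ((1 + s) ^ (-δ)) * D s)
        (volume.restrict (Ioi a)) ∧
      eLpNorm (fun t => ∫⁻ s in Ioi t, ENNReal.ofReal ((1 + s) ^ (-δ)) * D s) p
        (volume.restrict (Ioi a)) ≤ A a * eLpNorm D p (volume.restrict (Ioi a)) := by
  set ε := (δ - 1) / 2 with hε
  have hε0 : 0 < ε := by rw [hε]; linarith
  set I := ∫⁻ s in Ioi (0 : ℝ), ENNReal.ofReal ((s + 1) ^ (-(1 + ε))) with hI
  have hIfin : I ≠ ⊤ := by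
    have h := integrableOn_add_rpow_Ioi_of_lt (a := -(1 + ε)) (c := 0) (m := 1) (by linarith)
      (by norm_num)
    refine ne_of_lt (lt_of_le_of_lt (lintegral_mono fun s => ?_) h.hasFiniteIntegral)
    exact Real.ofReal_le_enorm _
  -- Half of the excess `δ - 1` yields the decay in `a`; the rest keeps the weight integrable. In
  -- the maximum, `I` bounds the integral in `s` and `1` the integral in `t`, where the length `s -
  -- a` is beaten by `(1 + s)^(-(1 + ε))`.
  refine ⟨fun a => ENNReal.ofReal ((1 + a) ^ (-ε)) * max I 1, ?_, fun a ha D hD => ?_⟩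
  · have h1 : Tendsto (fun a : ℝ => (1 + a) ^ (-ε)) atTop (𝓝 0) :=
      (tendsto_rpow_neg_atTop hε0).comp (tendsto_atTop_add_const_left _ _ tendsto_id)
    have h2 := ENNReal.Tendsto.mul_const (ENNReal.tendsto_ofReal h1) (b := max I 1)
      (Or.inr (by simp [hIfin]))
    simpa using h2
  · have hw : ∀ s, a < s → (1 + s) ^ (-δ) ≤ (1 + a) ^ (-ε) * (s + 1) ^ (-(1 + ε)) := by
      intro s hs
      have e : -δ = -ε + -(1 + ε) := by rw [hε]; ring
      rw [e, Real.rpow_add (by linarith), add_comm 1 s]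
      refine mul_le_mul_of_nonneg_right ?_ (Real.rpow_nonneg (by linarith) _)
      exact Real.rpow_le_rpow_of_nonpos (by linarith) (by linarith) (by linarith)
    have hS := measurableSet_snd_mem_Ioi
    have h1 : ∀ t s : ℝ, {x : ℝ × ℝ | x.1 < x.2}.indicator
        (fun x => ENNReal.ofReal ((1 + x.2) ^ (-δ))) (t, s) =
        (Ioi t).indicator (fun s => ENNReal.ofReal ((1 + s) ^ (-δ))) s := by
      intro t s
      simp only [indicator, mem_ofPred_eq, mem_Ioi]
    have hk : Measurable (Function.uncurry fun t s : ℝ => {x : ℝ × ℝ | x.1 < x.2}.indicator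
        (fun x => ENNReal.ofReal ((1 + x.2) ^ (-δ))) (t, s)) :=
      Measurable.indicator (by fun_prop) hS
    have key := eLpNorm_lintegral_kernel_le (μ := volume.restrict (Ioi a)) hp1 hp
      (k := fun t s => {x : ℝ × ℝ | x.1 < x.2}.indicator
        (fun x => ENNReal.ofReal ((1 + x.2) ^ (-δ))) (t, s))
      (A := ENNReal.ofReal ((1 + a) ^ (-ε)) * max I 1) hk ?_ ?_ hD
    · suffices hcongr : (fun t => ∫⁻ s in Ioi t, ENNReal.ofReal ((1 + s) ^ (-δ)) * D s)
          =ᵐ[volume.restrict (Ioi a)] fun t => ∫⁻ s in Ioi a, {x : ℝ × ℝ | x.1 < x.2}.indicator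
            (fun x => ENNReal.ofReal ((1 + x.2) ^ (-δ))) (t, s) * D s from
        ⟨(aemeasurable_lintegral_kernel hk hD).congr hcongr.symm,
          le_of_eq_of_le (eLpNorm_congr_ae hcongr) key⟩
      filter_upwards [ae_restrict_mem measurableSet_Ioi] with t ht
      simp only [h1]
      rw [← lintegral_indicator measurableSet_Ioi, ← lintegral_indicator measurableSet_Ioi]
      refine lintegral_congr fun s => ?_
      by_cases hs : s ∈ Ioi t
      · rw [indicator_of_mem hs, indicator_of_mem (mem_Ioi.2 ((mem_Ioi.1 ht).trans hs)),
          indicator_of_mem hs]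
      · simp [indicator, mem_Ioi.not.1 hs]
    · refine Eventually.of_forall fun t => ?_
      simp only [h1]
      calc ∫⁻ s in Ioi a, (Ioi t).indicator (fun s => ENNReal.ofReal ((1 + s) ^ (-δ))) s
          ≤ ∫⁻ s in Ioi a, ENNReal.ofReal ((1 + a) ^ (-ε)) *
              ENNReal.ofReal ((s + 1) ^ (-(1 + ε))) := by
            refine setLIntegral_mono (by fun_prop) fun s hs => ?_
            refine (indicator_le_self _ _ _).trans ?_
            rw [← ENNReal.ofReal_mul (by positivity)]
            exact ENNReal.ofReal_le_ofReal (hw s hs)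
        _ = ENNReal.ofReal ((1 + a) ^ (-ε)) *
              ∫⁻ s in Ioi a, ENNReal.ofReal ((s + 1) ^ (-(1 + ε))) :=
            lintegral_const_mul _ (by fun_prop)
        _ ≤ _ := by
            gcongr
            refine le_trans ?_ (le_max_left _ _)
            exact lintegral_mono_set (Ioi_subset_Ioi ha)
    · filter_upwards [ae_restrict_mem measurableSet_Ioi] with s hs
      have hs' : a < s := hs
      calc ∫⁻ t in Ioi a, {x : ℝ × ℝ | x.1 < x.2}.indicator
            (fun x => ENNReal.ofReal ((1 + x.2) ^ (-δ))) (t, s)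
          = ∫⁻ t in Ioi a, (Iio s).indicator (fun _ => ENNReal.ofReal ((1 + s) ^ (-δ))) t := by
            simp only [indicator, mem_ofPred_eq, mem_Iio]
        _ = ENNReal.ofReal ((1 + s) ^ (-δ)) * ENNReal.ofReal (s - a) := by
            rw [lintegral_indicator measurableSet_Iio, Measure.restrict_restrict measurableSet_Iio,
              Iio_inter_Ioi]
            simp
        _ ≤ ENNReal.ofReal ((1 + a) ^ (-ε)) := by
            rw [← ENNReal.ofReal_mul (by have : 0 ≤ 1 + s := by linarith
                                         positivity)]
            refine ENNReal.ofReal_le_ofReal ?_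
            have h0 : (0 : ℝ) < s + 1 := by linarith
            have h3 : (s + 1) ^ (-(1 + ε)) * (s - a) ≤ 1 := by
              calc (s + 1) ^ (-(1 + ε)) * (s - a) ≤ (s + 1) ^ (-(1 : ℝ)) * (s + 1) := by
                    gcongr ?_ * ?_
                    · exact Real.rpow_le_rpow_of_exponent_le (by linarith) (by linarith)
                    · linarith
                _ = 1 := by rw [Real.rpow_neg_one, inv_mul_cancel₀ h0.ne']
            calc (1 + s) ^ (-δ) * (s - a)
                ≤ (1 + a) ^ (-ε) * (s + 1) ^ (-(1 + ε)) * (s - a) := by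
                  gcongr
                  exact hw s hs'
              _ = (1 + a) ^ (-ε) * ((s + 1) ^ (-(1 + ε)) * (s - a)) := by ring
              _ ≤ (1 + a) ^ (-ε) * 1 := by gcongr
              _ = _ := mul_one _
        _ ≤ _ := le_mul_of_one_le_right' (le_max_right _ _)

theorem integrable_exp_neg_mul_abs {κ : ℝ} (hκ : 0 < κ) :
    Integrable fun x : ℝ => Real.exp (-(κ * |x|)) := by
  rw [← integrableOn_univ, ← Iic_union_Ioi (a := (0 : ℝ))]
  refine IntegrableOn.union ?_ ?_
  · refine (integrableOn_exp_mul_Iic hκ 0).congr_fun (fun x hx => ?_) measurableSet_Iic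
    simp only [abs_of_nonpos (mem_Iic.1 hx)]
    ring_nf
  · refine (integrableOn_exp_mul_Ioi (neg_lt_zero.2 hκ) 0).congr_fun (fun x hx => ?_)
      measurableSet_Ioi
    simp only [abs_of_pos (mem_Ioi.1 hx)]
    ring_nf

/-- Schur's test for a convolution kernel; translation invariance makes the constant independent of
`a`. -/
theorem exists_eLpNorm_exp_le (hp1 : 1 ≤ p) (hp : p ≠ ⊤) {κ : ℝ} (hκ : 0 < κ) :
    ∃ A : ℝ≥0∞, A ≠ ⊤ ∧ ∀ (a : ℝ) (D : ℝ → ℝ≥0∞), AEMeasurable D (volume.restrict (Ioi a)) →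
      AEMeasurable (fun t => ∫⁻ s in Ioi a, ENNReal.ofReal (Real.exp (-(κ * |t - s|))) * D s)
        (volume.restrict (Ioi a)) ∧
      eLpNorm (fun t => ∫⁻ s in Ioi a, ENNReal.ofReal (Real.exp (-(κ * |t - s|))) * D s) p
        (volume.restrict (Ioi a)) ≤ A * eLpNorm D p (volume.restrict (Ioi a)) := by
  refine ⟨∫⁻ x, ENNReal.ofReal (Real.exp (-(κ * |x|))), ?_, fun a D hD => ?_⟩
  · refine ne_of_lt (lt_of_le_of_lt (lintegral_mono fun s => ?_)
      (integrable_exp_neg_mul_abs hκ).hasFiniteIntegral)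
    exact Real.ofReal_le_enorm _
  · have hk : Measurable (Function.uncurry fun t s : ℝ =>
        ENNReal.ofReal (Real.exp (-(κ * |t - s|)))) := by
      unfold Function.uncurry
      fun_prop
    refine ⟨aemeasurable_lintegral_kernel hk hD,
      eLpNorm_lintegral_kernel_le (μ := volume.restrict (Ioi a)) hp1 hp hk ?_ ?_ hD⟩
    · refine Eventually.of_forall fun t => ?_
      refine (lintegral_mono' Measure.restrict_le_self le_rfl).trans ?_
      rw [lintegral_sub_left_eq_self (fun x => ENNReal.ofReal (Real.exp (-(κ * |x|)))) t]
    · refine Eventually.of_forall fun s => ?_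
      refine (lintegral_mono' Measure.restrict_le_self le_rfl).trans ?_
      rw [lintegral_sub_right_eq_self (fun x => ENNReal.ofReal (Real.exp (-(κ * |x|)))) s]

theorem eLpNorm_comp_add_right {E : Type*} [TopologicalSpace E] [ContinuousENorm E] (F : ℝ → E)
    (η : ℝ) : eLpNorm (fun t => F (t + η)) p (volume.restrict (Ioi a)) =
      eLpNorm F p (volume.restrict (Ioi (a + η))) := by
  have h1 : MeasurePreserving (fun t : ℝ => t + η) (volume.restrict (Ioi a))
      (volume.restrict (Ioi (a + η))) := by
    have := (measurePreserving_add_right (volume : Measure ℝ) η).restrict_preimage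
      (s := Ioi (a + η)) measurableSet_Ioi
    simpa using this
  have h2 : MeasurableEmbedding (fun t : ℝ => t + η) := measurableEmbedding_addRight η
  rw [← h1.map_eq, h2.eLpNorm_map_measure]
  rfl

end Kernels

/-! ## Perturbed equations -/

/-- The absorption step behind all a priori estimates below; finiteness of `x` is essential. -/
theorem ENNReal.le_two_mul_of_le_add {x b c : ℝ≥0∞} (hx : x ≠ ⊤) (hc : c ≤ 2⁻¹)
    (h : x ≤ b + c * x) : x ≤ 2 * b := by
  have h1 : x ≤ b + 2⁻¹ * x := h.trans (by gcongr)
  have h2 : (2⁻¹ : ℝ≥0∞) * x ≠ ⊤ := ENNReal.mul_ne_top (by simp) hx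
  have h3 : 2⁻¹ * x + 2⁻¹ * x = x := by
    rw [← add_mul, ENNReal.inv_two_add_inv_two, one_mul]
  have h4 : 2⁻¹ * x ≤ b := by
    exact (ENNReal.add_le_add_iff_right h2).1 (h3.trans_le h1)
  calc x = 2⁻¹ * x + 2⁻¹ * x := h3.symm
    _ ≤ b + b := add_le_add h4 h4
    _ = 2 * b := (two_mul b).symm

/-- The size of `(y, z)` in phase space. -/
noncomputable def phaseNorm (y z : ℝ → ℂ) (t : ℝ) : ℝ≥0∞ := ‖y t‖ₑ + ‖z t‖ₑ

/-- The size of `(y, z)` in `L_p(a, ∞)`. -/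
noncomputable def phaseLp (p : ℝ≥0∞) (y z : ℝ → ℂ) (a : ℝ) : ℝ≥0∞ :=
  eLpNorm (phaseNorm y z) p (volume.restrict (Ioi a))

/-- The Wronskian of a real solution `φ` and `y`. -/
noncomputable def cross (φ φ' : ℝ → ℝ) (y z : ℝ → ℂ) (t : ℝ) : ℂ := φ t • z t - φ' t • y t

/-- `y` solves `y'' = Q y + h` and `z = y'`. -/
structure IsForcedSol (Q : ℝ → ℝ) (h y z : ℝ → ℂ) : Prop where
  acy : ∀ R : ℝ, 0 < R → AbsolutelyContinuousOnInterval y 0 R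
  acz : ∀ R : ℝ, 0 < R → AbsolutelyContinuousOnInterval z 0 R
  hy : ∀ᵐ t ∂halfLine, HasDerivAt y (z t) t
  hz : ∀ᵐ t ∂halfLine, HasDerivAt z (Q t • y t + h t) t

/-- `y` solves `y'' = Q y + (1 + t) ^ (-δ) g - f` in `L_p`, where `g` is controlled by `(y, y')`
on each half-line `(a, ∞)`. -/
structure IsPertSol (p : ℝ≥0∞) (Q : ℝ → ℝ) (δ : ℝ) (C : ℝ≥0∞) (f y z : ℝ → ℂ) : Prop where
  memf : MemLp f p halfLine
  memy : MemLp y p halfLine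
  memz : MemLp z p halfLine
  forced : ∃ g : ℝ → ℂ, AEStronglyMeasurable g halfLine ∧
    IsForcedSol Q (fun t => ((1 + t) ^ (-δ)) • g t - f t) y z ∧
    ∀ a, 0 ≤ a → eLpNorm g p (volume.restrict (Ioi a)) ≤ C * phaseLp p y z a

theorem restrict_Ioi_le_halfLine {a : ℝ} (ha : 0 ≤ a) : volume.restrict (Ioi a) ≤ halfLine :=
  Measure.restrict_mono (Ioi_subset_Ioi ha) le_rfl

section phaseLp

variable {p : ℝ≥0∞} {y z : ℝ → ℂ} {a : ℝ}

theorem eLpNorm_fst_le_phaseLp : eLpNorm y p (volume.restrict (Ioi a)) ≤ phaseLp p y z a :=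
  eLpNorm_mono_enorm fun t => by simp [phaseNorm]

theorem eLpNorm_snd_le_phaseLp : eLpNorm z p (volume.restrict (Ioi a)) ≤ phaseLp p y z a :=
  eLpNorm_mono_enorm fun t => by simp [phaseNorm]

theorem phaseLp_anti {b : ℝ} (hab : a ≤ b) : phaseLp p y z b ≤ phaseLp p y z a :=
  eLpNorm_mono_measure _ (Measure.restrict_mono (Ioi_subset_Ioi hab) le_rfl)

theorem phaseLp_ne_top (hp1 : 1 ≤ p) (hy : MemLp y p halfLine) (hz : MemLp z p halfLine)
    (ha : 0 ≤ a) : phaseLp p y z a ≠ ⊤ := by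
  refine ne_of_lt ((phaseLp_anti ha).trans_lt ?_)
  refine lt_of_le_of_lt (eLpNorm_add_le (f := fun t => ‖y t‖ₑ) (g := fun t => ‖z t‖ₑ) hy.1.enorm.aestronglyMeasurable
    hz.1.enorm.aestronglyMeasurable hp1) ?_
  rw [eLpNorm_enorm, eLpNorm_enorm]
  exact ENNReal.add_lt_top.2 ⟨hy.2, hz.2⟩

end phaseLp

/-- Cramer's rule: the two Wronskians are coordinates of `(y, z)` in a basis of solutions. -/
theorem cross_reconstruct {φ φ' ψ ψ' : ℝ → ℝ} {y z : ℝ → ℂ} {t : ℝ}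
    (h : φ t * ψ' t - φ' t * ψ t = 1) :
    y t = ψ t • cross φ φ' y z t - φ t • cross ψ ψ' y z t ∧
    z t = ψ' t • cross φ φ' y z t - φ' t • cross ψ ψ' y z t := by
  have h' : (φ t : ℂ) * ψ' t - φ' t * ψ t = 1 := by exact_mod_cast h
  simp only [cross, Complex.real_smul]
  constructor
  · linear_combination -(y t) * h'
  · linear_combination -(z t) * h'

/-! ### Wronskian and window estimates for forced solutions -/

namespace IsForcedSol

variable {Q : ℝ → ℝ} {M : ℝ} {h y z : ℝ → ℂ}

/-- Variation of constants: the terms with `Q` cancel, so the derivative of the Wronskian with a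
free solution `φ` is `φ h`. -/
theorem cross_sub_le (hQ : IsBddCoeff Q M) (hs : IsForcedSol Q h y z) {φ φ' : ℝ → ℝ}
    (hφ : IsSol Q φ φ') {t T : ℝ} (ht : 0 ≤ t) (hT : t < T) :
    ‖cross φ φ' y z T - cross φ φ' y z t‖ₑ ≤ ∫⁻ s in Ioc t T, ‖φ s‖ₑ * ‖h s‖ₑ := by
  have hT0 : 0 < T := ht.trans_lt hT
  have hsub : uIcc t T ⊆ uIcc 0 T := by
    rw [uIcc_of_le hT.le, uIcc_of_le hT0.le]
    exact Icc_subset_Icc_left ht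
  have key := AbsolutelyContinuousOnInterval.enorm_sub_le (f := cross φ φ' y z)
    (f' := fun s => φ s • h s) hT.le
    ((((hφ.absolutelyContinuous hT0.le).smul (hs.acz T hT0)).sub
      ((hφ.absolutelyContinuous' hQ hT0.le).smul (hs.acy T hT0))).mono hsub) ?_
  · simpa only [enorm_smul] using key
  · have hle := restrict_Ioc_le_halfLine (b := T) ht
    filter_upwards [ae_mono hle hs.hy, ae_mono hle hs.hz, ae_mono hle (hφ.ae_hasDerivAt' hQ),
      ae_restrict_mem measurableSet_Ioc] with s h1 h2 h3 hsm
    have := ((hφ.hasDerivAt (ht.trans_lt hsm.1)).smul h2).sub (h3.smul h1)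
    refine this.congr_deriv ?_
    simp only [Complex.real_smul]
    push_cast
    ring

/-- A function bounded below by a positive constant on a half-line is not in `L_p` for finite `p`.
This replaces convergence to `0` at infinity. -/
theorem exists_phaseNorm_lt {p : ℝ≥0∞} (hp1 : 1 ≤ p) (hp : p ≠ ⊤) {t : ℝ}
    (hfin : phaseLp p y z t ≠ ⊤) {ε : ℝ≥0∞} (hε : ε ≠ 0) :
    ∃ T, t < T ∧ phaseNorm y z T < ε := by
  by_contra! hc
  refine hfin (eq_top_iff.2 ?_)
  have h1 : eLpNorm (fun _ : ℝ => ε) p (volume.restrict (Ioi t)) = ⊤ := by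
    rw [eLpNorm_const _ (zero_lt_one.trans_le hp1).ne' (by simp)]
    simp only [Measure.restrict_apply_univ, Real.volume_Ioi]
    rw [ENNReal.top_rpow_of_pos (by
      have := ENNReal.toReal_pos (zero_lt_one.trans_le hp1).ne' hp
      positivity), enorm_eq_self, ENNReal.mul_top hε]
  rw [← h1]
  refine eLpNorm_mono_enorm_ae ?_
  filter_upwards [ae_restrict_mem measurableSet_Ioi] with s hs
  exact hc s hs

theorem enorm_cross_le {φ φ' : ℝ → ℝ} {B T : ℝ} (h1 : |φ T| ≤ B) (h2 : |φ' T| ≤ B) :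
    ‖cross φ φ' y z T‖ₑ ≤ ENNReal.ofReal B * phaseNorm y z T := by
  have e : ∀ x : ℝ, |x| ≤ B → ‖x‖ₑ ≤ ENNReal.ofReal B := fun x hx => by
    rw [← ofReal_norm]
    exact ENNReal.ofReal_le_ofReal hx
  refine enorm_sub_le.trans ?_
  rw [enorm_smul, enorm_smul, phaseNorm, mul_add, add_comm]
  gcongr
  · exact e _ h2
  · exact e _ h1

/-- Against a bounded `φ`, the boundary term at `T` can be made arbitrarily small by the choice of
`T`, so the Wronskian is recovered from the future alone. -/
theorem cross_le_of_bounded {p : ℝ≥0∞} (hp1 : 1 ≤ p) (hp : p ≠ ⊤) (hQ : IsBddCoeff Q M)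
    (hs : IsForcedSol Q h y z) (hfin : phaseLp p y z 0 ≠ ⊤) {φ φ' : ℝ → ℝ}
    (hφ : IsSol Q φ φ') {B : ℝ} (h1 : ∀ t, 0 ≤ t → |φ t| ≤ B) (h2 : ∀ t, 0 ≤ t → |φ' t| ≤ B)
    {t : ℝ} (ht : 0 ≤ t) :
    ‖cross φ φ' y z t‖ₑ ≤ ∫⁻ s in Ioi t, ‖φ s‖ₑ * ‖h s‖ₑ := by
  refine ENNReal.le_of_forall_pos_le_add fun ε hε _ => ?_
  have hB : 0 < |B| + 1 := by positivity
  have hBε : (ε : ℝ≥0∞) / ENNReal.ofReal (|B| + 1) ≠ 0 := by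
    refine (ENNReal.div_pos (by exact_mod_cast hε.ne') (by simp)).ne'
  obtain ⟨T, hT, hlt⟩ := exists_phaseNorm_lt hp1 hp
    (ne_of_lt ((phaseLp_anti ht).trans_lt hfin.lt_top)) hBε
  have hle : B ≤ |B| + 1 := by linarith [le_abs_self B]
  have h3 : ‖cross φ φ' y z T‖ₑ ≤ ε := by
    refine (enorm_cross_le ((h1 T (ht.trans hT.le)).trans hle)
      ((h2 T (ht.trans hT.le)).trans hle)).trans ?_
    refine (mul_le_mul_right hlt.le _).trans ?_
    exact ENNReal.mul_div_le
  have h4 : cross φ φ' y z t = cross φ φ' y z T - (cross φ φ' y z T - cross φ φ' y z t) := by ring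
  calc ‖cross φ φ' y z t‖ₑ ≤ ‖cross φ φ' y z T‖ₑ + ‖cross φ φ' y z T - cross φ φ' y z t‖ₑ := by
        nth_rw 1 [h4]
        exact enorm_sub_le
    _ ≤ ε + ∫⁻ s in Ioc t T, ‖φ s‖ₑ * ‖h s‖ₑ := add_le_add h3 (hs.cross_sub_le hQ hφ ht hT)
    _ ≤ ε + ∫⁻ s in Ioi t, ‖φ s‖ₑ * ‖h s‖ₑ := by
        gcongr
        exact Ioc_subset_Ioi_self
    _ = _ := add_comm _ _

theorem phaseNorm_le_window (hs : IsForcedSol Q h y z) {t T : ℝ} (ht : 0 ≤ t) (hT : t < T) :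
    phaseNorm y z t ≤ phaseNorm y z T +
      ∫⁻ s in Ioc t T, (‖z s‖ₑ + ‖Q s • y s + h s‖ₑ) := by
  have hT0 : 0 < T := ht.trans_lt hT
  have hsub : uIcc t T ⊆ uIcc 0 T := by
    rw [uIcc_of_le hT.le, uIcc_of_le hT0.le]
    exact Icc_subset_Icc_left ht
  have hle := restrict_Ioc_le_halfLine (b := T) ht
  have h1 := AbsolutelyContinuousOnInterval.enorm_sub_le hT.le ((hs.acy T hT0).mono hsub)
    (ae_mono hle hs.hy)
  have h2 := AbsolutelyContinuousOnInterval.enorm_sub_le hT.le ((hs.acz T hT0).mono hsub)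
    (ae_mono hle hs.hz)
  have tri : ∀ u v : ℂ, ‖u‖ₑ ≤ ‖v‖ₑ + ‖v - u‖ₑ := fun u v => by
    have : u = v - (v - u) := by ring
    nth_rw 1 [this]
    exact enorm_sub_le
  have hz : ContinuousOn z (Icc t T) := by
    rw [← uIcc_of_le hT.le]
    exact ((hs.acz T hT0).mono hsub).continuousOn
  have hm : AEMeasurable (fun s => ‖z s‖ₑ) (volume.restrict (Ioc t T)) :=
    ((hz.mono Ioc_subset_Icc_self).aestronglyMeasurable measurableSet_Ioc).enorm
  rw [lintegral_add_left' hm]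
  calc phaseNorm y z t ≤ (‖y T‖ₑ + ‖y T - y t‖ₑ) + (‖z T‖ₑ + ‖z T - z t‖ₑ) :=
        add_le_add (tri _ _) (tri _ _)
    _ = phaseNorm y z T + (‖y T - y t‖ₑ + ‖z T - z t‖ₑ) := by rw [phaseNorm]; ring
    _ ≤ _ := by gcongr

end IsForcedSol

/-! ### The perturbed equation: backward control and the stable case -/

namespace IsPertSol

variable {p : ℝ≥0∞} {Q : ℝ → ℝ} {M δ : ℝ} {C : ℝ≥0∞} {f y z : ℝ → ℂ}

theorem phaseLp_ne_top (hp1 : 1 ≤ p) (hs : IsPertSol p Q δ C f y z) {a : ℝ} (ha : 0 ≤ a) :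
    phaseLp p y z a ≠ ⊤ :=
  _root_.phaseLp_ne_top hp1 hs.memy hs.memz ha

theorem _root_.eLpNorm_forcing_le (hp1 : 1 ≤ p) (hδ : 0 ≤ δ) {g : ℝ → ℂ}
    (hg : AEStronglyMeasurable g halfLine) (hf : AEStronglyMeasurable f halfLine)
    {a : ℝ} (ha : 0 ≤ a) :
    eLpNorm (fun t => ((1 + t) ^ (-δ)) • g t - f t) p (volume.restrict (Ioi a)) ≤
      ENNReal.ofReal ((1 + a) ^ (-δ)) * eLpNorm g p (volume.restrict (Ioi a)) +
        eLpNorm f p halfLine := by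
  have hle := restrict_Ioi_le_halfLine ha
  have hw : Measurable fun t : ℝ => (1 + t) ^ (-δ) := by fun_prop
  refine (eLpNorm_sub_le (hw.aestronglyMeasurable.smul (hg.mono_measure hle))
    (hf.mono_measure hle) hp1).trans ?_
  gcongr
  · refine eLpNorm_le_mul_eLpNorm_of_ae_le_mul ?_ p
    filter_upwards [ae_restrict_mem measurableSet_Ioi] with t ht
    have ht' : a < t := ht
    rw [Pi.smul_apply', norm_smul, Real.norm_of_nonneg (Real.rpow_nonneg (by linarith) _)]
    gcongr ?_ * _
    exact Real.rpow_le_rpow_of_nonpos (by linarith) (by linarith) (by linarith)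

theorem _root_.eLpNorm_vectorField_le (hp1 : 1 ≤ p) (hQ : IsBddCoeff Q M) {a : ℝ} (ha : 0 ≤ a)
    {h : ℝ → ℂ} (hym : AEStronglyMeasurable y (volume.restrict (Ioi a)))
    (hzm : AEStronglyMeasurable z (volume.restrict (Ioi a)))
    (hhm : AEStronglyMeasurable h (volume.restrict (Ioi a))) :
    AEMeasurable (fun s => ‖z s‖ₑ + ‖Q s • y s + h s‖ₑ) (volume.restrict (Ioi a)) ∧
    eLpNorm (fun s => ‖z s‖ₑ + ‖Q s • y s + h s‖ₑ) p (volume.restrict (Ioi a)) ≤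
      (1 + ENNReal.ofReal M) * phaseLp p y z a + eLpNorm h p (volume.restrict (Ioi a)) := by
  have hle := restrict_Ioi_le_halfLine ha
  have hQy : AEStronglyMeasurable (fun t => Q t • y t) (volume.restrict (Ioi a)) :=
    (hQ.meas.mono_measure hle).smul hym
  have hsum : AEMeasurable (fun s => ‖Q s • y s + h s‖ₑ) (volume.restrict (Ioi a)) :=
    (hQy.add hhm).enorm
  refine ⟨hzm.enorm.add hsum, ?_⟩
  have h1 : eLpNorm (fun s => ‖z s‖ₑ + ‖Q s • y s + h s‖ₑ) p (volume.restrict (Ioi a)) ≤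
      eLpNorm z p (volume.restrict (Ioi a)) +
        eLpNorm (fun s => Q s • y s + h s) p (volume.restrict (Ioi a)) := by
    refine (eLpNorm_add_le (f := fun s => ‖z s‖ₑ) (g := fun s => ‖Q s • y s + h s‖ₑ)
      hzm.enorm.aestronglyMeasurable hsum.aestronglyMeasurable hp1).trans ?_
    rw [eLpNorm_enorm, eLpNorm_enorm]
  have h2 : eLpNorm (fun s => Q s • y s) p (volume.restrict (Ioi a)) ≤
      ENNReal.ofReal M * eLpNorm y p (volume.restrict (Ioi a)) := by
    refine eLpNorm_le_mul_eLpNorm_of_ae_le_mul ?_ p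
    filter_upwards [ae_mono hle hQ.bound] with t ht
    rw [norm_smul]
    gcongr
    exact ht
  calc eLpNorm (fun s => ‖z s‖ₑ + ‖Q s • y s + h s‖ₑ) p (volume.restrict (Ioi a))
      ≤ eLpNorm z p (volume.restrict (Ioi a)) + (eLpNorm (fun s => Q s • y s) p
        (volume.restrict (Ioi a)) + eLpNorm h p (volume.restrict (Ioi a))) :=
        h1.trans (add_le_add le_rfl (eLpNorm_add_le (f := fun s => Q s • y s) (g := h)
          hQy hhm hp1))
    _ ≤ phaseLp p y z a + (ENNReal.ofReal M * phaseLp p y z a +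
        eLpNorm h p (volume.restrict (Ioi a))) := by
        refine add_le_add eLpNorm_snd_le_phaseLp (add_le_add ?_ le_rfl)
        exact h2.trans (mul_le_mul_right eLpNorm_fst_le_phaseLp _)
    _ = _ := by ring

/-- The norm on `(a, ∞)` is controlled by the norm on `(a + η, ∞)`. -/
theorem phaseLp_le_add (hp1 : 1 ≤ p) (hp : p ≠ ⊤) (hQ : IsBddCoeff Q M) (hδ : 0 ≤ δ)
    (hs : IsPertSol p Q δ C f y z) {a η : ℝ} (ha : 0 ≤ a) (hη : 0 < η) :
    phaseLp p y z a ≤ phaseLp p y z (a + η) + ENNReal.ofReal η *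
      ((1 + ENNReal.ofReal M + C) * phaseLp p y z a + eLpNorm f p halfLine) := by
  obtain ⟨g, hg, hF, hgle⟩ := hs.forced
  have hle := restrict_Ioi_le_halfLine ha
  have hw : Measurable fun t : ℝ => (1 + t) ^ (-δ) := by fun_prop
  have hhm : AEStronglyMeasurable (fun t => ((1 + t) ^ (-δ)) • g t - f t)
      (volume.restrict (Ioi a)) :=
    (hw.aestronglyMeasurable.smul (hg.mono_measure hle)).sub (hs.memf.1.mono_measure hle)
  have h3 := eLpNorm_forcing_le (p := p) hp1 hδ hg hs.memf.1 ha
  have h4 : ENNReal.ofReal ((1 + a) ^ (-δ)) ≤ 1 := by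
    rw [ENNReal.ofReal_le_one]
    exact Real.rpow_le_one_of_one_le_of_nonpos (by linarith) (by linarith)
  obtain ⟨hDm, hDle'⟩ := eLpNorm_vectorField_le (p := p) hp1 hQ ha
    (hs.memy.1.mono_measure hle) (hs.memz.1.mono_measure hle) hhm
  have hDle := hDle'.trans (add_le_add le_rfl
    (h3.trans (add_le_add (mul_le_mul' h4 (hgle a ha)) le_rfl)))
  rw [one_mul, ← add_assoc, ← add_mul] at hDle
  obtain ⟨hWm, hWle⟩ := eLpNorm_window_le hp1 hp η hDm
  have hYm : AEMeasurable (fun t => phaseNorm y z (t + η)) (volume.restrict (Ioi a)) := by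
    have h1 : MeasurePreserving (fun t : ℝ => t + η) (volume.restrict (Ioi a))
        (volume.restrict (Ioi (a + η))) := by
      have := (measurePreserving_add_right (volume : Measure ℝ) η).restrict_preimage
        (s := Ioi (a + η)) measurableSet_Ioi
      simpa using this
    have h2 : AEMeasurable (phaseNorm y z) (volume.restrict (Ioi (a + η))) :=
      (hs.memy.1.enorm.add hs.memz.1.enorm).mono_measure (restrict_Ioi_le_halfLine (by linarith))
    exact h2.comp_quasiMeasurePreserving h1.quasiMeasurePreserving
  have hpt : ∀ᵐ t ∂volume.restrict (Ioi a), phaseNorm y z t ≤ phaseNorm y z (t + η) +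
      ∫⁻ s in Ioc t (t + η), (‖z s‖ₑ + ‖Q s • y s + (((1 + s) ^ (-δ)) • g s - f s)‖ₑ) := by
    filter_upwards [ae_restrict_mem measurableSet_Ioi] with t ht
    exact hF.phaseNorm_le_window (ha.trans (le_of_lt ht)) (by linarith)
  generalize (fun s => ‖z s‖ₑ + ‖Q s • y s + (((1 + s) ^ (-δ)) • g s - f s)‖ₑ) = D at *
  calc phaseLp p y z a
      ≤ eLpNorm (fun t => phaseNorm y z (t + η) + ∫⁻ s in Ioc t (t + η), D s) p
          (volume.restrict (Ioi a)) := eLpNorm_mono_enorm_ae hpt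
    _ ≤ eLpNorm (fun t => phaseNorm y z (t + η)) p (volume.restrict (Ioi a)) +
          eLpNorm (fun t => ∫⁻ s in Ioc t (t + η), D s) p (volume.restrict (Ioi a)) :=
        eLpNorm_add_le (f := fun t => phaseNorm y z (t + η))
          (g := fun t => ∫⁻ s in Ioc t (t + η), D s) hYm.aestronglyMeasurable
          hWm.aestronglyMeasurable hp1
    _ ≤ _ := by
        rw [eLpNorm_comp_add_right]
        exact add_le_add le_rfl (hWle.trans (mul_le_mul_right hDle _))

/-- Backward Grönwall in `L_p`. Pointwise uniqueness is not available, since `g` may be nonlocal and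
is controlled only through norms on half-lines. A step of length `η = 1 / (2 L)` with `L = 1 + M +
C` lets half of the norm be absorbed, so moving the left endpoint back by `η` costs a factor `2`;
finitely many steps lead from `b` to `0`. -/
theorem exists_phaseLp_zero_le (hp1 : 1 ≤ p) (hp : p ≠ ⊤) (hQ : IsBddCoeff Q M) (hδ : 0 ≤ δ)
    (hC : C ≠ ⊤) (b : ℝ) : ∃ K : ℝ≥0∞, K ≠ ⊤ ∧ ∀ f y z, IsPertSol p Q δ C f y z →
      phaseLp p y z 0 ≤ K * (phaseLp p y z b + eLpNorm f p halfLine) := by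
  set L : ℝ := 1 + M + C.toReal with hL
  have hL1 : 1 ≤ L := by
    have := hQ.one_le
    have := C.toReal_nonneg
    linarith
  set η : ℝ := 1 / (2 * L) with hη
  have hη0 : 0 < η := by positivity
  have hηL : ENNReal.ofReal η * (1 + ENNReal.ofReal M + C) = 2⁻¹ := by
    have h1 : 1 + ENNReal.ofReal M + C = ENNReal.ofReal L := by
      have hM : 0 ≤ M := by linarith [hQ.one_le]
      rw [hL, ENNReal.ofReal_add (by positivity) C.toReal_nonneg,
        ENNReal.ofReal_add zero_le_one hM, ENNReal.ofReal_toReal hC, ENNReal.ofReal_one]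
    rw [h1, ← ENNReal.ofReal_mul hη0.le]
    have h2 : η * L = 2⁻¹ := by rw [hη]; field_simp
    rw [h2, ENNReal.ofReal_inv_of_pos two_pos]
    simp
  have hη1 : 2 * ENNReal.ofReal η ≤ 1 := by
    have : (2 : ℝ≥0∞) = ENNReal.ofReal 2 := by simp
    rw [this, ← ENNReal.ofReal_mul zero_le_two, ENNReal.ofReal_le_one, hη]
    field_simp
    linarith
  obtain ⟨n, hn⟩ := exists_nat_ge (b / η)
  have hnb : b ≤ n * η := (div_le_iff₀ hη0).1 hn
  refine ⟨2 ^ n, by simp, fun f y z hs => ?_⟩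
  have step : ∀ a, 0 ≤ a → phaseLp p y z a ≤ 2 * phaseLp p y z (a + η) + eLpNorm f p halfLine := by
    intro a ha
    have h1 := hs.phaseLp_le_add hp1 hp hQ hδ ha hη0
    rw [mul_add, ← mul_assoc, hηL, add_comm (2⁻¹ * _), ← add_assoc] at h1
    refine (ENNReal.le_two_mul_of_le_add (hs.phaseLp_ne_top hp1 ha) le_rfl h1).trans ?_
    rw [mul_add, ← mul_assoc]
    gcongr
    exact mul_le_of_le_one_left' hη1
  have hind : ∀ k : ℕ, phaseLp p y z 0 ≤
      2 ^ k * (phaseLp p y z (k * η) + eLpNorm f p halfLine) := by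
    intro k
    induction k with
    | zero => simp
    | succ k ih =>
      refine ih.trans ?_
      have h2 := step (k * η) (by positivity)
      have e : (k : ℝ) * η + η = ((k + 1 : ℕ) : ℝ) * η := by push_cast; ring
      rw [e] at h2
      calc 2 ^ k * (phaseLp p y z (k * η) + eLpNorm f p halfLine)
          ≤ 2 ^ k * ((2 * phaseLp p y z ((k + 1 : ℕ) * η) + eLpNorm f p halfLine)
            + eLpNorm f p halfLine) := by gcongr
        _ = _ := by ring
  refine (hind n).trans ?_
  gcongr
  exact phaseLp_anti hnb

/-- If all solutions of the unperturbed equation are bounded, then the perturbed homogeneous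
equation has no nontrivial solutions in `L_p`. -/
theorem phaseLp_eq_zero_of_stable (hp1 : 1 ≤ p) (hp : p ≠ ⊤) (hQ : IsBddCoeff Q M) (hδ : 1 < δ)
    (hC : C ≠ ⊤) {c c' s s' : ℝ → ℝ} (hfund : IsFund Q c c' s s')
    (hst : IsFund.Stable c c' s s') (hs : IsPertSol p Q δ C 0 y z) : phaseLp p y z 0 = 0 := by
  obtain ⟨B, hB⟩ := hst
  obtain ⟨g, hg, hF, hgle⟩ := hs.forced
  obtain ⟨A, hA0, hA⟩ := exists_eLpNorm_tail_le (p := p) hp1 hp hδ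
  set b := ENNReal.ofReal B with hb
  have hbe : ∀ {x : ℝ}, |x| ≤ B → ‖x‖ₑ ≤ b := fun {x} hx => by
    rw [← ofReal_norm]
    exact ENNReal.ofReal_le_ofReal hx
  set w : ℝ → ℝ≥0∞ := fun t => ∫⁻ s in Ioi t, ENNReal.ofReal ((1 + s) ^ (-δ)) * ‖g s‖ₑ with hw
  have hcross : ∀ {φ φ' : ℝ → ℝ}, IsSol Q φ φ' → (∀ t, 0 ≤ t → |φ t| ≤ B) →
      (∀ t, 0 ≤ t → |φ' t| ≤ B) → ∀ t, 0 ≤ t → ‖cross φ φ' y z t‖ₑ ≤ b * w t := by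
    intro φ φ' hφ h1 h2 t ht
    refine (hF.cross_le_of_bounded hp1 hp hQ (hs.phaseLp_ne_top hp1 le_rfl) hφ h1 h2 ht).trans ?_
    rw [hw]
    simp only
    rw [← lintegral_const_mul' _ _ (by simp [hb])]
    refine setLIntegral_mono_ae' measurableSet_Ioi (Eventually.of_forall fun x hx => ?_)
    have hx0 : 0 < x := ht.trans_lt hx
    gcongr
    · exact hbe (h1 x hx0.le)
    · simp only [Pi.zero_apply, sub_zero]
      rw [enorm_smul, ← ofReal_norm, Real.norm_of_nonneg (Real.rpow_nonneg (by linarith) _)]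
  -- Reconstruction from the Wronskians with `c` and `s`: two components, two terms each, every
  -- factor bounded by `b`.
  have hpt : ∀ t, 0 ≤ t → phaseNorm y z t ≤ (4 * b * b) * w t := by
    intro t ht
    obtain ⟨h1, h2, h3, h4⟩ := hB t ht
    obtain ⟨e1, e2⟩ := cross_reconstruct (y := y) (z := z) (hfund.det_eq_one hQ ht)
    have hc := hcross hfund.solc (fun t ht => (hB t ht).1) (fun t ht => (hB t ht).2.1) t ht
    have hs' := hcross hfund.sols (fun t ht => (hB t ht).2.2.1) (fun t ht => (hB t ht).2.2.2) t ht
    have a1 : ‖y t‖ₑ ≤ b * (b * w t) + b * (b * w t) := by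
      rw [e1]
      refine enorm_sub_le.trans ?_
      rw [enorm_smul, enorm_smul]
      gcongr
      · exact hbe h3
      · exact hbe h1
    have a2 : ‖z t‖ₑ ≤ b * (b * w t) + b * (b * w t) := by
      rw [e2]
      refine enorm_sub_le.trans ?_
      rw [enorm_smul, enorm_smul]
      gcongr
      · exact hbe h4
      · exact hbe h2
    refine (add_le_add a1 a2).trans_eq ?_
    ring
  have hest : ∀ a, 0 ≤ a → phaseLp p y z a ≤ (4 * b * b * C * A a) * phaseLp p y z a := by
    intro a ha
    obtain ⟨h0, h2⟩ := hA a ha (fun s => ‖g s‖ₑ)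
      (hg.enorm.mono_measure (restrict_Ioi_le_halfLine ha))
    rw [eLpNorm_enorm] at h2
    have h1 : phaseLp p y z a ≤ (4 * b * b) * eLpNorm w p (volume.restrict (Ioi a)) := by
      refine eLpNorm_le_mul_eLpNorm_of_ae_le_mul'' p h0.aestronglyMeasurable ?_
      filter_upwards [ae_restrict_mem measurableSet_Ioi] with t ht
      exact hpt t (ha.trans (le_of_lt ht))
    calc phaseLp p y z a ≤ (4 * b * b) * (A a * (C * phaseLp p y z a)) :=
          h1.trans (by gcongr; exact h2.trans (by gcongr; exact hgle a ha))
      _ = _ := by ring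
  have hlim : Tendsto (fun a => 4 * b * b * C * A a) atTop (𝓝 0) := by
    have := ENNReal.Tendsto.const_mul hA0 (a := 4 * b * b * C)
      (Or.inr (by simp [hb, ENNReal.mul_eq_top, hC]))
    simpa using this
  -- Far out the norm is at most half of itself, hence zero; backward control then reaches `0`.
  obtain ⟨a, ha, ha0⟩ := ((hlim.eventually (eventually_le_nhds (by simp : (0 : ℝ≥0∞) < 2⁻¹))).and
    (eventually_ge_atTop 0)).exists
  have hzero : phaseLp p y z a = 0 := by
    have := ENNReal.le_two_mul_of_le_add (b := 0) (hs.phaseLp_ne_top hp1 ha0) ha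
      (by rw [zero_add]; exact hest a ha0)
    simpa using this
  obtain ⟨K, -, hK⟩ := exists_phaseLp_zero_le (p := p) hp1 hp hQ (by linarith : 0 ≤ δ) hC a
  have := hK 0 y z hs
  rw [hzero] at this
  simpa using this

end IsPertSol

/-! ### The perturbed equation in a gap -/

namespace IsDichotomy

variable {p : ℝ≥0∞} {Q : ℝ → ℝ} {M δ : ℝ} {C : ℝ≥0∞} {φ φ' ψ ψ' : ℝ → ℝ} {ρ κ K : ℝ}

theorem nonneg (hd : IsDichotomy Q φ φ' ψ ψ' ρ κ K) : 0 ≤ K := by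
  have := (abs_nonneg _).trans (hd.boundφ 0 le_rfl)
  simpa using this

/-- This is the Green operator on `(a, ∞)`: the Wronskian with `φ` is an integral over the future,
the increment of the Wronskian with `ψ` one over the past, and the growth of one solution
compensates the decay of the other. The choices `(α, β) = (ψ t, φ t)` and `(ψ' t, φ' t)` give the
estimates for `y` and `z`. -/
theorem enorm_combination_le (hd : IsDichotomy Q φ φ' ψ ψ' ρ κ K) (hp1 : 1 ≤ p) (hp : p ≠ ⊤)
    (hQ : IsBddCoeff Q M) {h y z : ℝ → ℂ} (hs : IsForcedSol Q h y z)
    (hfin : phaseLp p y z 0 ≠ ⊤) {a t α β : ℝ} (ha : 0 ≤ a) (hat : a < t)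
    (hα : |α| ≤ K * Real.exp (κ * t)) (hβ : |β| ≤ K * Real.exp (-(κ * t))) :
    ‖α • cross φ φ' y z t - β • (cross ψ ψ' y z t - cross ψ ψ' y z a)‖ₑ ≤
      ENNReal.ofReal (K * K) *
        ∫⁻ s in Ioi a, ENNReal.ofReal (Real.exp (-(κ * |t - s|))) * ‖h s‖ₑ := by
  have ht0 : 0 ≤ t := ha.trans hat.le
  have hK := hd.nonneg
  have hb : ∀ t, 0 ≤ t → K * Real.exp (-(κ * t)) ≤ K := fun t ht => by
    refine mul_le_of_le_one_right hK ?_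
    rw [Real.exp_le_one_iff]
    have := hd.pos
    nlinarith
  have h1 : ‖α • cross φ φ' y z t‖ₑ ≤ ∫⁻ s in Ioi t, ENNReal.ofReal (K * K) *
      (ENNReal.ofReal (Real.exp (-(κ * |t - s|))) * ‖h s‖ₑ) := by
    rw [enorm_smul]
    refine (mul_le_mul_right (hs.cross_le_of_bounded hp1 hp hQ hfin hd.solφ
      (fun t ht => (hd.boundφ t ht).trans (hb t ht))
      (fun t ht => (hd.boundφ' t ht).trans (hb t ht)) ht0) _).trans ?_
    rw [← lintegral_const_mul' _ _ (by simp)]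
    refine setLIntegral_mono_ae' measurableSet_Ioi (Eventually.of_forall fun s hs' => ?_)
    have hts : t < s := hs'
    rw [← mul_assoc, ← mul_assoc, ← ENNReal.ofReal_mul (by positivity), ← ofReal_norm,
      ← ofReal_norm (φ s), ← ENNReal.ofReal_mul (norm_nonneg _)]
    refine mul_le_mul_left (ENNReal.ofReal_le_ofReal ?_) _
    calc |α| * |φ s| ≤ (K * Real.exp (κ * t)) * (K * Real.exp (-(κ * s))) :=
          mul_le_mul hα (hd.boundφ s (ht0.trans hts.le)) (abs_nonneg _) (by positivity)
      _ = K * K * (Real.exp (κ * t) * Real.exp (-(κ * s))) := by ring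
      _ = K * K * Real.exp (-(κ * |t - s|)) := by
          rw [← Real.exp_add, abs_of_neg (by linarith)]
          ring_nf
  have h2 : ‖β • (cross ψ ψ' y z t - cross ψ ψ' y z a)‖ₑ ≤
      ∫⁻ s in Ioc a t, ENNReal.ofReal (K * K) *
        (ENNReal.ofReal (Real.exp (-(κ * |t - s|))) * ‖h s‖ₑ) := by
    rw [enorm_smul]
    refine (mul_le_mul_right (hs.cross_sub_le hQ hd.solψ ha hat) _).trans ?_
    rw [← lintegral_const_mul' _ _ (by simp)]
    refine setLIntegral_mono_ae' measurableSet_Ioc (Eventually.of_forall fun s hs' => ?_)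
    rw [← mul_assoc, ← mul_assoc, ← ENNReal.ofReal_mul (by positivity), ← ofReal_norm,
      ← ofReal_norm (ψ s), ← ENNReal.ofReal_mul (norm_nonneg _)]
    refine mul_le_mul_left (ENNReal.ofReal_le_ofReal ?_) _
    calc |β| * |ψ s| ≤ (K * Real.exp (-(κ * t))) * (K * Real.exp (κ * s)) :=
          mul_le_mul hβ (hd.boundψ s (ha.trans hs'.1.le)) (abs_nonneg _) (by positivity)
      _ = K * K * (Real.exp (-(κ * t)) * Real.exp (κ * s)) := by ring
      _ = K * K * Real.exp (-(κ * |t - s|)) := by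
          rw [← Real.exp_add, abs_of_nonneg (by linarith [hs'.2])]
          ring_nf
  refine enorm_sub_le.trans ((add_le_add h1 h2).trans_eq ?_)
  rw [← lintegral_const_mul' _ _ (by simp), add_comm,
    ← lintegral_union measurableSet_Ioi (Ioc_disjoint_Ioi le_rfl), Ioc_union_Ioi_eq_Ioi hat.le]

theorem mult_nat {F : ℝ → ℝ} (hF : ∀ t, 0 ≤ t → F (t + 1) = ρ * F t) (n : ℕ) {t : ℝ}
    (ht : 0 ≤ t) : F (t + n) = ρ ^ n * F t := by
  induction n with
  | zero => simp
  | succ k ih =>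
    rw [Nat.cast_succ, ← add_assoc, hF _ (by positivity), ih]
    ring

/-- At integers the tails of `φ` and `φ'` shrink by exactly the same factor. Upper and lower bounds
for the `φ`-component therefore carry the same power of `ρ`, which is why the estimates are made on
`(n, ∞)`. -/
theorem eLpNorm_nat (hd : IsDichotomy Q φ φ' ψ ψ' ρ κ K) (n : ℕ) :
    eLpNorm φ p (volume.restrict (Ioi (n : ℝ))) = ‖ρ ^ n‖ₑ * eLpNorm φ p halfLine ∧
    eLpNorm φ' p (volume.restrict (Ioi (n : ℝ))) = ‖ρ ^ n‖ₑ * eLpNorm φ' p halfLine := by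
  have key : ∀ F : ℝ → ℝ, (∀ t, 0 ≤ t → F (t + 1) = ρ * F t) →
      eLpNorm F p (volume.restrict (Ioi (n : ℝ))) = ‖ρ ^ n‖ₑ * eLpNorm F p halfLine := by
    intro F hF
    have h1 := eLpNorm_comp_add_right (p := p) (a := 0) F n
    rw [zero_add] at h1
    rw [← h1, ← eLpNorm_const_smul]
    refine eLpNorm_congr_ae ?_
    filter_upwards [ae_restrict_mem measurableSet_Ioi] with t ht
    rw [mult_nat hF n (le_of_lt ht)]
    rfl
  exact ⟨key φ hd.mult, key φ' hd.mult'⟩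

theorem memLp (hd : IsDichotomy Q φ φ' ψ ψ' ρ κ K) (hp1 : 1 ≤ p) (hp : p ≠ ⊤) :
    MemLp φ p halfLine ∧ MemLp φ' p halfLine := by
  have hp0 : p ≠ 0 := (zero_lt_one.trans_le hp1).ne'
  have hr := ENNReal.toReal_pos hp0 hp
  have h1 : MemLp (fun t : ℝ => Real.exp (-(κ * t))) p halfLine := by
    rw [← integrable_norm_rpow_iff (by fun_prop) hp0 hp]
    have := integrableOn_exp_mul_Ioi (a := -(κ * p.toReal)) (by
      have := hd.pos
      have : 0 < κ * p.toReal := by positivity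
      linarith) 0
    refine this.congr (Eventually.of_forall fun t => ?_)
    simp only [Real.norm_eq_abs, abs_of_pos (Real.exp_pos _)]
    rw [← Real.exp_mul]
    ring_nf
  have key : ∀ F : ℝ → ℝ, Continuous F → (∀ t, 0 ≤ t → |F t| ≤ K * Real.exp (-(κ * t))) →
      MemLp F p halfLine := by
    intro F hF hb
    refine h1.of_le_mul (c := K) hF.aestronglyMeasurable ?_
    filter_upwards [ae_restrict_mem measurableSet_Ioi] with t ht
    rw [Real.norm_of_nonneg (Real.exp_pos _).le]
    exact hb t (le_of_lt ht)
  exact ⟨key φ hd.solφ.cont hd.boundφ, key φ' hd.solφ.cont' hd.boundφ'⟩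

theorem eLpNorm_ne_zero (hd : IsDichotomy Q φ φ' ψ ψ' ρ κ K) (hp1 : 1 ≤ p)
    (hQ : IsBddCoeff Q M) : eLpNorm φ p halfLine ≠ 0 := by
  intro h0
  rw [eLpNorm_eq_zero_iff hd.solφ.cont.aestronglyMeasurable
    (zero_lt_one.trans_le hp1).ne'] at h0
  have h1 : EqOn φ 0 (Ioi 0) := Measure.eqOn_open_of_ae_eq h0 isOpen_Ioi
    hd.solφ.cont.continuousOn continuousOn_const
  have h2 := h1.closure hd.solφ.cont continuous_const
  rw [closure_Ioi] at h2
  obtain ⟨t, ht, hne⟩ := hd.solφ.exists_ne_zero hQ hd.solψ (by rw [hd.wronskian]; norm_num)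
  exact hne (h2 ht.1)

/-- The two basic estimates on `(n, ∞)`. -/
theorem phaseLp_nat_le (hd : IsDichotomy Q φ φ' ψ ψ' ρ κ K) (hp1 : 1 ≤ p) (hp : p ≠ ⊤)
    (hQ : IsBddCoeff Q M) : ∃ T : ℝ≥0∞, T ≠ ⊤ ∧ ∀ (n : ℕ) (h y z : ℝ → ℂ),
      IsForcedSol Q h y z → MemLp y p halfLine → MemLp z p halfLine →
      AEStronglyMeasurable h (volume.restrict (Ioi (n : ℝ))) →
      phaseLp p y z n ≤ (eLpNorm φ p halfLine + eLpNorm φ' p halfLine) *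
          (‖ρ ^ n‖ₑ * ‖cross ψ ψ' y z n‖ₑ) +
          2 * T * eLpNorm h p (volume.restrict (Ioi (n : ℝ))) ∧
      eLpNorm φ p halfLine * (‖ρ ^ n‖ₑ * ‖cross ψ ψ' y z n‖ₑ) ≤
        eLpNorm y p halfLine + T * eLpNorm h p (volume.restrict (Ioi (n : ℝ))) := by
  obtain ⟨A, hA, hAle⟩ := exists_eLpNorm_exp_le hp1 hp hd.pos
  refine ⟨ENNReal.ofReal (K * K) * A, ENNReal.mul_ne_top (by simp) hA,
    fun n h y z hs hy hz hh => ?_⟩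
  have hn : (0 : ℝ) ≤ n := n.cast_nonneg
  have hle := restrict_Ioi_le_halfLine hn
  obtain ⟨hGm, hGle⟩ := hAle n (fun s => ‖h s‖ₑ) hh.enorm
  rw [eLpNorm_enorm] at hGle
  have hfin := _root_.phaseLp_ne_top hp1 hy hz le_rfl
  obtain ⟨e1, e2⟩ := hd.eLpNorm_nat (p := p) n
  have hrec : ∀ t : ℝ, n < t → φ t * ψ' t - φ' t * ψ t = 1 := fun t ht => by
    rw [hd.solφ.wronskian_eq hQ hd.solψ (hn.trans ht.le), hd.wronskian]
  -- By Cramer's rule the Green combination based at `n` equals `y` plus `φ` times the Wronskian of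
  -- `ψ` and `y` at `n`: modulo one multiple of `φ`, the solution is determined by the forcing.
  have b1 : ∀ t : ℝ, n < t → ‖y t + φ t • cross ψ ψ' y z n‖ₑ ≤ ENNReal.ofReal (K * K) *
      ∫⁻ s in Ioi (n : ℝ), ENNReal.ofReal (Real.exp (-(κ * |t - s|))) * ‖h s‖ₑ := by
    intro t ht
    have := hd.enorm_combination_le hp1 hp hQ hs hfin hn ht (hd.boundψ t (hn.trans ht.le))
      (hd.boundφ t (hn.trans ht.le))
    have e := (cross_reconstruct (y := y) (z := z) (hrec t ht)).1
    rw [smul_sub, ← sub_add, ← e] at this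
    exact this
  have b2 : ∀ t : ℝ, n < t → ‖z t + φ' t • cross ψ ψ' y z n‖ₑ ≤ ENNReal.ofReal (K * K) *
      ∫⁻ s in Ioi (n : ℝ), ENNReal.ofReal (Real.exp (-(κ * |t - s|))) * ‖h s‖ₑ := by
    intro t ht
    have := hd.enorm_combination_le hp1 hp hQ hs hfin hn ht (hd.boundψ' t (hn.trans ht.le))
      (hd.boundφ' t (hn.trans ht.le))
    have e := (cross_reconstruct (y := y) (z := z) (hrec t ht)).2
    rw [smul_sub, ← sub_add, ← e] at this
    exact this
  set X := cross ψ ψ' y z n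
  obtain ⟨G, hGle, b1, b2⟩ : ∃ G : ℝ → ℝ≥0∞,
      eLpNorm G p (volume.restrict (Ioi (n : ℝ))) ≤
        ENNReal.ofReal (K * K) * A * eLpNorm h p (volume.restrict (Ioi (n : ℝ))) ∧
      (∀ t : ℝ, n < t → ‖y t + φ t • X‖ₑ ≤ G t) ∧
      ∀ t : ℝ, n < t → ‖z t + φ' t • X‖ₑ ≤ G t := by
    refine ⟨_, ?_, b1, b2⟩
    refine (eLpNorm_le_mul_eLpNorm_of_ae_le_mul'' (c := ENNReal.ofReal (K * K)) p
      hGm.aestronglyMeasurable (Eventually.of_forall fun t => le_rfl)).trans ?_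
    rw [mul_assoc]
    exact mul_le_mul_right hGle _
  have key : ∀ (F : ℝ → ℝ) (v : ℝ → ℂ), Continuous F → AEStronglyMeasurable v halfLine →
      eLpNorm F p (volume.restrict (Ioi (n : ℝ))) = ‖ρ ^ n‖ₑ * eLpNorm F p halfLine →
      (∀ t : ℝ, n < t → ‖v t + F t • X‖ₑ ≤ G t) →
      eLpNorm v p (volume.restrict (Ioi (n : ℝ))) ≤ eLpNorm F p halfLine * (‖ρ ^ n‖ₑ * ‖X‖ₑ) +
        ENNReal.ofReal (K * K) * A * eLpNorm h p (volume.restrict (Ioi (n : ℝ))) ∧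
      eLpNorm F p halfLine * (‖ρ ^ n‖ₑ * ‖X‖ₑ) ≤ eLpNorm v p (volume.restrict (Ioi (n : ℝ))) +
        ENNReal.ofReal (K * K) * A * eLpNorm h p (volume.restrict (Ioi (n : ℝ))) := by
    intro F v hF hv heq hb
    have m1 : AEStronglyMeasurable (fun t => F t • X) (volume.restrict (Ioi (n : ℝ))) :=
      (by fun_prop : Continuous fun t => F t • X).aestronglyMeasurable
    have m2 := hv.mono_measure hle
    have n1 : eLpNorm (fun t => F t • X) p (volume.restrict (Ioi (n : ℝ))) =
        eLpNorm F p halfLine * (‖ρ ^ n‖ₑ * ‖X‖ₑ) := by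
      have h3 : eLpNorm (fun t => F t • X) p (volume.restrict (Ioi (n : ℝ))) =
          eLpNorm (‖X‖ • F) p (volume.restrict (Ioi (n : ℝ))) := by
        refine eLpNorm_congr_norm_ae (Eventually.of_forall fun t => ?_)
        simp [mul_comm]
      rw [h3, eLpNorm_const_smul, heq, enorm_norm]
      ring
    have n2 : eLpNorm (fun t => v t + F t • X) p (volume.restrict (Ioi (n : ℝ))) ≤
        ENNReal.ofReal (K * K) * A * eLpNorm h p (volume.restrict (Ioi (n : ℝ))) := by
      refine le_trans (eLpNorm_mono_enorm_ae ?_) hGle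
      filter_upwards [ae_restrict_mem measurableSet_Ioi] with t ht using hb t ht
    constructor
    · have e : v = (fun t => v t + F t • X) - fun t => F t • X := by
        ext t
        simp
      rw [← n1]
      nth_rw 1 [e]
      refine (eLpNorm_sub_le (m2.add m1) m1 hp1).trans ?_
      rw [add_comm]
      gcongr
      exact n2
    · have e : (fun t => F t • X) = (fun t => v t + F t • X) - v := by
        ext t
        simp
      rw [← n1]
      nth_rw 1 [e]
      refine (eLpNorm_sub_le (m2.add m1) m2 hp1).trans ?_
      rw [add_comm]
      gcongr
      exact n2
  obtain ⟨k1, k2⟩ := key φ y hd.solφ.cont hy.1 e1 b1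
  obtain ⟨k3, -⟩ := key φ' z hd.solφ.cont' hz.1 e2 b2
  constructor
  · have h1 : phaseLp p y z n ≤ eLpNorm y p (volume.restrict (Ioi (n : ℝ))) +
        eLpNorm z p (volume.restrict (Ioi (n : ℝ))) := by
      refine (eLpNorm_add_le (f := fun t => ‖y t‖ₑ) (g := fun t => ‖z t‖ₑ)
        (hy.1.mono_measure hle).enorm.aestronglyMeasurable
        (hz.1.mono_measure hle).enorm.aestronglyMeasurable hp1).trans ?_
      rw [eLpNorm_enorm, eLpNorm_enorm]
    refine h1.trans ((add_le_add k1 k3).trans_eq ?_)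
    ring
  · refine k2.trans (add_le_add (eLpNorm_mono_measure _ hle) le_rfl)

/-- In a gap, a solution of the perturbed equation is controlled by the right-hand side and one
linear functional, which is itself controlled by the `L_p` norm of the solution. -/
theorem exists_estimate (hd : IsDichotomy Q φ φ' ψ ψ' ρ κ K) (hp1 : 1 ≤ p) (hp : p ≠ ⊤)
    (hQ : IsBddCoeff Q M) (hδ : 1 < δ) (hC : C ≠ ⊤) :
    ∃ (n : ℕ) (L : ℝ≥0∞), L ≠ ⊤ ∧ ∀ f y z, IsPertSol p Q δ C f y z →
      ‖cross ψ ψ' y z n‖ₑ ≤ L * (eLpNorm y p halfLine + eLpNorm f p halfLine) ∧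
      phaseLp p y z 0 ≤ L * (‖cross ψ ψ' y z n‖ₑ + eLpNorm f p halfLine) := by
  obtain ⟨T, hT, hest⟩ := hd.phaseLp_nat_le hp1 hp hQ
  obtain ⟨m1, m2⟩ := hd.memLp hp1 hp
  have hℓ0 := hd.eLpNorm_ne_zero hp1 hQ
  set ℓ := eLpNorm φ p halfLine with hℓ
  set ω := eLpNorm φ p halfLine + eLpNorm φ' p halfLine with hω
  have hℓt : ℓ ≠ ⊤ := m1.2.ne
  have hωt : ω ≠ ⊤ := ENNReal.add_ne_top.2 ⟨m1.2.ne, m2.2.ne⟩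
  let ε : ℕ → ℝ≥0∞ := fun n => ENNReal.ofReal ((1 + (n : ℝ)) ^ (-δ))
  have hε : Tendsto ε atTop (𝓝 0) := by
    have h1 : Tendsto (fun n : ℕ => (1 + (n : ℝ)) ^ (-δ)) atTop (𝓝 0) :=
      (tendsto_rpow_neg_atTop (by linarith)).comp
        (tendsto_atTop_add_const_left _ _ tendsto_natCast_atTop_atTop)
    simpa using ENNReal.tendsto_ofReal h1
  have hlim : ∀ D : ℝ≥0∞, D ≠ ⊤ → Tendsto (fun n => D * ε n) atTop (𝓝 0) := fun D hD => by
    simpa using ENNReal.Tendsto.const_mul hε (a := D) (Or.inr hD)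
  have hTC : 2 * T * C ≠ ⊤ := ENNReal.mul_ne_top (ENNReal.mul_ne_top (by simp) hT) hC
  -- The first smallness condition absorbs the norm of the solution on `(n, ∞)`. The second absorbs
  -- the functional, multiplied by `r = |ρ|^n`, into its own lower bound; both sides contain `r`, so
  -- the condition on `n` does not involve it.
  obtain ⟨n, hn1, hn2⟩ := (((hlim (2 * T * C) hTC).eventually
    (eventually_le_nhds (by simp : (0 : ℝ≥0∞) < 2⁻¹))).and
    ((hlim (2 * T * C * ω) (ENNReal.mul_ne_top hTC hωt)).eventually
      (eventually_le_nhds (by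
        refine ENNReal.mul_pos (by simp) hℓ0 : (0 : ℝ≥0∞) < 2⁻¹ * ℓ)))).exists
  obtain ⟨K₁, hK₁, hback⟩ := IsPertSol.exists_phaseLp_zero_le (δ := δ) hp1 hp hQ (by linarith) hC
    (n : ℝ)
  set r := ‖ρ ^ n‖ₑ with hr
  have hr0 : r ≠ 0 := by
    rw [hr, enorm_ne_zero]
    exact pow_ne_zero _ hd.ne_zero
  have hrt : r ≠ ⊤ := enorm_ne_top
  set L₁ : ℝ≥0∞ := 2 * (1 + 2 * T) * ℓ⁻¹ * r⁻¹ with hL₁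
  set L₂ : ℝ≥0∞ := K₁ * (2 * ω * r + 4 * T + 1) with hL₂
  have hL₁t : L₁ ≠ ⊤ := by
    rw [hL₁]
    finiteness
  have hL₂t : L₂ ≠ ⊤ := by
    rw [hL₂]
    finiteness
  refine ⟨n, L₁ + L₂, ENNReal.add_ne_top.2 ⟨hL₁t, hL₂t⟩, fun f y z hs => ?_⟩
  obtain ⟨g, hg, hF, hgle⟩ := hs.forced
  have hnn : (0 : ℝ) ≤ n := n.cast_nonneg
  have hle := restrict_Ioi_le_halfLine hnn
  have hw : Measurable fun t : ℝ => (1 + t) ^ (-δ) := by fun_prop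
  obtain ⟨E1, E2⟩ := hest n _ y z hF hs.memy hs.memz
    ((hw.aestronglyMeasurable.smul (hg.mono_measure hle)).sub (hs.memf.1.mono_measure hle))
  have hH := (eLpNorm_forcing_le (p := p) hp1 (by linarith : 0 ≤ δ) hg hs.memf.1 hnn).trans
      (add_le_add (mul_le_mul_right (hgle n hnn) _) le_rfl)
  set N := phaseLp p y z n with hN
  set F := eLpNorm f p halfLine with hFdef
  set Y := eLpNorm y p halfLine with hY
  set x := ‖cross ψ ψ' y z n‖ₑ with hx
  have hNt : N ≠ ⊤ := hs.phaseLp_ne_top hp1 hnn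
  have hxt : x ≠ ⊤ := enorm_ne_top
  generalize eLpNorm (fun t => ((1 + t) ^ (-δ)) • g t - f t) p
    (volume.restrict (Ioi (n : ℝ))) = H at E1 E2 hH
  have hH' : H ≤ ε n * (C * N) + F := hH
  -- Control of the solution on `(n, ∞)` by the functional and `f`; inserted into the forcing bound,
  -- it also yields the bound for the functional.
  have A1 : N ≤ 2 * (ω * (r * x) + 2 * T * F) := by
    refine ENNReal.le_two_mul_of_le_add hNt hn1 (E1.trans ?_)
    calc ω * (r * x) + 2 * T * H ≤ ω * (r * x) + 2 * T * (ε n * (C * N) + F) := by gcongr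
      _ = _ := by ring
  have A2 : ℓ * (r * x) ≤ 2 * (Y + (1 + 2 * T) * F) := by
    have hvt : ℓ * (r * x) ≠ ⊤ := by finiteness
    refine (ENNReal.le_two_mul_of_le_add (b := Y + 2 * T * F) hvt le_rfl ?_).trans (by
      gcongr
      exact le_add_self)
    calc ℓ * (r * x) ≤ Y + T * H := E2
      _ ≤ Y + T * (ε n * (C * (2 * (ω * (r * x) + 2 * T * F))) + F) := by
          gcongr
          exact hH'.trans (by gcongr)
      _ = Y + T * F + (2 * T * C * ω * ε n) * (r * x) + (2 * T * C * ε n) * (2 * T * F) := by ring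
      _ ≤ Y + T * F + (2⁻¹ * ℓ) * (r * x) + 2⁻¹ * (2 * T * F) := by gcongr
      _ = Y + 2 * T * F + 2⁻¹ * (ℓ * (r * x)) := by
          have h2 : (2⁻¹ : ℝ≥0∞) * (2 * T * F) = T * F := by
            rw [← mul_assoc, ← mul_assoc, ENNReal.inv_mul_cancel (by simp) (by simp), one_mul]
          rw [h2]
          ring
  constructor
  · calc x = (ℓ⁻¹ * ℓ) * (r⁻¹ * r) * x := by
          rw [ENNReal.inv_mul_cancel hℓ0 hℓt, ENNReal.inv_mul_cancel hr0 hrt]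
          simp
      _ = ℓ⁻¹ * r⁻¹ * (ℓ * (r * x)) := by ring
      _ ≤ ℓ⁻¹ * r⁻¹ * (2 * (Y + (1 + 2 * T) * F)) := by gcongr
      _ ≤ ℓ⁻¹ * r⁻¹ * (2 * ((1 + 2 * T) * (Y + F))) := by
          rw [mul_add (1 + 2 * T)]
          gcongr
          exact le_mul_of_one_le_left' le_self_add
      _ = L₁ * (Y + F) := by rw [hL₁]; ring
      _ ≤ _ := by gcongr; exact le_self_add
  · calc phaseLp p y z 0 ≤ K₁ * (N + F) := hback f y z hs
      _ ≤ K₁ * (2 * (ω * (r * x) + 2 * T * F) + F) := by gcongr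
      _ ≤ L₂ * (x + F) := by
        rw [hL₂]
        have : 2 * (ω * (r * x) + 2 * T * F) + F ≤ (2 * ω * r + 4 * T + 1) * (x + F) := by
          calc 2 * (ω * (r * x) + 2 * T * F) + F
              ≤ 2 * (ω * (r * x) + 2 * T * F) + F + (2 * ω * r * F + (4 * T + 1) * x) :=
                le_self_add
            _ = _ := by ring
        exact (mul_le_mul_right this _).trans_eq (mul_assoc _ _ _).symm
      _ ≤ _ := by gcongr; exact le_add_self

end IsDichotomy

/-! ## The perturbed Hill operator -/

theorem AbsolutelyContinuousOnInterval.continuousOn_Ioi {g : ℝ → ℂ}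
    (hg : ∀ R : ℝ, 0 < R → AbsolutelyContinuousOnInterval g 0 R) : ContinuousOn g (Ioi 0) := by
  intro t ht
  have ht' : 0 < t := ht
  have h1 : ContinuousOn g (uIcc 0 (t + 1)) := (hg (t + 1) (by linarith)).continuousOn
  refine (h1.continuousAt ?_).continuousWithinAt
  rw [uIcc_of_le (by linarith)]
  exact Icc_mem_nhds ht (by linarith)

theorem eqOn_of_ae_eq_halfLine {g h : ℝ → ℂ}
    (hg : ∀ R : ℝ, 0 < R → AbsolutelyContinuousOnInterval g 0 R)
    (hh : ∀ R : ℝ, 0 < R → AbsolutelyContinuousOnInterval h 0 R) (e : g =ᵐ[halfLine] h) :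
    EqOn g h (Ioi 0) :=
  Measure.eqOn_open_of_ae_eq e isOpen_Ioi
    (AbsolutelyContinuousOnInterval.continuousOn_Ioi hg)
    (AbsolutelyContinuousOnInterval.continuousOn_Ioi hh)

/-- An upper triangular bounded integral operator is bounded on each half-line `(a, ∞)`. -/
theorem IsBoundedIntegralKernel.exists_bound {p : ℝ≥0∞} [Fact (1 ≤ p)] {δ : ℝ}
    {k : ℝ → ℝ → ℂ} (hk : IsBoundedIntegralKernel p (fun t s => (((1 + t) ^ δ : ℝ) : ℂ) * k t s))
    (hk0 : ∀ᵐ z ∂(halfLine.prod halfLine), z.2 < z.1 → k z.1 z.2 = 0) :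
    ∃ C : ℝ≥0∞, C ≠ ⊤ ∧ ∀ u : LpHalf p, ∃ g : ℝ → ℂ, AEStronglyMeasurable g halfLine ∧
      (∀ᵐ t ∂halfLine, ∫ s, k t s * u s ∂halfLine = ((1 + t) ^ (-δ)) • g t) ∧
      ∀ a, 0 ≤ a → eLpNorm g p (volume.restrict (Ioi a)) ≤
        C * eLpNorm u p (volume.restrict (Ioi a)) := by
  obtain ⟨K, hK⟩ := hk
  refine ⟨‖K‖ₑ, enorm_ne_top, fun u => ⟨K u, Lp.aestronglyMeasurable _, ?_, fun a ha => ?_⟩⟩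
  · filter_upwards [hK u, ae_restrict_mem measurableSet_Ioi] with t ht ht0
    have ht0' : 0 < 1 + t := by
      have : 0 < t := ht0
      linarith
    rw [ht.2]
    simp only [mul_assoc]
    rw [integral_const_mul, ← Complex.real_smul, smul_smul, ← Real.rpow_add ht0']
    simp
  · have hle := restrict_Ioi_le_halfLine ha
    have hres : halfLine.restrict (Ioi a) = volume.restrict (Ioi a) := by
      rw [Measure.restrict_restrict measurableSet_Ioi, Ioi_inter_Ioi, max_eq_left ha]
    have hu' : MemLp ((Ioi a).indicator u) p halfLine := (Lp.memLp u).indicator measurableSet_Ioi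
    have hcoe := hu'.coeFn_toLp
    -- For `t > a` the kernel sees only `s ≥ t`, so cutting `u` off to `(a, ∞)` changes nothing
    -- there. This locality is the role of the triangularity hypothesis.
    have heq : K u =ᵐ[volume.restrict (Ioi a)] K (hu'.toLp _) := by
      filter_upwards [ae_mono hle (hK u), ae_mono hle (hK (hu'.toLp _)),
        ae_mono hle (Measure.ae_ae_of_ae_prod hk0), ae_restrict_mem measurableSet_Ioi]
        with t h1 h2 h3 hat
      rw [h1.2, h2.2]
      refine integral_congr_ae ?_
      filter_upwards [h3, hcoe] with s hs hs'
      rw [hs']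
      by_cases hsa : s ∈ Ioi a
      · rw [indicator_of_mem hsa]
      · rw [hs (lt_of_le_of_lt (not_lt.1 hsa) hat)]
        simp
    calc eLpNorm (K u) p (volume.restrict (Ioi a))
        = eLpNorm (K (hu'.toLp _)) p (volume.restrict (Ioi a)) := eLpNorm_congr_ae heq
      _ ≤ eLpNorm (K (hu'.toLp _)) p halfLine := eLpNorm_mono_measure _ hle
      _ = ‖K (hu'.toLp _)‖ₑ := (Lp.enorm_def _).symm
      _ ≤ ‖K‖ₑ * ‖hu'.toLp _‖ₑ := K.le_opENorm _
      _ = ‖K‖ₑ * eLpNorm ((Ioi a).indicator u) p halfLine := by rw [Lp.enorm_toLp]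
      _ = ‖K‖ₑ * eLpNorm u p (volume.restrict (Ioi a)) := by
          rw [eLpNorm_indicator_eq_eLpNorm_restrict measurableSet_Ioi, hres]

/-- Multiplication by a weighted bounded function. -/
theorem exists_bound_mul {p : ℝ≥0∞} {δ : ℝ} {b : ℝ → ℂ}
    (hb : MemLp (fun t => (((1 + t) ^ δ : ℝ) : ℂ) * b t) ⊤ halfLine) :
    ∃ C : ℝ≥0∞, C ≠ ⊤ ∧ ∀ u : LpHalf p, ∃ g : ℝ → ℂ, AEStronglyMeasurable g halfLine ∧
      (∀ᵐ t ∂halfLine, b t * u t = ((1 + t) ^ (-δ)) • g t) ∧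
      ∀ a, 0 ≤ a → eLpNorm g p (volume.restrict (Ioi a)) ≤
        C * eLpNorm u p (volume.restrict (Ioi a)) := by
  refine ⟨eLpNorm (fun t => (((1 + t) ^ δ : ℝ) : ℂ) * b t) ⊤ halfLine, hb.2.ne, fun u =>
    ⟨fun t => (((1 + t) ^ δ : ℝ) : ℂ) * b t * u t, hb.1.mul (Lp.aestronglyMeasurable u), ?_,
      fun a ha => ?_⟩⟩
  · filter_upwards [ae_restrict_mem measurableSet_Ioi] with t ht0
    have ht0' : 0 < 1 + t := by
      have : 0 < t := ht0
      linarith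
    rw [mul_assoc, ← Complex.real_smul, smul_smul, ← Real.rpow_add ht0']
    simp
  · have hle := restrict_Ioi_le_halfLine ha
    refine eLpNorm_le_mul_eLpNorm_of_ae_le_mul'' p ((Lp.aestronglyMeasurable u).mono_measure hle) ?_
    rw [eLpNorm_exponent_top]
    filter_upwards [ae_mono hle (enorm_ae_le_eLpNormEssSup
      (fun t => (((1 + t) ^ δ : ℝ) : ℂ) * b t) halfLine)] with t ht
    rw [enorm_mul]
    gcongr

/-! ### Reduction of the operator to the perturbed equation -/

/-- `y` and `z` represent `u` and its derivative, where `H u = μ u + f`. -/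
structure IsHillSol (p : ℝ≥0∞) (q : ℝ → ℝ) (b₁ b₂ : ℝ → ℂ) (k₁ k₂ : ℝ → ℝ → ℂ) (μ : ℝ)
    (u f : LpHalf p) (y z : ℝ → ℂ) : Prop where
  mem : (u, f + (μ : ℂ) • u) ∈ hillGraph p q b₁ b₂ k₁ k₂
  ae_eq : u =ᵐ[halfLine] y
  acy : ∀ R : ℝ, 0 < R → AbsolutelyContinuousOnInterval y 0 R
  acz : ∀ R : ℝ, 0 < R → AbsolutelyContinuousOnInterval z 0 R
  hy : ∀ᵐ t ∂halfLine, HasDerivAt y (z t) t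

namespace IsHillSol

variable {p : ℝ≥0∞} {q : ℝ → ℝ} {b₁ b₂ : ℝ → ℂ} {k₁ k₂ : ℝ → ℝ → ℂ} {μ : ℝ}

theorem exists_of_mem {u f : LpHalf p}
    (h : (u, f + (μ : ℂ) • u) ∈ hillGraph p q b₁ b₂ k₁ k₂) :
    ∃ y z, IsHillSol p q b₁ b₂ k₁ k₂ μ u f y z := by
  obtain ⟨v, w, ⟨g₀, e0, ac0, d0⟩, ⟨g₁, e1, ac1, d1⟩, -⟩ := id h
  refine ⟨g₀, fun t => (-Complex.I) • g₁ t, h, e0, ac0, fun R hR => (ac1 R hR).const_smul _, ?_⟩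
  filter_upwards [d0, e1] with t h1 h2
  rw [smul_eq_mul, ← h2]
  exact h1

theorem sub {u f u' f' : LpHalf p} {y z y' z' : ℝ → ℂ}
    (h : IsHillSol p q b₁ b₂ k₁ k₂ μ u f y z) (h' : IsHillSol p q b₁ b₂ k₁ k₂ μ u' f' y' z') :
    IsHillSol p q b₁ b₂ k₁ k₂ μ (u - u') (f - f') (y - y') (z - z') := by
  refine ⟨?_, ?_, fun R hR => (h.acy R hR).sub (h'.acy R hR),
    fun R hR => (h.acz R hR).sub (h'.acz R hR), ?_⟩
  · have := (hillGraph p q b₁ b₂ k₁ k₂).sub_mem h.mem h'.mem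
    rw [Prod.mk_sub_mk] at this
    convert this using 2
    rw [smul_sub]
    abel
  · exact (Lp.coeFn_sub u u').trans (h.ae_eq.sub h'.ae_eq)
  · filter_upwards [h.hy, h'.hy] with t h1 h2 using h1.sub h2

/-- With `D u = v` and `D² u = w` one has `z = -i v` and `z' = -w`, so solving the operator equation
for `w` gives the forced equation. All four perturbation terms have the form `(1 + t)^(-δ) g`, with
a constant that depends neither on `μ` nor on `u`. -/
theorem exists_isPertSol [Fact (1 ≤ p)] {δ : ℝ}
    (hb₁δ : MemLp (fun t => (((1 + t) ^ δ : ℝ) : ℂ) * b₁ t) ⊤ halfLine)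
    (hb₂δ : MemLp (fun t => (((1 + t) ^ δ : ℝ) : ℂ) * b₂ t) ⊤ halfLine)
    (hk₁_zero : ∀ᵐ z ∂(halfLine.prod halfLine), z.2 < z.1 → k₁ z.1 z.2 = 0)
    (hk₂_zero : ∀ᵐ z ∂(halfLine.prod halfLine), z.2 < z.1 → k₂ z.1 z.2 = 0)
    (hk₁δ : IsBoundedIntegralKernel p (fun t s => (((1 + t) ^ δ : ℝ) : ℂ) * k₁ t s))
    (hk₂δ : IsBoundedIntegralKernel p (fun t s => (((1 + t) ^ δ : ℝ) : ℂ) * k₂ t s)) :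
    ∃ C : ℝ≥0∞, C ≠ ⊤ ∧ ∀ (μ : ℝ) (u f : LpHalf p) (y z : ℝ → ℂ),
      IsHillSol p q b₁ b₂ k₁ k₂ μ u f y z → IsPertSol p (fun t => q t - μ) δ C f y z := by
  have hp1 : 1 ≤ p := Fact.out
  obtain ⟨C₁, hC₁, H₁⟩ := exists_bound_mul (p := p) hb₁δ
  obtain ⟨C₂, hC₂, H₂⟩ := exists_bound_mul (p := p) hb₂δ
  obtain ⟨C₃, hC₃, H₃⟩ := hk₁δ.exists_bound hk₁_zero
  obtain ⟨C₄, hC₄, H₄⟩ := hk₂δ.exists_bound hk₂_zero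
  refine ⟨C₁ + C₂ + C₃ + C₄, by finiteness, fun μ u f y z hs => ?_⟩
  obtain ⟨v, w, ⟨g₀, e0, ac0, d0⟩, ⟨g₁, e1, ac1, d1⟩, heq⟩ := hs.mem
  -- The representatives stored in the graph need not be `y` and `z`; absolute continuity upgrades
  -- almost everywhere equality to equality on `(0, ∞)`, so that derivatives can be compared.
  simp only at e0 d0 e1 d1 heq
  have hy0 : EqOn y g₀ (Ioi 0) := eqOn_of_ae_eq_halfLine hs.acy ac0 (hs.ae_eq.symm.trans e0)
  have ac1' : ∀ R : ℝ, 0 < R → AbsolutelyContinuousOnInterval (fun t => (-Complex.I) • g₁ t) 0 R :=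
    fun R hR => (ac1 R hR).const_smul _
  have hzv : ∀ᵐ t ∂halfLine, z t = -Complex.I * v t := by
    filter_upwards [hs.hy, d0, ae_restrict_mem measurableSet_Ioi] with t h1 h2 ht
    exact h1.unique (h2.congr_of_eventuallyEq (hy0.eventuallyEq_of_mem (Ioi_mem_nhds ht)))
  have hz1 : EqOn z (fun t => (-Complex.I) • g₁ t) (Ioi 0) := by
    refine eqOn_of_ae_eq_halfLine hs.acz ac1' ?_
    filter_upwards [hzv, e1] with t h1 h2
    rw [h1, h2, smul_eq_mul]
  have hz' : ∀ᵐ t ∂halfLine, HasDerivAt z (-(w t)) t := by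
    filter_upwards [d1, ae_restrict_mem measurableSet_Ioi] with t h1 ht
    have h2 := (h1.const_smul (-Complex.I)).congr_of_eventuallyEq
      (hz1.eventuallyEq_of_mem (Ioi_mem_nhds ht))
    refine h2.congr_deriv ?_
    rw [smul_eq_mul]
    linear_combination w t * Complex.I_sq
  have hvn : ∀ a, 0 ≤ a → eLpNorm v p (volume.restrict (Ioi a)) =
      eLpNorm z p (volume.restrict (Ioi a)) := fun a ha => by
    refine eLpNorm_congr_norm_ae ?_
    filter_upwards [ae_mono (restrict_Ioi_le_halfLine ha) hzv] with t ht
    rw [ht]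
    simp
  have hun : ∀ a, 0 ≤ a → eLpNorm u p (volume.restrict (Ioi a)) =
      eLpNorm y p (volume.restrict (Ioi a)) := fun a ha =>
    eLpNorm_congr_ae (ae_mono (restrict_Ioi_le_halfLine ha) hs.ae_eq)
  obtain ⟨g₁', m1, r1, n1⟩ := H₁ v
  obtain ⟨g₂', m2, r2, n2⟩ := H₂ u
  obtain ⟨g₃', m3, r3, n3⟩ := H₃ v
  obtain ⟨g₄', m4, r4, n4⟩ := H₄ u
  have memz : MemLp z p halfLine := by
    refine MemLp.ae_eq ?_ ((Lp.memLp v).const_mul (-Complex.I))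
    filter_upwards [hzv] with t ht using ht.symm
  refine ⟨Lp.memLp f, (memLp_congr_ae hs.ae_eq).1 (Lp.memLp u), memz,
    fun t => g₁' t + g₂' t + g₃' t + g₄' t, ((m1.add m2).add m3).add m4,
    ⟨hs.acy, hs.acz, hs.hy, ?_⟩, fun a ha => ?_⟩
  · filter_upwards [hz', heq, hs.ae_eq, r1, r2, r3, r4, Lp.coeFn_add f ((μ : ℂ) • u),
      Lp.coeFn_smul (μ : ℂ) u] with t h1 ⟨_, _, h2⟩ h3 h4 h5 h6 h7 h8 h9
    refine h1.congr_deriv ?_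
    rw [h4, h5, h6, h7, h8, Pi.add_apply, h9, Pi.smul_apply, h3] at h2
    simp only [Complex.real_smul, smul_eq_mul] at h2 ⊢
    push_cast at h2 ⊢
    linear_combination h2
  · have hle := restrict_Ioi_le_halfLine ha
    have t1 := n1 a ha
    have t2 := n2 a ha
    have t3 := n3 a ha
    have t4 := n4 a ha
    rw [hvn a ha] at t1 t3
    rw [hun a ha] at t2 t4
    have m1' := m1.mono_measure hle
    have m2' := m2.mono_measure hle
    have m3' := m3.mono_measure hle
    have m4' := m4.mono_measure hle
    calc eLpNorm (fun t => g₁' t + g₂' t + g₃' t + g₄' t) p (volume.restrict (Ioi a))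
        ≤ eLpNorm g₁' p (volume.restrict (Ioi a)) + eLpNorm g₂' p (volume.restrict (Ioi a)) +
          eLpNorm g₃' p (volume.restrict (Ioi a)) + eLpNorm g₄' p (volume.restrict (Ioi a)) := by
          refine (eLpNorm_add_le (f := g₁' + g₂' + g₃') (g := g₄') ((m1'.add m2').add m3') m4'
            hp1).trans (add_le_add ?_ le_rfl)
          refine (eLpNorm_add_le (f := g₁' + g₂') (g := g₃') (m1'.add m2') m3'
            hp1).trans (add_le_add ?_ le_rfl)
          exact eLpNorm_add_le m1' m2' hp1
      _ ≤ C₁ * phaseLp p y z a + C₂ * phaseLp p y z a + C₃ * phaseLp p y z a +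
          C₄ * phaseLp p y z a := by
          refine add_le_add (add_le_add (add_le_add ?_ ?_) ?_) ?_
          · exact t1.trans (mul_le_mul_right eLpNorm_snd_le_phaseLp _)
          · exact t2.trans (mul_le_mul_right eLpNorm_fst_le_phaseLp _)
          · exact t3.trans (mul_le_mul_right eLpNorm_snd_le_phaseLp _)
          · exact t4.trans (mul_le_mul_right eLpNorm_fst_le_phaseLp _)
      _ = _ := by ring

end IsHillSol

/-! ## The main theorem -/

theorem IsPertSol.congr {p : ℝ≥0∞} {Q : ℝ → ℝ} {δ : ℝ} {C : ℝ≥0∞} {f f' y z : ℝ → ℂ}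
    (hs : IsPertSol p Q δ C f y z) (h : f =ᵐ[halfLine] f') : IsPertSol p Q δ C f' y z := by
  obtain ⟨g, hg, ⟨ay, az, dy, dz⟩, hle⟩ := hs.forced
  refine ⟨(memLp_congr_ae h).1 hs.memf, hs.memy, hs.memz, g, hg, ⟨ay, az, dy, ?_⟩, hle⟩
  filter_upwards [dz, h] with t h1 h2
  rw [← h2]
  exact h1

theorem cross_sub (φ φ' : ℝ → ℝ) (y z y' z' : ℝ → ℂ) (t : ℝ) :
    cross φ φ' (y - y') (z - z') t = cross φ φ' y z t - cross φ φ' y' z' t := by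
  simp only [cross, Pi.sub_apply, smul_sub]
  ring

/-- A bounded potential, shifted by parameters near `μ`, is uniformly bounded. -/
theorem exists_isBddCoeff {q : ℝ → ℝ} (hq : MemLp q ⊤ halfLine) (μ : ℝ) :
    ∃ M, ∀ d, |d| ≤ 1 → IsBddCoeff (fun t => q t - μ - d) M := by
  have hb := ae_le_eLpNormEssSup (f := q) (μ := halfLine)
  rw [← eLpNorm_exponent_top] at hb
  set B := (eLpNorm q ⊤ halfLine).toReal with hB
  refine ⟨B + |μ| + 1, fun d hd => ⟨?_, ?_, ?_⟩⟩
  · exact (hq.1.sub aestronglyMeasurable_const).sub aestronglyMeasurable_const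
  · have : 0 ≤ B := ENNReal.toReal_nonneg
    have := abs_nonneg μ
    linarith
  · filter_upwards [hb] with t ht
    have h1 : |q t| ≤ B := by
      have := ENNReal.toReal_mono hq.2.ne ht
      simpa [hB] using this
    have h2 := abs_sub (q t - μ) d
    have h3 := abs_sub (q t) μ
    linarith

section

variable {p : ℝ≥0∞} {q : ℝ → ℝ} {b₁ b₂ : ℝ → ℂ} {k₁ k₂ : ℝ → ℝ → ℂ} {μ : ℝ}

theorem exists_isHillSol (u : (hillOperator p q b₁ b₂ k₁ k₂).domain) (f : LpHalf p)
    (hf : hillOperator p q b₁ b₂ k₁ k₂ u - (μ : ℂ) • (u : LpHalf p) = f) :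
    ∃ y z, IsHillSol p q b₁ b₂ k₁ k₂ μ u f y z := by
  refine IsHillSol.exists_of_mem ?_
  rw [← hf, sub_add_cancel, ← hillOperator_graph]
  exact LinearPMap.mem_graph _ u

theorem IsHillSol.enorm_le_phaseLp {u f : LpHalf p} {y z : ℝ → ℂ}
    (h : IsHillSol p q b₁ b₂ k₁ k₂ μ u f y z) : ‖u‖ₑ ≤ phaseLp p y z 0 := by
  rw [Lp.enorm_def, eLpNorm_congr_ae h.ae_eq]
  exact eLpNorm_fst_le_phaseLp

/-- The gaps of the unperturbed equation contain no continuous spectrum. -/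
theorem notMem_continuousSpectrum [Fact (1 ≤ p)] (hp : p ≠ ⊤) {δ : ℝ} (hδ : 1 < δ) {M : ℝ}
    (hQ : IsBddCoeff (fun t => q t - μ) M) {C : ℝ≥0∞} (hC : C ≠ ⊤)
    (H : ∀ (u f : LpHalf p) (y z : ℝ → ℂ),
      IsHillSol p q b₁ b₂ k₁ k₂ μ u f y z → IsPertSol p (fun t => q t - μ) δ C f y z)
    {φ φ' ψ ψ' : ℝ → ℝ} {ρ κ K : ℝ} (hd : IsDichotomy (fun t => q t - μ) φ φ' ψ ψ' ρ κ K) :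
    (μ : ℂ) ∉ continuousSpectrum (hillOperator p q b₁ b₂ k₁ k₂) := by
  rintro ⟨u, ⟨R, hR⟩, hnc, hlim⟩
  obtain ⟨n, L, hL, hest⟩ := hd.exists_estimate Fact.out hp hQ hδ hC
  lift L to NNReal using hL
  set f : ℕ → LpHalf p := fun k => hillOperator p q b₁ b₂ k₁ k₂ (u k) - (μ : ℂ) • (u k : LpHalf p)
  choose y z hyz using fun k => exists_isHillSol (u k) (f k) rfl
  set X : ℕ → ℂ := fun k => cross ψ ψ' (y k) (z k) n with hX
  have hXb : ∀ k, ‖X k‖ ≤ L * (‖(u k : LpHalf p)‖ + ‖f k‖) := fun k => by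
    have := (hest _ _ _ (H _ _ _ _ (hyz k))).1
    rw [← eLpNorm_congr_ae (hyz k).ae_eq, ← Lp.enorm_def, ← Lp.enorm_def] at this
    simp only [enorm_eq_nnnorm] at this
    exact_mod_cast this
  -- Differences solve the same equation, so distances between the `u j` reduce to distances between
  -- complex numbers and between residuals.
  have hsub : ∀ j k, ‖(u j : LpHalf p) - u k‖ ≤ L * (‖X j - X k‖ + ‖f j - f k‖) := fun j k => by
    have hs := (hyz j).sub (hyz k)
    have := hs.enorm_le_phaseLp.trans (hest _ _ _ (H _ _ _ _ hs)).2
    rw [cross_sub, ← Lp.enorm_def] at this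
    simp only [enorm_eq_nnnorm] at this
    exact_mod_cast this
  obtain ⟨F, hF⟩ := hlim.norm.bddAbove_range
  have hXball : ∀ k, X k ∈ Metric.closedBall (0 : ℂ) (L * (R + F)) := fun k => by
    rw [mem_closedBall_zero_iff]
    refine (hXb k).trans ?_
    gcongr
    · exact hR k
    · exact hF ⟨k, rfl⟩
  -- The functional takes values in `ℂ`, where bounded sequences have convergent subsequences; along
  -- such a subsequence `u` is Cauchy, contrary to the choice of the sequence.
  obtain ⟨x, -, θ, hθ, hx⟩ := (isCompact_closedBall (0 : ℂ) (L * (R + F))).tendsto_subseq hXball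
  refine hnc θ hθ (cauchySeq_tendsto_of_complete ?_)
  have hfc : CauchySeq (f ∘ θ) := (hlim.comp hθ.tendsto_atTop).cauchySeq
  have hXc : CauchySeq (X ∘ θ) := hx.cauchySeq
  rw [cauchySeq_iff_tendsto_dist_atTop_0] at hfc hXc ⊢
  have hsum := (hXc.add hfc).const_mul (L : ℝ)
  rw [add_zero, mul_zero] at hsum
  refine squeeze_zero (fun _ => dist_nonneg) (fun i => ?_) hsum
  simp only [dist_eq_norm]
  exact hsub _ _

end

theorem mainTheorem3 (p : ℝ≥0∞) [Fact (1 ≤ p)] (hp : p ≠ ⊤)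
    (q : ℝ → ℝ) (hq : MemLp q ⊤ halfLine) (hq_per : Function.Periodic q 1)
    (b₁ b₂ : ℝ → ℂ) (hb₁ : MemLp b₁ ⊤ halfLine) (hb₂ : MemLp b₂ ⊤ halfLine)
    (k₁ k₂ : ℝ → ℝ → ℂ)
    (hk₁ : MemLp (Function.uncurry k₁) ⊤ (halfLine.prod halfLine))
    (hk₂ : MemLp (Function.uncurry k₂) ⊤ (halfLine.prod halfLine))
    (δ : ℝ) (hδ : 1 < δ)
    (hb₁δ : MemLp (fun t => (((1 + t) ^ δ : ℝ) : ℂ) * b₁ t) ⊤ halfLine)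
    (hb₂δ : MemLp (fun t => (((1 + t) ^ δ : ℝ) : ℂ) * b₂ t) ⊤ halfLine)
    (hk₁_zero : ∀ᵐ z ∂(halfLine.prod halfLine), z.2 < z.1 → k₁ z.1 z.2 = 0)
    (hk₂_zero : ∀ᵐ z ∂(halfLine.prod halfLine), z.2 < z.1 → k₂ z.1 z.2 = 0)
    (hk₁δ : IsBoundedIntegralKernel p (fun t s => (((1 + t) ^ δ : ℝ) : ℂ) * k₁ t s))
    (hk₂δ : IsBoundedIntegralKernel p (fun t s => (((1 + t) ^ δ : ℝ) : ℂ) * k₂ t s))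
    (lam : ℝ)
    (hlam : lam ∈ interior {x : ℝ | (x : ℂ) ∈
      continuousSpectrum (hillOperator p q b₁ b₂ k₁ k₂)}) :
    ¬ IsEigenvalue (hillOperator p q b₁ b₂ k₁ k₂) (lam : ℂ) := by
  obtain ⟨C, hC, H⟩ := IsHillSol.exists_isPertSol (q := q) hb₁δ hb₂δ hk₁_zero hk₂_zero hk₁δ hk₂δ
  obtain ⟨M, hM⟩ := exists_isBddCoeff hq lam
  obtain ⟨ε, hε, hball⟩ := Metric.mem_nhds_iff.1 (mem_interior_iff_mem_nhds.1 hlam)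
  have hper : ∀ d : ℝ, Function.Periodic (fun t => q t - lam - d) 1 := fun d t => by
    simp only [hq_per t]
  -- Radius `ε` keeps `λ + d` in the continuous spectrum, radius `1` keeps one bound `M` for all
  -- shifted coefficients. A discriminant beyond `2` in modulus would place `λ + d` in a gap.
  have hle : ∀ d, |d| < min ε 1 → ∀ γ γ' σ σ',
      IsFund (fun t => q t - lam - d) γ γ' σ σ' → |γ 1 + σ' 1| ≤ 2 := by
    intro d hdη γ γ' σ σ' hfund
    by_contra! hgt
    have hd1 : |d| ≤ 1 := (hdη.trans_le (min_le_right _ _)).le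
    obtain ⟨φ, φ', ψ, ψ', ρ, κ, K, hd⟩ := hfund.exists_dichotomy (hM d hd1) (hper d) hgt
    have e : (fun t => q t - lam - d) = fun t => q t - (lam + d) := by
      ext t
      ring
    have hQ := hM d hd1
    rw [e] at hQ hd
    refine notMem_continuousSpectrum hp hδ hQ hC (H (lam + d)) hd ?_
    have hmem : lam + d ∈ Metric.ball lam ε := by
      rw [Metric.mem_ball, Real.dist_eq, add_sub_cancel_left]
      exact hdη.trans_le (min_le_left _ _)
    exact hball hmem
  have hη : 0 < min ε 1 := lt_min hε one_pos
  have hQ : IsBddCoeff (fun t => q t - lam) M := by simpa using hM 0 (by simp)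
  have hper0 : Function.Periodic (fun t => q t - lam) 1 := by simpa using hper 0
  obtain ⟨c, c', s, s', hfund⟩ := hQ.exists_isFund
  -- Inside a band boundedness is automatic; at `|Δ| = 2` it holds because the inequality persists
  -- on both sides of `λ`, as at a closed gap.
  have hst : IsFund.Stable c c' s s' := by
    rcases (hle 0 (by simpa using hη) c c' s s' (by simpa using hfund)).lt_or_eq with hD | hD
    · exact hfund.stable_of_abs_lt hQ hper0 hD
    · obtain ⟨h1, h2, h3⟩ := hfund.scalar_of_discriminant hQ hD hη
        (fun d hd => hM d (hd.trans_le (min_le_right _ _)).le) hle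
      exact hfund.stable_of_scalar hQ hper0 h1 h2 h3
  rintro ⟨u, hu0, hu⟩
  obtain ⟨y, z, hyz⟩ := exists_isHillSol u 0 (sub_eq_zero.2 hu)
  have hzero := IsPertSol.phaseLp_eq_zero_of_stable Fact.out hp hQ hδ hC hfund hst
    ((H _ _ _ _ _ hyz).congr (Lp.coeFn_zero ℂ p halfLine))
  have := hyz.enorm_le_phaseLp
  rw [hzero, nonpos_iff_eq_zero, enorm_eq_zero] at this
  exact hu0 this
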